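/- For $x\in\mathbb{R}^n$ let $B(x,r)$ denote the ball of center $x$ and radius $r$, and write $\|f\|_p$ for the norm of $L^p(\mathbb{R}^n)$. For $\rho\in L^1_+(\mathbb{R}^n)\cap L^\infty(\mathbb{R}^n)$ (non-negative, integrable and essentially bounded) let $$\mathcal{E}_W[\rho]=\int_{\mathbb{R}^n}\int_{\mathbb{R}^n}\rho(x)\rho(y)W(x-y)\,dx\,dy ,\qquad \delta(\rho)=\inf_{a\in\mathbb{R}^n}\frac{\|\rho(\cdot+a)-\rho^*\|_1}{2\|\rho\|_1},$$ where $\rho^*$ is the radially symmetric decreasing rearrangement of $\rho$, i.e. $\rho^*(x)=\int_0^\infty 1_{\{\rho>t\}^*}(x)\,dt$, with $A^*$ the open ball centered at $0$ with $|A^*|=|A|$. Let the potential $W:\mathbb{R}^n\to\mathbb{R}$ satisfy: (W1) $W\in C^1(\mathbb{R}^n\setminus\{0\})\cap L^1_{loc}(\mathbb{R}^n)$ is radial, $W(x)=w(|x|)$ for $x\neq 0$; (W2) $w'(r)<0$ for all $r>0$; (W3) there is $c>0$ with $w'(r)\le -cr$ for all $r\in(0,1)$. For $k\in\mathbb{R}$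 let $W_k(x)=-|x|^k/k$ if $k\ne0$, and $W_0(x)=-\log|x|$. Let $R_*>0$. In all statements below $\rho$ ranges over the elements of $L^1_+(\mathbb{R}^n)\cap L^\infty(\mathbb{R}^n)$ with $\operatorname{supp}\rho^*\subset \overline{B(0,R_*)}$ (the support of $\rho$ itself need not be bounded). For such $\rho$, and for $W$ as above or $W=W_k$ with $k\in(-n,2]$, $\mathcal{E}_W[\rho]$ is well defined in $[-\infty,\infty)$ and $\mathcal{E}_W[\rho^*]$ is finite, and the following holds (for $\rho=0$ the right-hand sides are read as $0$). (i) If $n\ge2$, there is a constant $c(n,W,R_*)>0$, depending only on $n$, $W$ and $R_*$, such that for all such $\rho$ $$\mathcal{E}_W[\rho^*]-\mathcal{E}_W[\rho]\ \ge\ c(n,W,R_*)\,\|\rho\|_1^{2+\frac2n}\,\|\rho\|_\infty^{-\frac2n}\,\delta(\rho)^2 .\qquad(*)$$ Moreover, there is $c(n)>0$, depending only on $n$, such that for all $k\in(-n,2]$ and all $R_*>0$, $(*)$ holds for $W=W_k$ with constant $c(n,W_k,R_*)=c(n)R_*^{k-2}$. (ii) If $n=1$, both assertions of (i) hold (with $k\in(-1,2]$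 in the second) for those $\rho$ that are a multiple $b\,1_D$ of the characteristic function of a measurable set $D$. (iii) If $n=1$ and $\rho$ is general, both assertions of (i) hold (with $k\in(-1,2]$ in the second) with $\delta(\rho)^2$ replaced by $\delta(\rho)^3$. -/

import Mathlib

open MeasureTheory Set
open scoped ENNReal

noncomputable section

namespace InteractionEnergy

/-- Euclidean space `ℝⁿ`. -/
abbrev Rn (n : ℕ) : Type := EuclideanSpace ℝ (Fin n)

/-- The assumptions on the interaction potential: `W ∈ C¹(ℝⁿ \ {0}) ∩ L¹_loc(ℝⁿ)` is radial with
profile `w` on `(0, ∞)`, `w' < 0` on `(0, ∞)`, and `w'(r) ≤ -c r` on `(0, 1)` for some `c > 0`.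
The values of `W` at the origin and of `w` on `(-∞, 0]` play no role. -/
def IsAdmissible {n : ℕ} (W : Rn n → ℝ) : Prop :=
  ContDiffOn ℝ 1 W {0}ᶜ ∧ LocallyIntegrable W volume ∧
    ∃ w : ℝ → ℝ, (∀ x : Rn n, x ≠ 0 → W x = w ‖x‖) ∧
      (∀ r : ℝ, 0 < r → deriv w r < 0) ∧
      ∃ c : ℝ, 0 < c ∧ ∀ r ∈ Ioo (0 : ℝ) 1, deriv w r ≤ -c * r

/-- The power-law potential `W_k(x) = -|x|^k / k` for `k ≠ 0`, and `W_0(x) = -log |x|`. -/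
def powerLaw (n : ℕ) (k : ℝ) (x : Rn n) : ℝ :=
  if k = 0 then -Real.log ‖x‖ else -(‖x‖ ^ k) / k

/-- `ρ ∈ L¹₊(ℝⁿ) ∩ L^∞(ℝⁿ)`. -/
def IsDensity {n : ℕ} (ρ : Rn n → ℝ) : Prop :=
  MemLp ρ 1 volume ∧ MemLp ρ ∞ volume ∧ 0 ≤ᵐ[volume] ρ

/-- `ρ` is (a.e. equal to) a multiple of the characteristic function of a measurable set. -/
def IsMultipleOfCharFun {n : ℕ} (ρ : Rn n → ℝ) : Prop :=
  ∃ (b : ℝ) (D : Set (Rn n)), MeasurableSet D ∧ ρ =ᵐ[volume] D.indicator (fun _ => b)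

/-- The symmetric rearrangement of a set of finite volume: the open ball centred at the origin
with the same volume. -/
def symmSet {n : ℕ} (A : Set (Rn n)) : Set (Rn n) :=
  Metric.ball 0 ((volume A / volume (Metric.ball (0 : Rn n) 1)).toReal ^ (1 / (n : ℝ)))

/-- The radially symmetric decreasing rearrangement `f*(x) = ∫₀^∞ 1_{{|f| > t}*}(x) dt`. -/
def rearrangement {n : ℕ} (f : Rn n → ℝ) (x : Rn n) : ℝ :=
  ∫ t in Ioi (0 : ℝ), (symmSet {y | t < |f y|}).indicator (fun _ => (1 : ℝ)) x

/-- The integral of the positive part of `ρ(x) ρ(y) W(x - y)`. -/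
def energyPos {n : ℕ} (W ρ : Rn n → ℝ) : ℝ≥0∞ :=
  ∫⁻ x, ∫⁻ y, ENNReal.ofReal (ρ x * ρ y * W (x - y))

/-- The integral of the negative part of `ρ(x) ρ(y) W(x - y)`. -/
def energyNeg {n : ℕ} (W ρ : Rn n → ℝ) : ℝ≥0∞ :=
  ∫⁻ x, ∫⁻ y, ENNReal.ofReal (-(ρ x * ρ y * W (x - y)))

/-- The interaction energy `E_W[ρ] = ∬ ρ(x) ρ(y) W(x - y) dx dy` as an extended real number. It is
meaningful when the positive part has a finite integral; the value may then be `-∞`, since `W` may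
tend to `-∞` at infinity and `ρ` need not have compact support. -/
def energy {n : ℕ} (W ρ : Rn n → ℝ) : EReal :=
  (energyPos W ρ : EReal) - (energyNeg W ρ : EReal)

/-- The norm `‖f‖_p` on `L^p(ℝⁿ)`, as a real number. -/
def normLp {n : ℕ} (p : ℝ≥0∞) (f : Rn n → ℝ) : ℝ :=
  (eLpNorm f p volume).toReal

/-- The asymmetry `δ(ρ) = inf_a ‖ρ(· + a) - ρ*‖₁ / (2 ‖ρ‖₁)`. -/
def asymmetry {n : ℕ} (ρ : Rn n → ℝ) : ℝ :=
  ⨅ a : Rn n, normLp 1 (fun x => ρ (x + a) - rearrangement ρ x) / (2 * normLp 1 ρ)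

/-- `E_W[ρ]` is well defined in `[-∞, ∞)`, `E_W[ρ*]` is finite, and
`E_W[ρ*] - E_W[ρ] ≥ c ‖ρ‖₁^{2 + 2/n} ‖ρ‖_∞^{-2/n} δ(ρ)^p`. -/
def StabilityEstimate {n : ℕ} (W ρ : Rn n → ℝ) (c : ℝ) (p : ℕ) : Prop :=
  energyPos W ρ ≠ ∞ ∧
  energyPos W (rearrangement ρ) ≠ ∞ ∧ energyNeg W (rearrangement ρ) ≠ ∞ ∧
  ((c * normLp 1 ρ ^ (2 + 2 / (n : ℝ)) * normLp ∞ ρ ^ (-(2 / (n : ℝ))) * asymmetry ρ ^ p : ℝ) :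
      EReal) ≤ energy W (rearrangement ρ) - energy W ρ

end InteractionEnergy

end

/-! The potential is compared with the truncated quadratic `cap L r` = (L² - r²)₊, where L = 6R and
R is the radius of a ball containing the support of ρ*. On (0, L) the profile satisfies w'(r) ≤ -2cr
for some c > 0, so w - c·cap is still nonincreasing. By the Riesz rearrangement inequality this
remainder does not lower the energy gap (`energy_gap_ge`), and it suffices to prove stability for
the single kernel cap.

For this kernel the energy is a truncated second moment. Let m be the mass. Distances within the
support of ρ* are at most 2R < L, so the energy of ρ* is at least m²L² - 2m∫ρ*|x|². For ρ there are
two cases (`capGap_dichotomy`). If ρ has large truncated second moment about every point, the gap is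
at least m²R², which is more than needed. Otherwise ρ is concentrated near some a. The nearest-point
projection onto the ball of radius 3R about a is 1-Lipschitz with image of diameter at most L, and
replacing the points by their projections bounds the energy of ρ by m²L² - 2m∫ρ min(|x-b|², R²) for
a suitable b. The gap is then at least 2m times the difference of the moments of the translate
ρ(·+b) and of ρ* against min(|x|², R²), which is linear in the layers of ρ.

That difference is handled by a quantitative bathtub principle on each level set (`bathtub_level`).
If a set of volume v, with symmetrized radius r ≤ R, misses a volume d of its symmetrized ball, then
at least d/2 of the missing part lies at depth of order rd/(nv) below the sphere, and the moment
increases by at least d²r²/(4nv), that is, a constant times d²v^(2/n-1). Integration over the levels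
uses Cauchy–Schwarz and, for n ≥ 2, the concavity of v^(1-2/n). For n = 1 the weight is v, and only
v ≥ d is available in general, whence the cube. If all levels have the same volume the square
survives. The integral of d over the levels is at least m times the asymmetry.

The Riesz inequality is proved by polarization. For continuous compactly supported f, the functions
equimeasurable with f, with the same moduli of continuity and support bound and at least the energy
of f, form a compact set by Arzelà–Ascoli. A minimizer of the second moment in it is radially
nonincreasing, since polarization stays in the set and would otherwise lower the moment; so it
equals f*. Density in L¹ and truncation of the kernel give the general case. -/

noncomputable section

namespace InteractionEnergy

/-! ### Symmetrized sets -/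

/-- The radius of the symmetric rearrangement of a set. -/
def symmRadius {n : ℕ} (A : Set (Rn n)) : ℝ :=
  (volume A / volume (Metric.ball (0 : Rn n) 1)).toReal ^ (1 / (n : ℝ))

theorem symmSet_eq_ball {n : ℕ} (A : Set (Rn n)) : symmSet A = Metric.ball 0 (symmRadius A) := rfl

theorem mem_symmSet {n : ℕ} {A : Set (Rn n)} {x : Rn n} : x ∈ symmSet A ↔ ‖x‖ < symmRadius A := by
  rw [symmSet_eq_ball, mem_ball_zero_iff]

theorem symmRadius_nonneg {n : ℕ} (A : Set (Rn n)) : 0 ≤ symmRadius A :=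
  Real.rpow_nonneg ENNReal.toReal_nonneg _

/-- The volume of the unit ball. -/
def unitVol (n : ℕ) : ℝ := volume.real (Metric.ball (0 : Rn n) 1)

theorem unitVol_pos (n : ℕ) : 0 < unitVol n :=
  ENNReal.toReal_pos (Metric.measure_ball_pos volume 0 one_pos).ne' measure_ball_lt_top.ne

theorem volumeReal_ball {n : ℕ} (hn : 0 < n) (x : Rn n) {r : ℝ} (hr : 0 ≤ r) :
    volume.real (Metric.ball x r) = r ^ n * unitVol n := by
  have : Nonempty (Fin n) := ⟨⟨0, hn⟩⟩
  rw [measureReal_def, Measure.addHaar_ball volume x hr, ENNReal.toReal_mul, finrank_euclideanSpace,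
    Fintype.card_fin, ENNReal.toReal_ofReal (pow_nonneg hr n)]
  rfl

theorem symmRadius_eq {n : ℕ} (A : Set (Rn n)) :
    symmRadius A = (volume.real A / unitVol n) ^ (1 / (n : ℝ)) := by
  rw [symmRadius, ENNReal.toReal_div]; rfl

theorem symmRadius_pow {n : ℕ} (hn : 0 < n) (A : Set (Rn n)) :
    symmRadius A ^ n = volume.real A / unitVol n := by
  rw [symmRadius_eq, one_div, Real.rpow_inv_natCast_pow _ hn.ne']
  exact div_nonneg measureReal_nonneg (unitVol_pos n).le

theorem volumeReal_symmSet {n : ℕ} (hn : 0 < n) (A : Set (Rn n)) :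
    volume.real (symmSet A) = volume.real A := by
  rw [symmSet_eq_ball, volumeReal_ball hn _ (symmRadius_nonneg A), symmRadius_pow hn,
    div_mul_cancel₀ _ (unitVol_pos n).ne']

theorem symmRadius_mono {n : ℕ} {A B : Set (Rn n)} (hB : volume B ≠ ∞) (h : volume A ≤ volume B) :
    symmRadius A ≤ symmRadius B := by
  rw [symmRadius_eq, symmRadius_eq]
  have : volume.real A ≤ volume.real B := ENNReal.toReal_mono hB h
  have := unitVol_pos n
  gcongr

theorem symmRadius_ball {n : ℕ} (hn : 0 < n) (x : Rn n) {r : ℝ} (hr : 0 ≤ r) :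
    symmRadius (Metric.ball x r) = r := by
  rw [symmRadius_eq, volumeReal_ball hn x hr, mul_div_assoc, div_self (unitVol_pos n).ne', mul_one,
    one_div, Real.pow_rpow_inv_natCast hr hn.ne']

theorem symmRadius_of_volume_zero {n : ℕ} (hn : 0 < n) {A : Set (Rn n)} (h : volume A = 0) :
    symmRadius A = 0 := by
  rw [symmRadius_eq, measureReal_def, h]
  simp [Real.zero_rpow, hn.ne']

theorem isOpen_symmSet {n : ℕ} (A : Set (Rn n)) : IsOpen (symmSet A) := Metric.isOpen_ball

theorem volume_symmSet_ne_top {n : ℕ} (A : Set (Rn n)) : volume (symmSet A) ≠ ∞ :=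
  measure_ball_lt_top.ne

/-! ### Layers -/

/-- Bounded, nonnegative, integrable functions, defined and measurable everywhere. -/
structure IsLayered {n : ℕ} (N : ℝ) (f : Rn n → ℝ) : Prop where
  measurable : Measurable f
  nonneg : ∀ x, 0 ≤ f x
  le : ∀ x, f x ≤ N
  integrable : Integrable f volume

namespace IsLayered

variable {n : ℕ} {N : ℝ} {f : Rn n → ℝ}

theorem bound_nonneg (hf : IsLayered N f) : 0 ≤ N := (hf.nonneg 0).trans (hf.le 0)

theorem mono (hf : IsLayered N f) {M : ℝ} (h : N ≤ M) : IsLayered M f :=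
  ⟨hf.measurable, hf.nonneg, fun x => (hf.le x).trans h, hf.integrable⟩

theorem abs_eq (hf : IsLayered N f) (t : ℝ) : {y | t < |f y|} = {y | t < f y} := by
  ext y; simp [abs_of_nonneg (hf.nonneg y)]

theorem measurableSet_level (hf : IsLayered N f) (t : ℝ) : MeasurableSet {y | t < f y} :=
  measurableSet_lt measurable_const hf.measurable

theorem volume_level_ne_top (hf : IsLayered N f) {t : ℝ} (ht : 0 < t) :
    volume {y | t < f y} ≠ ∞ := (hf.integrable.measure_gt_lt_top ht).ne

theorem comp_add (hf : IsLayered N f) (a : Rn n) : IsLayered N (fun x => f (x + a)) :=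
  ⟨hf.measurable.comp (measurable_add_const a), fun _ => hf.nonneg _, fun _ => hf.le _,
    hf.integrable.comp_add_right a⟩

end IsLayered

/-- The measure on `(0, N) × ℝⁿ`. -/
abbrev layerMeasure (n : ℕ) (N : ℝ) : Measure (ℝ × Rn n) :=
  (volume.restrict (Ioo (0 : ℝ) N)).prod volume

/-- The indicator of the subgraph of `f`. -/
def layer {n : ℕ} (f : Rn n → ℝ) (p : ℝ × Rn n) : ℝ := if p.1 < f p.2 then 1 else 0

/-- The indicator of the subgraph of the rearrangement of `f`. -/
def symmLayer {n : ℕ} (f : Rn n → ℝ) (p : ℝ × Rn n) : ℝ :=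
  (symmSet {y | p.1 < |f y|}).indicator (fun _ => (1 : ℝ)) p.2

section
variable {n : ℕ} {N : ℝ} {f : Rn n → ℝ}

theorem layer_nonneg (f : Rn n → ℝ) (p : ℝ × Rn n) : 0 ≤ layer f p := by
  unfold layer; split_ifs <;> simp

theorem layer_le_one (f : Rn n → ℝ) (p : ℝ × Rn n) : layer f p ≤ 1 := by
  unfold layer; split_ifs <;> simp

theorem symmLayer_nonneg (f : Rn n → ℝ) (p : ℝ × Rn n) : 0 ≤ symmLayer f p :=
  indicator_nonneg (fun _ _ => zero_le_one) _

theorem symmLayer_le_one (f : Rn n → ℝ) (p : ℝ × Rn n) : symmLayer f p ≤ 1 :=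
  indicator_le' (fun _ _ => le_rfl) (fun _ _ => zero_le_one) _

theorem layer_eq_indicator (f : Rn n → ℝ) (t : ℝ) :
    (fun x => layer f (t, x)) = {y | t < f y}.indicator (fun _ => 1) := by
  ext x; simp [layer, indicator]

theorem integral_layer_snd (h0 : ∀ x, 0 ≤ f x) (hN : ∀ x, f x ≤ N) (x : Rn n) :
    ∫ t in Ioo 0 N, layer f (t, x) = f x := by
  have : ∀ t, layer f (t, x) = (Iio (f x)).indicator (fun _ => (1 : ℝ)) t := by
    intro t; simp [layer, indicator]
  simp_rw [this]
  rw [integral_indicator measurableSet_Iio, Measure.restrict_restrict measurableSet_Iio,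
    show Iio (f x) ∩ Ioo 0 N = Ioo 0 (f x) by
      ext t; have := hN x; simp only [mem_inter_iff, mem_Iio, mem_Ioo]
      constructor
      · rintro ⟨h, h', -⟩; exact ⟨h', h⟩
      · rintro ⟨h, h'⟩; exact ⟨h', h, h'.trans_le this⟩]
  simp [h0 x]

/-- Only positive levels are compared: at t ≤ 0 the level set may have infinite volume, and `toReal`
then gives radius 0. -/
theorem antitoneOn_symmRadius_level (hf : IsLayered N f) :
    AntitoneOn (fun t => symmRadius {y | t < |f y|}) (Ioi 0) := by
  intro s hs t _ hst
  simp only [hf.abs_eq]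
  exact symmRadius_mono (hf.volume_level_ne_top hs)
    (measure_mono fun y (hy : t < f y) => lt_of_le_of_lt hst hy)

theorem measurable_layer (hf : IsLayered N f) : Measurable (layer f) :=
  Measurable.ite (measurableSet_lt measurable_fst (hf.measurable.comp measurable_snd))
    measurable_const measurable_const

theorem integrable_layer (hf : IsLayered N f) : Integrable (layer f) (layerMeasure n N) := by
  rw [integrable_prod_iff' (measurable_layer hf).aestronglyMeasurable]
  refine ⟨Filter.Eventually.of_forall fun x => ?_, ?_⟩
  · refine Integrable.of_bound ((measurable_layer hf).comp
      measurable_prodMk_right).aestronglyMeasurable 1 (Filter.Eventually.of_forall fun t => ?_)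
    rw [Real.norm_of_nonneg (layer_nonneg _ _)]; exact layer_le_one _ _
  · simp_rw [Real.norm_of_nonneg (layer_nonneg f _), integral_layer_snd hf.nonneg hf.le]
    exact hf.integrable

/-- The region is {‖x‖ < radius(t)}, and the radius is measurable in t because it is monotone there.
-/
theorem aestronglyMeasurable_symmLayer (hf : IsLayered N f) :
    AEStronglyMeasurable (symmLayer f) (layerMeasure n N) := by
  have hr : AEMeasurable (fun t => symmRadius {y | t < |f y|}) (volume.restrict (Ioo 0 N)) :=
    aemeasurable_restrict_of_antitoneOn measurableSet_Ioo
      ((antitoneOn_symmRadius_level hf).mono fun t ht => ht.1)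
  have h1 : AEMeasurable (fun p : ℝ × Rn n => symmRadius {y | p.1 < |f y|}) (layerMeasure n N) :=
    hr.comp_quasiMeasurePreserving Measure.quasiMeasurePreserving_fst
  have h2 : NullMeasurableSet {p : ℝ × Rn n | ‖p.2‖ < symmRadius {y | p.1 < |f y|}}
      (layerMeasure n N) := nullMeasurableSet_lt measurable_snd.norm.aemeasurable h1
  have : symmLayer f =
      {p : ℝ × Rn n | ‖p.2‖ < symmRadius {y | p.1 < |f y|}}.indicator (fun _ => (1 : ℝ)) := by
    ext p; simp only [symmLayer, indicator, mem_symmSet, mem_ofPred_eq]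
  rw [this]
  exact (aestronglyMeasurable_const.indicator₀ h2)

theorem integral_layer_fst (hf : IsLayered N f) (t : ℝ) :
    ∫ x, layer f (t, x) = volume.real {y | t < f y} := by
  rw [layer_eq_indicator, integral_indicator (hf.measurableSet_level t)]; simp

theorem integral_symmLayer_fst (hn : 0 < n) (hf : IsLayered N f) (t : ℝ) :
    ∫ x, symmLayer f (t, x) = volume.real {y | t < f y} := by
  change ∫ x, (symmSet {y | t < |f y|}).indicator (fun _ => (1 : ℝ)) x = _
  rw [integral_indicator (isOpen_symmSet _).measurableSet]
  simp only [integral_const, measureReal_restrict_apply_univ, smul_eq_mul, mul_one]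
  rw [volumeReal_symmSet hn, hf.abs_eq]

theorem integrable_symmLayer_fst (f : Rn n → ℝ) (t : ℝ) :
    Integrable (fun x => symmLayer f (t, x)) := by
  change Integrable ((symmSet {y | t < |f y|}).indicator (fun _ => (1 : ℝ)))
  rw [integrable_indicator_iff (isOpen_symmSet _).measurableSet]
  exact integrableOn_const (volume_symmSet_ne_top _)

theorem integrable_layer_fst (hf : IsLayered N f) {t : ℝ} (ht : 0 < t) :
    Integrable (fun x => layer f (t, x)) := by
  rw [layer_eq_indicator, integrable_indicator_iff (hf.measurableSet_level t)]
  exact integrableOn_const (hf.volume_level_ne_top ht)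

theorem integrable_symmLayer (hn : 0 < n) (hf : IsLayered N f) :
    Integrable (symmLayer f) (layerMeasure n N) := by
  rw [integrable_prod_iff (aestronglyMeasurable_symmLayer hf)]
  refine ⟨Filter.Eventually.of_forall fun t => integrable_symmLayer_fst f t, ?_⟩
  simp_rw [Real.norm_of_nonneg (symmLayer_nonneg f _), integral_symmLayer_fst hn hf]
  simpa only [integral_layer_fst hf] using (integrable_layer hf).integral_prod_left

theorem symmLayer_eq_zero_of_le (hn : 0 < n) (hN : ∀ x, f x ≤ N) (h0 : ∀ x, 0 ≤ f x) {t : ℝ}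
    (ht : N ≤ t) (x : Rn n) : symmLayer f (t, x) = 0 := by
  have : {y | t < |f y|} = ∅ := by
    ext y
    simp only [mem_ofPred_eq, mem_empty_iff_false, iff_false, not_lt, abs_of_nonneg (h0 y)]
    exact (hN y).trans ht
  refine indicator_of_notMem ?_ _
  simp [mem_symmSet, this, symmRadius_of_volume_zero hn]

theorem rearrangement_eq_integral (hn : 0 < n) (hf : IsLayered N f) (x : Rn n) :
    rearrangement f x = ∫ t in Ioo 0 N, symmLayer f (t, x) := by
  change ∫ t in Ioi 0, symmLayer f (t, x) = _
  refine setIntegral_eq_of_subset_of_forall_sdiff_eq_zero measurableSet_Ioi Ioo_subset_Ioi_self ?_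
  rintro t ⟨ht, ht'⟩
  refine symmLayer_eq_zero_of_le hn hf.le hf.nonneg ?_ x
  by_contra h
  exact ht' ⟨ht, not_le.1 h⟩

theorem rearrangement_nonneg (f : Rn n → ℝ) (x : Rn n) : 0 ≤ rearrangement f x :=
  integral_nonneg fun t => symmLayer_nonneg f (t, x)

theorem rearrangement_le (hn : 0 < n) (hf : IsLayered N f) (x : Rn n) : rearrangement f x ≤ N := by
  rw [rearrangement_eq_integral hn hf]
  calc _ ≤ ∫ t in Ioo 0 N, (1 : ℝ) := by
        refine integral_mono_of_nonneg (Filter.Eventually.of_forall fun t => symmLayer_nonneg f _)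
          (by simp) (Filter.Eventually.of_forall fun t => symmLayer_le_one f _)
    _ = N := by simp [hf.bound_nonneg]

theorem integrable_rearrangement (hn : 0 < n) (hf : IsLayered N f) :
    Integrable (rearrangement f) := by
  have := (integrable_symmLayer hn hf).integral_prod_right
  exact this.congr (Filter.Eventually.of_forall fun x => (rearrangement_eq_integral hn hf x).symm)

theorem integrable_layer_mul (hf : IsLayered N f) {ψ : Rn n → ℝ} (hψ : Measurable ψ) {C : ℝ}
    (hC : ∀ x, |ψ x| ≤ C) : Integrable (fun p => layer f p * ψ p.2) (layerMeasure n N) :=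
  (integrable_layer hf).mul_bdd (c := C) (hψ.comp measurable_snd).aestronglyMeasurable
    (Filter.Eventually.of_forall fun p => hC p.2)

theorem integrable_symmLayer_mul (hn : 0 < n) (hf : IsLayered N f) {ψ : Rn n → ℝ}
    (hψ : Measurable ψ) {C : ℝ} (hC : ∀ x, |ψ x| ≤ C) :
    Integrable (fun p => symmLayer f p * ψ p.2) (layerMeasure n N) :=
  (integrable_symmLayer hn hf).mul_bdd (c := C) (hψ.comp measurable_snd).aestronglyMeasurable
    (Filter.Eventually.of_forall fun p => hC p.2)

theorem integral_mul_eq_layer (hf : IsLayered N f) {ψ : Rn n → ℝ} (hψ : Measurable ψ) {C : ℝ}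
    (hC : ∀ x, |ψ x| ≤ C) :
    ∫ x, f x * ψ x = ∫ t in Ioo 0 N, ∫ x, layer f (t, x) * ψ x := by
  rw [integral_integral_swap (integrable_layer_mul hf hψ hC)]
  simp_rw [integral_mul_const, integral_layer_snd hf.nonneg hf.le]

theorem integral_rearrangement_mul_eq (hn : 0 < n) (hf : IsLayered N f) {ψ : Rn n → ℝ}
    (hψ : Measurable ψ) {C : ℝ} (hC : ∀ x, |ψ x| ≤ C) :
    ∫ x, rearrangement f x * ψ x = ∫ t in Ioo 0 N, ∫ x, symmLayer f (t, x) * ψ x := by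
  rw [integral_integral_swap (integrable_symmLayer_mul hn hf hψ hC)]
  simp_rw [integral_mul_const, rearrangement_eq_integral hn hf]

theorem integral_eq_integral_level (hf : IsLayered N f) :
    ∫ x, f x = ∫ t in Ioo 0 N, volume.real {y | t < f y} := by
  have := integral_mul_eq_layer hf (ψ := fun _ => 1) measurable_const (C := 1) (by simp)
  simpa only [mul_one, integral_layer_fst hf] using this

theorem integral_rearrangement (hn : 0 < n) (hf : IsLayered N f) :
    ∫ x, rearrangement f x = ∫ x, f x := by
  have := integral_rearrangement_mul_eq hn hf (ψ := fun _ => 1) measurable_const (C := 1) (by simp)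
  simpa only [mul_one, integral_symmLayer_fst hn hf, ← integral_eq_integral_level hf] using this

/-- Concentric balls are nested, so their L¹ distance is the difference of the volumes, which
symmetrization does not change. -/
theorem integral_abs_symmLayer_sub (hn : 0 < n) {f g : Rn n → ℝ} (hf : IsLayered N f)
    (hg : IsLayered N g) {t : ℝ} (ht : 0 < t) :
    ∫ x, |symmLayer f (t, x) - symmLayer g (t, x)| ≤ ∫ x, |layer f (t, x) - layer g (t, x)| := by
  have key : ∫ x, |symmLayer f (t, x) - symmLayer g (t, x)| =
      |∫ x, (symmLayer f (t, x) - symmLayer g (t, x))| := by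
    rcases le_total (symmRadius {y | t < |f y|}) (symmRadius {y | t < |g y|}) with h | h
    · have h' : ∀ x, symmLayer f (t, x) - symmLayer g (t, x) ≤ 0 := fun x =>
        sub_nonpos.2 (indicator_le_indicator_of_subset (Metric.ball_subset_ball h)
          (fun _ => zero_le_one) x)
      simp_rw [abs_of_nonpos (h' _)]
      rw [abs_of_nonpos (integral_nonpos h'), integral_neg]
    · have h' : ∀ x, 0 ≤ symmLayer f (t, x) - symmLayer g (t, x) := fun x =>
        sub_nonneg.2 (indicator_le_indicator_of_subset (Metric.ball_subset_ball h)
          (fun _ => zero_le_one) x)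
      simp_rw [abs_of_nonneg (h' _)]
      rw [abs_of_nonneg (integral_nonneg h')]
  rw [key, integral_sub (integrable_symmLayer_fst f t) (integrable_symmLayer_fst g t),
    integral_symmLayer_fst hn hf, integral_symmLayer_fst hn hg, ← integral_layer_fst hf,
    ← integral_layer_fst hg, ← integral_sub (integrable_layer_fst hf ht)
      (integrable_layer_fst hg ht)]
  exact abs_integral_le_integral_abs

/-- At fixed x the two layers are nested intervals in t, so the difference has a constant sign. -/
theorem integral_abs_layer_sub {f g : Rn n → ℝ} (hf : IsLayered N f) (hg : IsLayered N g)
    (x : Rn n) : ∫ t in Ioo 0 N, |layer f (t, x) - layer g (t, x)| = |f x - g x| := by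
  have hi : ∀ {h : Rn n → ℝ}, IsLayered N h → Integrable (fun t => layer h (t, x))
      (volume.restrict (Ioo 0 N)) := by
    intro h hh
    refine Integrable.of_bound ((measurable_layer hh).comp
      measurable_prodMk_right).aestronglyMeasurable 1 (Filter.Eventually.of_forall fun t => ?_)
    rw [Real.norm_of_nonneg (layer_nonneg _ _)]; exact layer_le_one _ _
  have hs : ∫ t in Ioo 0 N, (layer f (t, x) - layer g (t, x)) = f x - g x := by
    rw [integral_sub (hi hf) (hi hg), integral_layer_snd hf.nonneg hf.le,
      integral_layer_snd hg.nonneg hg.le]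
  rcases le_total (f x) (g x) with h | h
  · have h' : ∀ t, layer f (t, x) - layer g (t, x) ≤ 0 := by
      intro t; simp only [layer]; split_ifs <;> simp; linarith
    simp_rw [abs_of_nonpos (h' _)]
    rw [integral_neg, hs, abs_of_nonpos (by linarith)]
  · have h' : ∀ t, 0 ≤ layer f (t, x) - layer g (t, x) := by
      intro t; simp only [layer]; split_ifs <;> simp; linarith
    simp_rw [abs_of_nonneg (h' _)]
    rw [hs, abs_of_nonneg (by linarith)]

/-- The rearrangement is a contraction in `L¹`. -/
theorem integral_abs_rearrangement_sub_le (hn : 0 < n) {f g : Rn n → ℝ} (hf : IsLayered N f)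
    (hg : IsLayered N g) :
    ∫ x, |rearrangement f x - rearrangement g x| ≤ ∫ x, |f x - g x| := by
  have hS : Integrable (fun p => symmLayer f p - symmLayer g p) (layerMeasure n N) :=
    (integrable_symmLayer hn hf).sub (integrable_symmLayer hn hg)
  have hA : Integrable (fun p => layer f p - layer g p) (layerMeasure n N) :=
    (integrable_layer hf).sub (integrable_layer hg)
  calc ∫ x, |rearrangement f x - rearrangement g x|
      ≤ ∫ x, ∫ t in Ioo 0 N, |symmLayer f (t, x) - symmLayer g (t, x)| := by
        refine integral_mono_ae ((integrable_rearrangement hn hf).sub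
          (integrable_rearrangement hn hg)).abs hS.abs.integral_prod_right ?_
        filter_upwards [(integrable_symmLayer hn hf).prod_left_ae,
          (integrable_symmLayer hn hg).prod_left_ae] with x h1 h2
        rw [rearrangement_eq_integral hn hf, rearrangement_eq_integral hn hg, ← integral_sub h1 h2]
        exact abs_integral_le_integral_abs
    _ = ∫ t in Ioo 0 N, ∫ x, |symmLayer f (t, x) - symmLayer g (t, x)| :=
        (integral_integral_swap (f := fun t x => |symmLayer f (t, x) - symmLayer g (t, x)|)
          hS.abs).symm
    _ ≤ ∫ t in Ioo 0 N, ∫ x, |layer f (t, x) - layer g (t, x)| := by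
        refine setIntegral_mono_on hS.abs.integral_prod_left hA.abs.integral_prod_left
          measurableSet_Ioo fun t ht => integral_abs_symmLayer_sub hn hf hg ht.1
    _ = ∫ x, ∫ t in Ioo 0 N, |layer f (t, x) - layer g (t, x)| :=
        integral_integral_swap (f := fun t x => |layer f (t, x) - layer g (t, x)|) hA.abs
    _ = ∫ x, |f x - g x| := by simp_rw [integral_abs_layer_sub hf hg]

end

/-! ### Reflections and polarization -/

section Polarization
variable {n : ℕ}

/-- The signed distance to the hyperplane `⟪e, x⟫ = t`. -/
def side (e : Rn n) (t : ℝ) (x : Rn n) : ℝ := t - inner ℝ e x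

/-- The reflection in the hyperplane `⟪e, x⟫ = t`, where `e` is a unit vector. -/
def mirror (e : Rn n) (t : ℝ) (x : Rn n) : Rn n := x + (2 * side e t x) • e

/-- The polarization of `u` towards the half-space `⟪e, x⟫ ≤ t`. -/
def polarize (e : Rn n) (t : ℝ) (u : Rn n → ℝ) (x : Rn n) : ℝ :=
  if 0 ≤ side e t x then max (u x) (u (mirror e t x)) else min (u x) (u (mirror e t x))

variable {e : Rn n} {t : ℝ}

theorem side_mirror (he : ‖e‖ = 1) (x : Rn n) : side e t (mirror e t x) = -side e t x := by
  simp only [side, mirror, inner_add_right, inner_smul_right, real_inner_self_eq_norm_sq, he]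
  ring

theorem mirror_mirror (he : ‖e‖ = 1) (x : Rn n) : mirror e t (mirror e t x) = x := by
  conv_lhs => rw [mirror, side_mirror he, mirror]
  module

theorem mirror_of_side_eq_zero {x : Rn n} (h : side e t x = 0) : mirror e t x = x := by
  simp [mirror, h]

/-- Which of y and its mirror image is closer to x is decided by the sign of the product of the
signed distances. -/
theorem norm_sub_mirror_sq (he : ‖e‖ = 1) (x y : Rn n) :
    ‖x - mirror e t y‖ ^ 2 = ‖x - y‖ ^ 2 + 4 * (side e t x * side e t y) := by
  have : x - mirror e t y = (x - y) - (2 * side e t y) • e := by rw [mirror]; module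
  rw [this, norm_sub_sq_real, norm_smul, he, inner_smul_right, mul_one, Real.norm_eq_abs, sq_abs,
    real_inner_comm, inner_sub_right]
  simp only [side]; ring

theorem norm_mirror_sq (he : ‖e‖ = 1) (x : Rn n) :
    ‖mirror e t x‖ ^ 2 = ‖x‖ ^ 2 + 4 * (t * side e t x) := by
  have := norm_sub_mirror_sq (t := t) he 0 x
  simpa [side] using this

theorem norm_mirror_sub_mirror (he : ‖e‖ = 1) (x y : Rn n) :
    ‖mirror e t x - mirror e t y‖ = ‖x - y‖ := by
  rw [← sq_eq_sq₀ (norm_nonneg _) (norm_nonneg _), norm_sub_mirror_sq he, side_mirror he,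
    norm_sub_rev, norm_sub_mirror_sq he, norm_sub_rev]
  ring

theorem norm_mirror_sub (he : ‖e‖ = 1) (x y : Rn n) : ‖mirror e t x - y‖ = ‖x - mirror e t y‖ := by
  rw [← norm_mirror_sub_mirror he (t := t) x, mirror_mirror he]

theorem norm_sub_le_norm_sub_mirror (he : ‖e‖ = 1) {x y : Rn n} (h : 0 ≤ side e t x * side e t y) :
    ‖x - y‖ ≤ ‖x - mirror e t y‖ := by
  rw [← sq_le_sq₀ (norm_nonneg _) (norm_nonneg _), norm_sub_mirror_sq he]; linarith

theorem norm_sub_mirror_le_norm_sub (he : ‖e‖ = 1) {x y : Rn n} (h : side e t x * side e t y ≤ 0) :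
    ‖x - mirror e t y‖ ≤ ‖x - y‖ := by
  rw [← sq_le_sq₀ (norm_nonneg _) (norm_nonneg _), norm_sub_mirror_sq he]; linarith

theorem continuous_side : Continuous (side e t) := by unfold side; fun_prop

theorem continuous_mirror : Continuous (mirror e t) := by
  unfold mirror; have := continuous_side (e := e) (t := t); fun_prop

/-- The mirror is the reflection in the orthogonal complement of e followed by the translation by
2te. -/
theorem measurePreserving_mirror (he : ‖e‖ = 1) : MeasurePreserving (mirror e t) := by
  have h1 : MeasurePreserving ((ℝ ∙ e)ᗮ.reflection) (volume : Measure (Rn n)) volume :=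
    (ℝ ∙ e)ᗮ.reflection.measurePreserving
  have h2 := (measurePreserving_add_right (volume : Measure (Rn n)) ((2 * t) • e)).comp h1
  have heq : mirror e t = (fun x => x + (2 * t) • e) ∘ (ℝ ∙ e)ᗮ.reflection := by
    funext x
    simp only [Function.comp, Submodule.reflection_orthogonal_apply,
      Submodule.reflection_singleton_apply, he, mirror, side]
    simp only [RCLike.ofReal_real_eq_id, id, one_pow, div_one]
    module
  rw [heq]; exact h2

/-- Polarization sorts the two values on each orbit {x, mirror x}, the larger one going to the
nonnegative side. -/
theorem polarize_cases (he : ‖e‖ = 1) (u : Rn n → ℝ) (x : Rn n) :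
    (0 ≤ side e t x ∧ polarize e t u x = max (u x) (u (mirror e t x)) ∧
      polarize e t u (mirror e t x) = min (u x) (u (mirror e t x))) ∨
    (side e t x ≤ 0 ∧ polarize e t u x = min (u x) (u (mirror e t x)) ∧
      polarize e t u (mirror e t x) = max (u x) (u (mirror e t x))) := by
  unfold polarize
  rw [mirror_mirror he, side_mirror he]
  rcases lt_trichotomy (side e t x) 0 with h | h | h
  · right; refine ⟨h.le, ?_, ?_⟩
    · rw [if_neg (not_le.2 h)]
    · rw [if_pos (by linarith), max_comm]
  · left; rw [mirror_of_side_eq_zero h]; simp [h]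
  · left; refine ⟨h.le, ?_, ?_⟩
    · rw [if_pos h.le]
    · rw [if_neg (by linarith), min_comm]

/-- The two values on an orbit are only permuted. Integrated, this is the equimeasurability of u and
its polarization. -/
theorem polarize_comp_add (he : ‖e‖ = 1) (u : Rn n → ℝ) (Φ : ℝ → ℝ) (x : Rn n) :
    Φ (polarize e t u x) + Φ (polarize e t u (mirror e t x)) = Φ (u x) + Φ (u (mirror e t x)) := by
  rcases polarize_cases he u x (t := t) with ⟨-, h1, h2⟩ | ⟨-, h1, h2⟩ <;> rw [h1, h2] <;>
  rcases le_total (u x) (u (mirror e t x)) with h | h <;> simp [h, add_comm]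

theorem integral_comp_mirror (he : ‖e‖ = 1) {F : Rn n → ℝ} (hF : AEStronglyMeasurable F volume) :
    ∫ x, F (mirror e t x) = ∫ x, F x := by
  have h := measurePreserving_mirror he (t := t)
  conv_rhs => rw [← h.map_eq]
  rw [integral_map h.measurable.aemeasurable (by rwa [h.map_eq])]

theorem integral_comp_polarize (he : ‖e‖ = 1) {u : Rn n → ℝ} {Φ : ℝ → ℝ}
    (h1 : Integrable fun x => Φ (u x)) (h2 : Integrable fun x => Φ (polarize e t u x)) :
    ∫ x, Φ (polarize e t u x) = ∫ x, Φ (u x) := by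
  have hm := measurePreserving_mirror he (t := t)
  have a1 := integral_comp_mirror he (t := t) h1.1
  have a2 := integral_comp_mirror he (t := t) h2.1
  have b1 : Integrable fun x => Φ (u (mirror e t x)) := hm.integrable_comp_of_integrable h1
  have b2 : Integrable fun x => Φ (polarize e t u (mirror e t x)) :=
    hm.integrable_comp_of_integrable h2
  have := integral_congr_ae (μ := volume) (Filter.Eventually.of_forall fun x =>
    polarize_comp_add he (t := t) u Φ x)
  rw [integral_add h2 b2, integral_add h1 b1, a1, a2] at this
  linarith

/-- `ε`, `δ` is a pair of moduli of uniform continuity of `u`. -/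
def HasModulus (u : Rn n → ℝ) (ε δ : ℝ) : Prop := ∀ x y, ‖x - y‖ ≤ δ → |u x - u y| ≤ ε

/-- For x and y on opposite sides the value at x may have to be compared with that at the mirror
image of y, which is then no farther from x than y is. -/
theorem HasModulus.polarize (he : ‖e‖ = 1) {u : Rn n → ℝ} {ε δ : ℝ} (h : HasModulus u ε δ) :
    HasModulus (polarize e t u) ε δ := by
  intro x y hxy
  have a1 := abs_le.1 (h x y hxy)
  have a2 := abs_le.1 (h (mirror e t x) (mirror e t y) (by rwa [norm_mirror_sub_mirror he]))
  have a3 : side e t x * side e t y ≤ 0 → |u x - u (mirror e t y)| ≤ ε := fun hs =>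
    h _ _ ((norm_sub_mirror_le_norm_sub he hs).trans hxy)
  have a4 : side e t x * side e t y ≤ 0 → |u (mirror e t x) - u y| ≤ ε := fun hs =>
    h _ _ ((norm_mirror_sub he x y).trans_le ((norm_sub_mirror_le_norm_sub he hs).trans hxy))
  rw [abs_le]
  rcases polarize_cases he u x (t := t) with ⟨s1, h1, -⟩ | ⟨s1, h1, -⟩ <;>
  rcases polarize_cases he u y (t := t) with ⟨s2, h2, -⟩ | ⟨s2, h2, -⟩ <;> rw [h1, h2]
  · rcases max_cases (u x) (u (mirror e t x)) with b | b <;>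
    rcases max_cases (u y) (u (mirror e t y)) with c | c <;> constructor <;> linarith
  · have a3 := abs_le.1 (a3 (mul_nonpos_of_nonneg_of_nonpos s1 s2))
    have a4 := abs_le.1 (a4 (mul_nonpos_of_nonneg_of_nonpos s1 s2))
    rcases max_cases (u x) (u (mirror e t x)) with b | b <;>
    rcases min_cases (u y) (u (mirror e t y)) with c | c <;> constructor <;> linarith
  · have a3 := abs_le.1 (a3 (mul_nonpos_of_nonpos_of_nonneg s1 s2))
    have a4 := abs_le.1 (a4 (mul_nonpos_of_nonpos_of_nonneg s1 s2))
    rcases min_cases (u x) (u (mirror e t x)) with b | b <;>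
    rcases max_cases (u y) (u (mirror e t y)) with c | c <;> constructor <;> linarith
  · rcases min_cases (u x) (u (mirror e t x)) with b | b <;>
    rcases min_cases (u y) (u (mirror e t y)) with c | c <;> constructor <;> linarith

/-- The interaction energy for the kernel `g(|x - y|)`. -/
def radialEnergy (g : ℝ → ℝ) (u : Rn n → ℝ) : ℝ :=
  ∫ p : Rn n × Rn n, u p.1 * u p.2 * g ‖p.1 - p.2‖

theorem integrable_radialEnergy {g : ℝ → ℝ} (hg : Measurable g) {C : ℝ} (hC : ∀ r, |g r| ≤ C)
    {u v : Rn n → ℝ} (hu : Integrable u) (hv : Integrable v) :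
    Integrable fun p : Rn n × Rn n => u p.1 * v p.2 * g ‖p.1 - p.2‖ :=
  (hu.mul_prod hv).mul_bdd (c := C)
    (hg.comp (measurable_fst.sub measurable_snd).norm).aestronglyMeasurable
    (Filter.Eventually.of_forall fun _ => hC _)

/-- Rearrangement inequality for two pairs: the difference of the sides is 0 if the pairs are
ordered alike, and (M - m)(K - k)(G - G') otherwise. -/
theorem sum_mul_le_of_sorted {a a' b b' M m K k G G' : ℝ} (hG : G' ≤ G) (hM : m ≤ M) (hK : k ≤ K)
    (h1 : (M = a ∧ m = a') ∨ (M = a' ∧ m = a)) (h2 : (K = b ∧ k = b') ∨ (K = b' ∧ k = b)) :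
    (a * b + a' * b') * G + (a * b' + a' * b) * G' ≤
      (M * K + m * k) * G + (M * k + m * K) * G' := by
  have := mul_nonneg (mul_nonneg (sub_nonneg.2 hM) (sub_nonneg.2 hK)) (sub_nonneg.2 hG)
  rcases h1 with ⟨rfl, rfl⟩ | ⟨rfl, rfl⟩ <;> rcases h2 with ⟨rfl, rfl⟩ | ⟨rfl, rfl⟩ <;> nlinarith

theorem max_min_sorted (a b : ℝ) :
    (max a b = a ∧ min a b = b) ∨ (max a b = b ∧ min a b = a) := by
  rcases le_total a b with h | h <;> simp [h]

/-- For points on the same side the direct distance is the shorter one and the sorted pairs are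
aligned; for points on opposite sides both relations are reversed. -/
theorem polarize_sum_le (he : ‖e‖ = 1) {g : ℝ → ℝ} (hg : Antitone g) (u : Rn n → ℝ) (x y : Rn n) :
    (u x * u y + u (mirror e t x) * u (mirror e t y)) * g ‖x - y‖ +
        (u x * u (mirror e t y) + u (mirror e t x) * u y) * g ‖x - mirror e t y‖ ≤
      (polarize e t u x * polarize e t u y +
          polarize e t u (mirror e t x) * polarize e t u (mirror e t y)) * g ‖x - y‖ +
        (polarize e t u x * polarize e t u (mirror e t y) +
          polarize e t u (mirror e t x) * polarize e t u y) * g ‖x - mirror e t y‖ := by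
  have hmM : ∀ a b : ℝ, min a b ≤ max a b := fun a b => min_le_max
  rcases polarize_cases he u x (t := t) with ⟨s1, h1, h1'⟩ | ⟨s1, h1, h1'⟩ <;>
  rcases polarize_cases he u y (t := t) with ⟨s2, h2, h2'⟩ | ⟨s2, h2, h2'⟩ <;> rw [h1, h2, h1', h2']
  · exact sum_mul_le_of_sorted (hg (norm_sub_le_norm_sub_mirror he (mul_nonneg s1 s2)))
      (hmM _ _) (hmM _ _) (max_min_sorted _ _) (max_min_sorted _ _)
  · have := sum_mul_le_of_sorted
      (hg (norm_sub_mirror_le_norm_sub he (mul_nonpos_of_nonneg_of_nonpos s1 s2)))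
      (hmM _ _) (hmM _ _) (max_min_sorted (u x) (u (mirror e t x)))
      (max_min_sorted (u y) (u (mirror e t y))).symm
    linarith
  · have := sum_mul_le_of_sorted
      (hg (norm_sub_mirror_le_norm_sub he (mul_nonpos_of_nonpos_of_nonneg s1 s2)))
      (hmM _ _) (hmM _ _) (max_min_sorted (u x) (u (mirror e t x)))
      (max_min_sorted (u y) (u (mirror e t y))).symm
    linarith
  · have := sum_mul_le_of_sorted
      (hg (norm_sub_le_norm_sub_mirror he (mul_nonneg_of_nonpos_of_nonpos s1 s2)))
      (hmM _ _) (hmM _ _) (max_min_sorted (u x) (u (mirror e t x)))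
      (max_min_sorted (u y) (u (mirror e t y)))
    linarith

/-- Averaging over the mirror in each variable separately turns the comparison of energies into a
pointwise one on orbits. -/
theorem four_mul_radialEnergy (he : ‖e‖ = 1) {g : ℝ → ℝ} (hg : Measurable g) {C : ℝ}
    (hC : ∀ r, |g r| ≤ C)
    {u : Rn n → ℝ} (hu : Integrable u) :
    Integrable (fun p : Rn n × Rn n =>
      (u p.1 * u p.2 + u (mirror e t p.1) * u (mirror e t p.2)) * g ‖p.1 - p.2‖ +
        (u p.1 * u (mirror e t p.2) + u (mirror e t p.1) * u p.2) * g ‖p.1 - mirror e t p.2‖) ∧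
    4 * radialEnergy g u = ∫ p : Rn n × Rn n,
      ((u p.1 * u p.2 + u (mirror e t p.1) * u (mirror e t p.2)) * g ‖p.1 - p.2‖ +
        (u p.1 * u (mirror e t p.2) + u (mirror e t p.1) * u p.2) * g ‖p.1 - mirror e t p.2‖) := by
  have hm := measurePreserving_mirror he (t := t)
  have hid : MeasurePreserving (id : Rn n → Rn n) := MeasurePreserving.id _
  set F : Rn n × Rn n → ℝ := fun p => u p.1 * u p.2 * g ‖p.1 - p.2‖ with hF
  have hFi : Integrable F := integrable_radialEnergy hg hC hu hu
  have key : ∀ T : Rn n × Rn n → Rn n × Rn n, MeasurePreserving T →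
      Integrable (fun p => F (T p)) ∧ ∫ p, F (T p) = radialEnergy g u := by
    intro T hT
    refine ⟨hT.integrable_comp_of_integrable hFi, ?_⟩
    change _ = ∫ p, F p
    conv_rhs => rw [← hT.map_eq]
    rw [integral_map hT.measurable.aemeasurable (by rw [hT.map_eq]; exact hFi.1)]
  obtain ⟨i1, e1⟩ := key _ (hid.prod hid)
  obtain ⟨i2, e2⟩ := key _ (hm.prod hm)
  obtain ⟨i3, e3⟩ := key _ (hid.prod hm)
  obtain ⟨i4, e4⟩ := key _ (hm.prod hid)
  have hs : (fun p : Rn n × Rn n =>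
      (u p.1 * u p.2 + u (mirror e t p.1) * u (mirror e t p.2)) * g ‖p.1 - p.2‖ +
        (u p.1 * u (mirror e t p.2) + u (mirror e t p.1) * u p.2) * g ‖p.1 - mirror e t p.2‖) =
      fun p => ((F (Prod.map id id p) + F (Prod.map (mirror e t) (mirror e t) p)) +
        (F (Prod.map id (mirror e t) p) + F (Prod.map (mirror e t) id p))) := by
    ext p
    simp only [hF, Prod.map_fst, Prod.map_snd, id, norm_mirror_sub_mirror he, norm_mirror_sub he]
    ring
  rw [hs]
  refine ⟨(i1.add i2).add (i3.add i4), ?_⟩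
  rw [integral_add, integral_add i1 i2, integral_add i3 i4, e1, e2, e3, e4]
  rotate_left
  · exact i1.add i2
  · exact i3.add i4
  ring

theorem radialEnergy_le_polarize (he : ‖e‖ = 1) {g : ℝ → ℝ} (hg : Antitone g) {C : ℝ}
    (hC : ∀ r, |g r| ≤ C)
    {u : Rn n → ℝ} (hu : Integrable u) (hpu : Integrable (polarize e t u)) :
    radialEnergy g u ≤ radialEnergy g (polarize e t u) := by
  obtain ⟨i1, e1⟩ := four_mul_radialEnergy he hg.measurable hC hu (t := t)
  obtain ⟨i2, e2⟩ := four_mul_radialEnergy he hg.measurable hC hpu (t := t)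
  have := integral_mono i1 i2 fun p => polarize_sum_le he hg u p.1 p.2
  linarith

/-- Polarization towards a half-space containing the origin decreases the second moment, strictly
unless the function is already polarized. -/
theorem le_of_secondMoment_le_polarize (he : ‖e‖ = 1) (ht : 0 < t) {u : Rn n → ℝ}
    (hu : Continuous u) (hpu : Continuous (polarize e t u)) (h1 : Integrable fun x => u x * ‖x‖ ^ 2)
    (h2 : Integrable fun x => polarize e t u x * ‖x‖ ^ 2)
    (h : ∫ x, u x * ‖x‖ ^ 2 ≤ ∫ x, polarize e t u x * ‖x‖ ^ 2) {x : Rn n} (hx : 0 < side e t x) :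
    u (mirror e t x) ≤ u x := by
  have hm := measurePreserving_mirror he (t := t)
  have hc := continuous_mirror (e := e) (t := t)
  set F : Rn n → ℝ := fun x => (u x - polarize e t u x) * ‖x‖ ^ 2 with hF
  have hFi : Integrable F := (h1.sub h2).congr (Filter.Eventually.of_forall fun x => by
    simp only [hF, Pi.sub_apply]; ring)
  have hFi' : Integrable fun x => F (mirror e t x) := hm.integrable_comp_of_integrable hFi
  have hFeq : ∫ x, F (mirror e t x) = ∫ x, F x := integral_comp_mirror he hFi.1
  have hFle : ∫ x, F x ≤ 0 := by
    have : ∫ x, F x = (∫ x, u x * ‖x‖ ^ 2) - ∫ x, polarize e t u x * ‖x‖ ^ 2 := by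
      rw [← integral_sub h1 h2]
      exact integral_congr_ae (Filter.Eventually.of_forall fun x => by simp only [hF]; ring)
    linarith
  -- The mirror changes ‖x‖² by 4t·`side`, and u minus its polarization changes sign under it. Both
  -- factors on the right have the same sign, because t > 0.
  have hsum : ∀ x, F x + F (mirror e t x) =
      (polarize e t u x - u x) * (4 * (t * side e t x)) := by
    intro x
    have hp := polarize_comp_add he (t := t) u id x
    simp only [id] at hp
    simp only [hF, norm_mirror_sq he]
    linear_combination (-(‖x‖ ^ 2 + 4 * (t * side e t x))) * hp
  have hnn : ∀ x, 0 ≤ F x + F (mirror e t x) := by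
    intro x
    rw [hsum]
    rcases polarize_cases he u x (t := t) with ⟨s, h1, -⟩ | ⟨s, h1, -⟩
    · rw [h1]
      exact mul_nonneg (sub_nonneg.2 (le_max_left _ _)) (by positivity)
    · rw [h1]
      refine mul_nonneg_of_nonpos_of_nonpos (sub_nonpos.2 (min_le_left _ _)) ?_
      nlinarith
  have hz : ∫ x, (F x + F (mirror e t x)) = 0 := by
    refine le_antisymm ?_ (integral_nonneg hnn)
    rw [integral_add hFi hFi', hFeq]; linarith
  have hcont : Continuous fun x => F x + F (mirror e t x) := by
    have : Continuous F := by fun_prop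
    exact this.add (this.comp hc)
  rw [integral_eq_zero_iff_of_nonneg hnn (hFi.add hFi')] at hz
  have hz' := congrFun ((hcont.ae_eq_iff_eq volume continuous_zero).1 hz) x
  rw [Pi.zero_apply, hsum] at hz'
  have : polarize e t u x = u x := by
    rcases mul_eq_zero.1 hz' with h | h
    · linarith
    · exact absurd h (by positivity)
  rw [polarize, if_pos hx.le] at this
  rw [← this]; exact le_max_right _ _

/-- Two points at different distances from the origin are swapped by a mirror. -/
theorem exists_mirror {x y : Rn n} (h : ‖x‖ < ‖y‖) :
    ∃ (e : Rn n) (t : ℝ), ‖e‖ = 1 ∧ 0 < t ∧ 0 < side e t x ∧ mirror e t x = y := by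
  have hne : y - x ≠ 0 := by
    intro h0; rw [sub_eq_zero] at h0; simp [h0] at h
  have hd : 0 < ‖y - x‖ := norm_pos_iff.2 hne
  have hip : ∀ z, inner ℝ (‖y - x‖⁻¹ • (y - x)) z = ‖y - x‖⁻¹ * (inner ℝ y z - inner ℝ x z) := by
    intro z; rw [real_inner_smul_left, inner_sub_left]
  have hsq : ‖y - x‖ ^ 2 = ‖y‖ ^ 2 - 2 * inner ℝ x y + ‖x‖ ^ 2 := by
    rw [norm_sub_sq_real, real_inner_comm]
  have hs : side (‖y - x‖⁻¹ • (y - x)) (‖y - x‖⁻¹ * ((‖y‖ ^ 2 - ‖x‖ ^ 2) / 2)) x =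
      ‖y - x‖ / 2 := by
    rw [side, hip, real_inner_self_eq_norm_sq, real_inner_comm]
    have : ‖y - x‖ / 2 = ‖y - x‖⁻¹ * (‖y - x‖ ^ 2 / 2) := by field_simp
    rw [this, hsq]; ring
  -- The mirror is the perpendicular bisector of x and y; the origin lies on the side of x, i.e. t >
  -- 0, since ‖x‖ < ‖y‖.
  refine ⟨‖y - x‖⁻¹ • (y - x), ‖y - x‖⁻¹ * ((‖y‖ ^ 2 - ‖x‖ ^ 2) / 2), ?_, ?_, ?_, ?_⟩
  · rw [norm_smul, norm_inv, norm_norm, inv_mul_cancel₀ hd.ne']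
  · have : ‖x‖ ^ 2 < ‖y‖ ^ 2 := by gcongr
    have : 0 < (‖y‖ ^ 2 - ‖x‖ ^ 2) / 2 := by linarith
    positivity
  · rw [hs]; positivity
  · rw [mirror, hs, smul_smul, show 2 * (‖y - x‖ / 2) * ‖y - x‖⁻¹ = 1 by field_simp, one_smul]
    abel

end Polarization

/-! ### The Riesz rearrangement inequality for continuous functions -/

section RieszContinuous
open scoped BoundedContinuousFunction
variable {n : ℕ}

/-- Functions with values in `[0, M]`, supported in the ball of radius `r`, and at least as
uniformly continuous as `f`. -/
def comparisonSet (f : Rn n → ℝ) (r M : ℝ) : Set (Rn n → ℝ) :=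
  {u | (∀ x, u x ∈ Icc 0 M) ∧ (∀ x, r ≤ ‖x‖ → u x = 0) ∧
    ∀ ε δ, HasModulus f ε δ → HasModulus u ε δ}

theorem isClosed_comparisonSet (f : Rn n → ℝ) (r M : ℝ) : IsClosed (comparisonSet f r M) := by
  have e1 : IsClosed {u : Rn n → ℝ | ∀ x, u x ∈ Icc 0 M} := by
    simp only [ofPred_forall]
    exact isClosed_iInter fun x => isClosed_Icc.preimage (continuous_apply x)
  have e2 : IsClosed {u : Rn n → ℝ | ∀ x, r ≤ ‖x‖ → u x = 0} := by
    simp only [ofPred_forall]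
    exact isClosed_iInter fun x => isClosed_iInter fun _ =>
      isClosed_eq (continuous_apply x) continuous_const
  have e3 : IsClosed {u : Rn n → ℝ | ∀ ε δ, HasModulus f ε δ → HasModulus u ε δ} := by
    simp only [ofPred_forall, HasModulus]
    exact isClosed_iInter fun ε => isClosed_iInter fun δ => isClosed_iInter fun _ =>
      isClosed_iInter fun x => isClosed_iInter fun y => isClosed_iInter fun _ =>
      isClosed_le ((continuous_apply x).sub (continuous_apply y)).abs continuous_const
  exact e1.inter (e2.inter e3)

theorem exists_hasModulus {f : Rn n → ℝ} (hf : UniformContinuous f) {ε : ℝ} (hε : 0 < ε) :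
    ∃ δ, 0 < δ ∧ HasModulus f ε δ := by
  obtain ⟨δ, hδ, h⟩ := Metric.uniformContinuous_iff.1 hf ε hε
  refine ⟨δ / 2, by positivity, fun x y hxy => ?_⟩
  have := h (a := x) (b := y) (by rw [dist_eq_norm]; linarith)
  exact this.le

theorem uniformContinuous_of_mem {f : Rn n → ℝ} (hf : UniformContinuous f) {r M : ℝ}
    {u : Rn n → ℝ} (hu : u ∈ comparisonSet f r M) : UniformContinuous u := by
  rw [Metric.uniformContinuous_iff]
  intro ε hε
  obtain ⟨δ, hδ, h⟩ := exists_hasModulus hf (half_pos hε)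
  refine ⟨δ, hδ, fun {x y} hxy => ?_⟩
  have := hu.2.2 _ _ h x y (by rw [← dist_eq_norm]; exact hxy.le)
  rw [Real.dist_eq]; linarith

/-- Arzelà–Ascoli: the moduli of f give equicontinuity, and the pointwise closed conditions with
values in [0, M] give compactness in the product topology. -/
theorem isCompact_comparisonSet {f : Rn n → ℝ} (hf : UniformContinuous f) (r M : ℝ) :
    IsCompact {u : C(Rn n, ℝ) | ⇑u ∈ comparisonSet f r M} := by
  refine ArzelaAscoli.isCompact_of_equicontinuous _ ?_ ?_
  · have : ContinuousMap.toFun '' {u : C(Rn n, ℝ) | ⇑u ∈ comparisonSet f r M} =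
        comparisonSet f r M := by
      ext v
      constructor
      · rintro ⟨u, hu, rfl⟩; exact hu
      · intro hv
        exact ⟨⟨v, (uniformContinuous_of_mem hf hv).continuous⟩, hv, rfl⟩
    rw [this]
    exact (isCompact_univ_pi fun _ : Rn n => isCompact_Icc (a := (0 : ℝ)) (b := M)).of_isClosed_subset
      (isClosed_comparisonSet f r M) fun u hu x _ => hu.1 x
  · intro x₀
    rw [Metric.equicontinuousAt_iff]
    intro ε hε
    obtain ⟨δ, hδ, h⟩ := exists_hasModulus hf (half_pos hε)
    refine ⟨δ, hδ, fun x hx u => ?_⟩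
    have := u.2.2.2 _ _ h x₀ x (by rw [← dist_eq_norm, dist_comm]; exact hx.le)
    rw [Real.dist_eq]; exact this.trans_lt (by linarith)

theorem integrable_of_vanishing {F : Rn n → ℝ} (hF : Continuous F) {r : ℝ}
    (h : ∀ x, r ≤ ‖x‖ → F x = 0) : Integrable F := by
  refine hF.integrable_of_hasCompactSupport (HasCompactSupport.intro (isCompact_closedBall 0 r) ?_)
  intro x hx
  refine h x ?_
  simp only [mem_closedBall_zero_iff, not_le] at hx; exact hx.le

theorem integrable_indicator_closedBall (r C : ℝ) :
    Integrable ((Metric.closedBall (0 : Rn n) r).indicator fun _ => C) :=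
  (integrable_indicator_iff Metric.isClosed_closedBall.measurableSet).2
    (integrableOn_const measure_closedBall_lt_top.ne)

theorem abs_le_indicator {F : Rn n → ℝ} {r C : ℝ} (hC : ∀ x, ‖x‖ ≤ r → |F x| ≤ C)
    (h : ∀ x, r ≤ ‖x‖ → F x = 0) (x : Rn n) :
    |F x| ≤ (Metric.closedBall (0 : Rn n) r).indicator (fun _ => C) x := by
  by_cases hx : x ∈ Metric.closedBall (0 : Rn n) r
  · rw [indicator_of_mem hx]; exact hC x (mem_closedBall_zero_iff.1 hx)
  · rw [indicator_of_notMem hx, h x (by simp only [mem_closedBall_zero_iff, not_le] at hx; exact hx.le)]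
    simp

theorem continuousOn_integral_comp (f : Rn n → ℝ) (r M : ℝ) (Φ : ℝ →ᵇ ℝ)
    (hΦ : Φ 0 = 0) :
    ContinuousOn (fun u : C(Rn n, ℝ) => ∫ x, Φ (u x)) {u | ⇑u ∈ comparisonSet f r M} := by
  refine continuousOn_of_dominated (bound := (Metric.closedBall 0 r).indicator fun _ => ‖Φ‖)
    (fun u _ => (Φ.continuous.comp u.continuous).aestronglyMeasurable)
    (fun u hu => Filter.Eventually.of_forall fun x => ?_) (integrable_indicator_closedBall r _)
    (Filter.Eventually.of_forall fun x => ?_)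
  · exact abs_le_indicator (F := fun x => Φ (u x)) (fun x _ => Φ.norm_coe_le_norm _)
      (fun x hx => by rw [hu.2.1 x hx, hΦ]) x
  · exact (Φ.continuous.comp (continuous_eval_const x)).continuousOn

theorem continuousOn_secondMoment (f : Rn n → ℝ) (r M : ℝ) :
    ContinuousOn (fun u : C(Rn n, ℝ) => ∫ x, u x * ‖x‖ ^ 2) {u | ⇑u ∈ comparisonSet f r M} := by
  refine continuousOn_of_dominated (bound := (Metric.closedBall 0 r).indicator fun _ => M * r ^ 2)
    (fun u _ => (u.continuous.mul (continuous_norm.pow 2)).aestronglyMeasurable)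
    (fun u hu => Filter.Eventually.of_forall fun x => ?_) (integrable_indicator_closedBall r _)
    (Filter.Eventually.of_forall fun x => ?_)
  · refine abs_le_indicator (F := fun x => u x * ‖x‖ ^ 2) (fun x hx => ?_)
      (fun x hx => by rw [hu.2.1 x hx, zero_mul]) x
    have := hu.1 x
    rw [abs_of_nonneg (mul_nonneg this.1 (by positivity))]
    have h0 := this.1
    have h1 := this.2
    gcongr
    exact h0.trans h1
  · exact ((continuous_eval_const x).mul continuous_const).continuousOn

theorem continuousOn_radialEnergy (f : Rn n → ℝ) (r M : ℝ) {g : ℝ → ℝ} (hg : Measurable g) {C : ℝ}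
    (hC : ∀ r, |g r| ≤ C) :
    ContinuousOn (fun u : C(Rn n, ℝ) => radialEnergy g u) {u | ⇑u ∈ comparisonSet f r M} := by
  have hb : Integrable fun p : Rn n × Rn n =>
      (Metric.closedBall (0 : Rn n) r).indicator (fun _ => M) p.1 *
        (Metric.closedBall (0 : Rn n) r).indicator (fun _ => M) p.2 :=
    (integrable_indicator_closedBall r M).mul_prod (integrable_indicator_closedBall r M)
  have hm : ∀ u ∈ {u : C(Rn n, ℝ) | ⇑u ∈ comparisonSet f r M}, AEStronglyMeasurable
      (fun p : Rn n × Rn n => u p.1 * u p.2 * g ‖p.1 - p.2‖) volume := by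
    intro u hu
    have hi := integrable_of_vanishing u.continuous hu.2.1
    exact (integrable_radialEnergy hg hC hi hi).1
  have hle : ∀ u ∈ {u : C(Rn n, ℝ) | ⇑u ∈ comparisonSet f r M}, ∀ p : Rn n × Rn n,
      ‖u p.1 * u p.2 * g ‖p.1 - p.2‖‖ ≤
        (Metric.closedBall (0 : Rn n) r).indicator (fun _ => M) p.1 *
          (Metric.closedBall (0 : Rn n) r).indicator (fun _ => M) p.2 * C := by
    intro u hu p
    have hle := abs_le_indicator (F := u) (fun x _ => by
      rw [abs_of_nonneg (hu.1 x).1]; exact (hu.1 x).2) hu.2.1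
    rw [Real.norm_eq_abs, abs_mul, abs_mul]
    exact mul_le_mul (mul_le_mul (hle _) (hle _) (abs_nonneg _) ((abs_nonneg _).trans (hle _)))
      (hC _) (abs_nonneg _) (mul_nonneg ((abs_nonneg _).trans (hle _)) ((abs_nonneg _).trans (hle _)))
  have hc : ∀ p : Rn n × Rn n, Continuous fun u : C(Rn n, ℝ) => u p.1 * u p.2 * g ‖p.1 - p.2‖ :=
    fun p => ((continuous_eval_const p.1).mul (continuous_eval_const p.2)).mul continuous_const
  exact continuousOn_of_dominated hm (fun u hu => Filter.Eventually.of_forall (hle u hu))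
    (hb.mul_const C) (Filter.Eventually.of_forall fun p => (hc p).continuousOn)

/-- The functions in the comparison set that are equimeasurable with `f` and have at least the
same energy. -/
def competitors (g : ℝ → ℝ) (f : Rn n → ℝ) (r M : ℝ) : Set C(Rn n, ℝ) :=
  {u | ⇑u ∈ comparisonSet f r M ∧ radialEnergy g f ≤ radialEnergy g u ∧
    ∀ Φ : ℝ →ᵇ ℝ, Φ 0 = 0 → ∫ x, Φ (u x) = ∫ x, Φ (f x)}

/-- By dominated convergence on a fixed ball, the energy and the integrals of Φ(u) are continuous on
the compact comparison set, so the constraints are closed. -/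
theorem isCompact_competitors {f : Rn n → ℝ} (hf : UniformContinuous f) (r M : ℝ) {g : ℝ → ℝ}
    (hg : Measurable g) {C : ℝ} (hC : ∀ r, |g r| ≤ C) : IsCompact (competitors g f r M) := by
  have hS := isCompact_comparisonSet hf r M
  have h1 : IsClosed ({u : C(Rn n, ℝ) | ⇑u ∈ comparisonSet f r M} ∩
      (fun u : C(Rn n, ℝ) => radialEnergy g u) ⁻¹' Ici (radialEnergy g f)) :=
    (continuousOn_radialEnergy f r M hg hC).preimage_isClosed_of_isClosed hS.isClosed isClosed_Ici
  have h2 : IsClosed (⋂ (Φ : ℝ →ᵇ ℝ) (_ : Φ 0 = 0), ({u : C(Rn n, ℝ) | ⇑u ∈ comparisonSet f r M} ∩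
      (fun u : C(Rn n, ℝ) => ∫ x, Φ (u x)) ⁻¹' {∫ x, Φ (f x)})) :=
    isClosed_iInter fun Φ => isClosed_iInter fun hΦ =>
      (continuousOn_integral_comp f r M Φ hΦ).preimage_isClosed_of_isClosed hS.isClosed
        isClosed_singleton
  refine hS.of_isClosed_subset (t := competitors g f r M) ?_ fun u hu => hu.1
  convert h1.inter h2 using 1
  ext u
  simp only [competitors, mem_ofPred_eq, mem_inter_iff, mem_preimage, mem_Ici, mem_iInter,
    mem_singleton_iff]
  constructor
  · rintro ⟨a, b, c⟩; exact ⟨⟨a, b⟩, fun Φ hΦ => ⟨a, c Φ hΦ⟩⟩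
  · rintro ⟨⟨a, b⟩, c⟩; exact ⟨a, b, fun Φ hΦ => (c Φ hΦ).2⟩

/-- With t ≥ 0, reflecting a point of the nonnegative side moves it away from the origin, so the
support bound survives the maximum; on the other side the minimum of 0 and a nonnegative value is 0.
-/
theorem polarize_mem_comparisonSet {e : Rn n} {t : ℝ} (he : ‖e‖ = 1) (ht : 0 ≤ t)
    {f u : Rn n → ℝ} {r M : ℝ} (hu : u ∈ comparisonSet f r M) :
    polarize e t u ∈ comparisonSet f r M := by
  refine ⟨fun x => ?_, fun x hx => ?_, fun ε δ h => (hu.2.2 ε δ h).polarize he⟩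
  · have h1 := hu.1 x
    have h2 := hu.1 (mirror e t x)
    unfold polarize
    split_ifs
    · rcases max_choice (u x) (u (mirror e t x)) with h | h <;> rw [h] <;> assumption
    · rcases min_choice (u x) (u (mirror e t x)) with h | h <;> rw [h] <;> assumption
  · unfold polarize
    rw [hu.2.1 x hx]
    split_ifs with hs
    · rw [hu.2.1 (mirror e t x), max_self]
      refine hx.trans ?_
      rw [← sq_le_sq₀ (norm_nonneg _) (norm_nonneg _), norm_mirror_sq he]
      nlinarith [mul_nonneg ht hs]
    · exact min_eq_left (hu.1 _).1

theorem polarize_mem_competitors {e : Rn n} {t : ℝ} (he : ‖e‖ = 1) (ht : 0 ≤ t) {f : Rn n → ℝ}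
    (hf : UniformContinuous f) {r M : ℝ} {g : ℝ → ℝ} (hg : Antitone g) {C : ℝ}
    (hC : ∀ r, |g r| ≤ C) {u : C(Rn n, ℝ)} (hu : u ∈ competitors g f r M) :
    ∃ v ∈ competitors g f r M, ⇑v = polarize e t u := by
  have hp := polarize_mem_comparisonSet he ht hu.1
  have hpc := (uniformContinuous_of_mem hf hp).continuous
  refine ⟨⟨_, hpc⟩, ⟨hp, ?_, fun Φ hΦ => ?_⟩, rfl⟩
  · exact hu.2.1.trans (radialEnergy_le_polarize he hg hC
      (integrable_of_vanishing u.continuous hu.1.2.1) (integrable_of_vanishing hpc hp.2.1))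
  · rw [← hu.2.2 Φ hΦ]
    exact integral_comp_polarize he
      (integrable_of_vanishing (r := r) (Φ.continuous.comp u.continuous) fun x hx => by
        simp [hu.1.2.1 x hx, hΦ])
      (integrable_of_vanishing (r := r) (Φ.continuous.comp hpc) fun x hx => by
        simp [hp.2.1 x hx, hΦ])

/-- Among the competitors there is a radially nonincreasing one. -/
theorem exists_radial_competitor {f : Rn n → ℝ} (hf : UniformContinuous f) {r M : ℝ}
    (hf0 : ∀ x, f x ∈ Icc 0 M) (hfr : ∀ x, r ≤ ‖x‖ → f x = 0) {g : ℝ → ℝ} (hg : Antitone g) {C : ℝ}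
    (hC : ∀ r, |g r| ≤ C) :
    ∃ u ∈ competitors g f r M, ∀ x y : Rn n, ‖x‖ < ‖y‖ → u y ≤ u x := by
  have hfmem : (⟨f, hf.continuous⟩ : C(Rn n, ℝ)) ∈ competitors g f r M :=
    ⟨⟨hf0, hfr, fun _ _ h => h⟩, le_rfl, fun _ _ => rfl⟩
  -- A minimizer of the second moment: every polarization of it towards the origin is again a
  -- competitor and cannot do better.
  obtain ⟨u, hu, hmin⟩ := (isCompact_competitors hf r M hg.measurable hC).exists_isMinOn ⟨_, hfmem⟩
    ((continuousOn_secondMoment f r M).mono fun u hu => hu.1)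
  refine ⟨u, hu, fun x y hxy => ?_⟩
  obtain ⟨e, t, he, ht, hs, rfl⟩ := exists_mirror hxy
  obtain ⟨v, hv, hvu⟩ := polarize_mem_competitors he ht.le hf hg hC hu
  have hle := hmin hv
  simp only [mem_ofPred_eq] at hle
  have hvc := v.continuous
  have hv0 := hv.1.2.1
  rw [hvu] at hvc hv0
  simp only [hvu] at hle
  exact le_of_secondMoment_le_polarize he ht u.continuous hvc
    (integrable_of_vanishing (r := r) (u.continuous.mul (continuous_norm.pow 2)) fun x hx => by
      simp [hu.1.2.1 x hx])
    (integrable_of_vanishing (r := r) (hvc.mul (continuous_norm.pow 2)) fun x hx => by simp [hv0 x hx])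
    hle hs

/-- The constraint tests only Φ with Φ 0 = 0, constants not being integrable on the whole space. On
the ball, which carries both functions, subtracting Φ 0 yields all Φ, hence equality of the image
measures; positive levels lie in the ball. -/
theorem volume_level_eq_of_competitor {f : Rn n → ℝ} (hf : Continuous f) {r M : ℝ}
    (hfr : ∀ x, r ≤ ‖x‖ → f x = 0) {g : ℝ → ℝ} {u : C(Rn n, ℝ)} (hu : u ∈ competitors g f r M)
    {t : ℝ} (ht : 0 < t) : volume {y | t < u y} = volume {y | t < f y} := by
  set B := Metric.closedBall (0 : Rn n) r
  have hfin : IsFiniteMeasure (volume.restrict B) :=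
    ⟨by rw [Measure.restrict_apply_univ]; exact measure_closedBall_lt_top⟩
  have hB : ∀ {v : Rn n → ℝ}, (∀ x, r ≤ ‖x‖ → v x = 0) → ∀ Φ : ℝ →ᵇ ℝ, Continuous v →
      ∫ x in B, Φ (v x) = (∫ x, (Φ - BoundedContinuousFunction.const ℝ (Φ 0)) (v x)) +
        volume.real B * Φ 0 := by
    intro v hv Φ hvc
    have hi : Integrable fun x => (Φ - BoundedContinuousFunction.const ℝ (Φ 0)) (v x) :=
      integrable_of_vanishing (r := r) ((BoundedContinuousFunction.continuous _).comp hvc)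
        fun x hx => by simp [hv x hx]
    have : ∫ x, (Φ - BoundedContinuousFunction.const ℝ (Φ 0)) (v x) =
        ∫ x in B, (Φ - BoundedContinuousFunction.const ℝ (Φ 0)) (v x) := by
      refine (setIntegral_eq_integral_of_forall_compl_eq_zero fun x hx => ?_).symm
      have : r ≤ ‖x‖ := by
        simp only [B, mem_closedBall_zero_iff, not_le] at hx; exact hx.le
      simp [hv x this]
    rw [this, ← smul_eq_mul, ← setIntegral_const, ← integral_add hi.integrableOn]
    · simp
    · exact integrable_const _
  have hmap : Measure.map u (volume.restrict B) = Measure.map f (volume.restrict B) := by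
    have := Measure.isFiniteMeasure_map (volume.restrict B) u
    have := Measure.isFiniteMeasure_map (volume.restrict B) f
    refine ext_of_forall_integral_eq_of_IsFiniteMeasure fun Φ => ?_
    rw [integral_map u.continuous.measurable.aemeasurable Φ.continuous.aestronglyMeasurable,
      integral_map hf.measurable.aemeasurable Φ.continuous.aestronglyMeasurable,
      hB hu.1.2.1 Φ u.continuous, hB hfr Φ hf, hu.2.2 _ (by simp)]
  have hlev : ∀ {v : Rn n → ℝ}, (∀ x, r ≤ ‖x‖ → v x = 0) → Continuous v →
      Measure.map v (volume.restrict B) (Ioi t) = volume {y | t < v y} := by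
    intro v hv hvc
    rw [Measure.map_apply hvc.measurable measurableSet_Ioi,
      Measure.restrict_apply (hvc.measurable measurableSet_Ioi)]
    congr 1
    ext y
    simp only [mem_inter_iff, mem_preimage, mem_Ioi, mem_ofPred_eq, and_iff_left_iff_imp]
    intro hy
    by_contra hyB
    have : r ≤ ‖y‖ := by
      simp only [B, mem_closedBall_zero_iff, not_le] at hyB; exact hyB.le
    rw [hv y this] at hy
    linarith
  rw [← hlev hu.1.2.1 u.continuous, hmap, hlev hfr hf]

/-- Positive-volume or empty, a level set here is an open ball. Continuity supplies openness and
extends `hrad` to points of equal norm, by approaching x along c • x with c < 1. -/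
theorem mem_symmSet_level_iff (hn : 0 < n) {u : Rn n → ℝ} (hu : Continuous u)
    (hrad : ∀ x y : Rn n, ‖x‖ < ‖y‖ → u y ≤ u x) {t : ℝ} (hfin : volume {y | t < u y} ≠ ∞)
    (x : Rn n) : x ∈ symmSet {y | t < u y} ↔ t < u x := by
  have hex : ∀ s : ℝ, 0 ≤ s → ∃ z : Rn n, ‖z‖ = s := fun s hs =>
    ⟨EuclideanSpace.single ⟨0, hn⟩ s, by simp [abs_of_nonneg hs]⟩
  have hrad' : ∀ x y : Rn n, ‖x‖ ≤ ‖y‖ → u y ≤ u x := by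
    intro x y hxy
    have h1 : Filter.Tendsto (fun c : ℝ => u (c • x)) (nhdsWithin 1 (Iio 1)) (nhds (u x)) := by
      have : Continuous fun c : ℝ => u (c • x) := by fun_prop
      simpa using (this.tendsto 1).mono_left nhdsWithin_le_nhds
    by_cases hy : y = 0
    · have : x = 0 := by rw [hy, norm_zero] at hxy; exact norm_le_zero_iff.1 hxy
      rw [hy, this]
    refine ge_of_tendsto h1 ?_
    filter_upwards [Ioo_mem_nhdsLT (show (0 : ℝ) < 1 by norm_num)] with c hc
    refine hrad _ _ ?_
    rw [norm_smul, Real.norm_of_nonneg hc.1.le]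
    have := norm_pos_iff.2 hy
    nlinarith [hc.2, hc.1]
  rw [mem_symmSet]
  constructor
  · intro h
    by_contra hx
    have : symmRadius {y | t < u y} ≤ symmRadius (Metric.ball (0 : Rn n) ‖x‖) := by
      refine symmRadius_mono measure_ball_lt_top.ne (measure_mono fun y hy => ?_)
      rw [mem_ball_zero_iff]
      by_contra hxy
      exact hx (lt_of_lt_of_le hy (hrad' _ _ (not_lt.1 hxy)))
    rw [symmRadius_ball hn _ (norm_nonneg x)] at this
    linarith
  · intro h
    obtain ⟨c, hc1, hc⟩ : ∃ c : ℝ, ‖x‖ < c ∧ ∀ y : Rn n, ‖y‖ < c → t < u y := by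
      by_cases hx0 : x = 0
      · obtain ⟨ε, hε, hb⟩ := Metric.isOpen_iff.1 (isOpen_lt continuous_const hu) x h
        refine ⟨ε, by simpa [hx0] using hε, fun y hy => hb ?_⟩
        rw [hx0, mem_ball_zero_iff]; exact hy
      have h1 : ∀ᶠ c : ℝ in nhds 1, t < u (c • x) := by
        have : Continuous fun c : ℝ => u (c • x) := by fun_prop
        exact (this.tendsto' 1 (u x) (by simp)).eventually_const_lt h
      have h2 : ∀ᶠ c : ℝ in nhdsWithin 1 (Ioi 1), t < u (c • x) := h1.filter_mono nhdsWithin_le_nhds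
      obtain ⟨c, hc, hc1⟩ := (h2.and self_mem_nhdsWithin).exists
      have hx := norm_pos_iff.2 hx0
      refine ⟨c * ‖x‖, by nlinarith [hc1], fun y hy => lt_of_lt_of_le hc (hrad' _ _ ?_)⟩
      rw [norm_smul, Real.norm_of_nonneg (by linarith [hc1])]
      exact hy.le
    have hc0 : 0 ≤ c := (norm_nonneg x).trans hc1.le
    have : symmRadius (Metric.ball (0 : Rn n) c) ≤ symmRadius {y | t < u y} :=
      symmRadius_mono hfin (measure_mono fun y hy => hc y (mem_ball_zero_iff.1 hy))
    rw [symmRadius_ball hn _ hc0] at this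
    linarith

theorem rearrangement_congr_level {f u : Rn n → ℝ} (hf : ∀ x, 0 ≤ f x) (hu : ∀ x, 0 ≤ u x)
    (h : ∀ t, 0 < t → volume {y | t < u y} = volume {y | t < f y}) :
    rearrangement u = rearrangement f := by
  funext x
  refine setIntegral_congr_fun measurableSet_Ioi fun t ht => ?_
  simp only [abs_of_nonneg (hf _), abs_of_nonneg (hu _), symmSet, h t ht]

theorem isLayered_of_vanishing {f : Rn n → ℝ} (hf : Continuous f) {r M : ℝ}
    (hf0 : ∀ x, f x ∈ Icc 0 M) (hfr : ∀ x, r ≤ ‖x‖ → f x = 0) : IsLayered M f :=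
  ⟨hf.measurable, fun x => (hf0 x).1, fun x => (hf0 x).2, integrable_of_vanishing hf hfr⟩

/-- The radial competitor is its own rearrangement, and its rearrangement is that of f by
equimeasurability. -/
theorem radialEnergy_le_rearrangement_of_continuous (hn : 0 < n) {f : Rn n → ℝ}
    (hf : UniformContinuous f) {r M : ℝ} (hf0 : ∀ x, f x ∈ Icc 0 M)
    (hfr : ∀ x, r ≤ ‖x‖ → f x = 0) {g : ℝ → ℝ} (hg : Antitone g) {C : ℝ}
    (hC : ∀ r, |g r| ≤ C) : radialEnergy g f ≤ radialEnergy g (rearrangement f) := by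
  obtain ⟨u, hu, hrad⟩ := exists_radial_competitor hf hf0 hfr hg hC
  have hul := isLayered_of_vanishing u.continuous hu.1.1 hu.1.2.1
  have hr : rearrangement u = rearrangement f :=
    rearrangement_congr_level (fun x => (hf0 x).1) hul.nonneg fun t ht =>
      volume_level_eq_of_competitor hf.continuous hfr hu ht
  have hu' : rearrangement u = u := by
    funext x
    rw [rearrangement_eq_integral hn hul, ← integral_layer_snd hul.nonneg hul.le x]
    refine setIntegral_congr_fun measurableSet_Ioo fun t ht => ?_
    simp only [symmLayer, layer, indicator, hul.abs_eq,
      mem_symmSet_level_iff hn u.continuous hrad (hul.volume_level_ne_top ht.1)]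
  rw [← hr, hu']
  exact hu.2.1

end RieszContinuous

/-! ### The Riesz rearrangement inequality -/

section Riesz
variable {n : ℕ}

/-- Bilinearity: u⊗u - v⊗v = u⊗(u - v) + (u - v)⊗v. -/
theorem abs_radialEnergy_sub_le {g : ℝ → ℝ} (hg : Measurable g) {C : ℝ} (hC : ∀ r, |g r| ≤ C)
    {u v : Rn n → ℝ} (hu : Integrable u) (hv : Integrable v) :
    |radialEnergy g u - radialEnergy g v| ≤
      C * (((∫ x, |u x|) + ∫ x, |v x|) * ∫ x, |u x - v x|) := by
  have hC0 : 0 ≤ C := (abs_nonneg _).trans (hC 0)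
  have hd : Integrable fun x => |u x - v x| := (hu.sub hv).abs
  have i1 : Integrable fun p : Rn n × Rn n => |u p.1| * |u p.2 - v p.2| := hu.abs.mul_prod hd
  have i2 : Integrable fun p : Rn n × Rn n => |u p.1 - v p.1| * |v p.2| := hd.mul_prod hv.abs
  unfold radialEnergy
  rw [← integral_sub (integrable_radialEnergy hg hC hu hu) (integrable_radialEnergy hg hC hv hv)]
  calc |∫ p : Rn n × Rn n, (u p.1 * u p.2 * g ‖p.1 - p.2‖ - v p.1 * v p.2 * g ‖p.1 - p.2‖)|
      ≤ ∫ p : Rn n × Rn n, C * (|u p.1| * |u p.2 - v p.2| + |u p.1 - v p.1| * |v p.2|) := by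
        rw [← Real.norm_eq_abs]
        refine norm_integral_le_of_norm_le ((i1.add i2).const_mul C)
          (Filter.Eventually.of_forall fun p => ?_)
        have : u p.1 * u p.2 * g ‖p.1 - p.2‖ - v p.1 * v p.2 * g ‖p.1 - p.2‖ =
          g ‖p.1 - p.2‖ * (u p.1 * (u p.2 - v p.2) + (u p.1 - v p.1) * v p.2) := by ring
        rw [this, norm_mul]
        refine mul_le_mul (hC _) ?_ (norm_nonneg _) hC0
        refine (norm_add_le _ _).trans_eq ?_
        simp only [norm_mul, Real.norm_eq_abs]
    _ = C * (((∫ x, |u x|) + ∫ x, |v x|) * ∫ x, |u x - v x|) := by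
        rw [integral_const_mul, integral_add i1 i2]
        have e1 : ∫ p : Rn n × Rn n, |u p.1| * |u p.2 - v p.2| =
            (∫ x, |u x|) * ∫ x, |u x - v x| :=
          integral_prod_mul (fun x => |u x|) (fun x => |u x - v x|)
        have e2 : ∫ p : Rn n × Rn n, |u p.1 - v p.1| * |v p.2| =
            (∫ x, |u x - v x|) * ∫ x, |v x| :=
          integral_prod_mul (fun x => |u x - v x|) (fun x => |v x|)
        rw [e1, e2]; ring

theorem integral_abs_of_nonneg {u : Rn n → ℝ} (h : ∀ x, 0 ≤ u x) : ∫ x, |u x| = ∫ x, u x := by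
  simp_rw [abs_of_nonneg (h _)]

theorem exists_continuous_approx {N : ℝ} {f : Rn n → ℝ} (hf : IsLayered N f) {ε : ℝ}
    (hε : 0 < ε) : ∃ (h : Rn n → ℝ) (r M : ℝ), UniformContinuous h ∧ (∀ x, h x ∈ Icc 0 M) ∧
      (∀ x, r ≤ ‖x‖ → h x = 0) ∧ ∫ x, |f x - h x| ≤ ε := by
  obtain ⟨h, hs, hle, hc, hi⟩ := hf.integrable.exists_hasCompactSupport_integral_sub_le hε
  have hc' : Continuous fun x => max (h x) 0 := hc.max continuous_const
  have hs' : HasCompactSupport fun x => max (h x) 0 := hs.comp_left (g := fun s => max s 0) (by simp)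
  obtain ⟨M, hM⟩ := hs'.exists_bound_of_continuous hc'
  obtain ⟨r, hr⟩ := hs'.isCompact.isBounded.subset_ball 0
  refine ⟨fun x => max (h x) 0, r, M, hs'.uniformContinuous_of_continuous hc', fun x => ?_,
    fun x hx => ?_, ?_⟩
  · exact ⟨le_max_right _ _, (le_abs_self _).trans (hM x)⟩
  · by_contra h0
    have := hr (subset_tsupport _ (Function.mem_support.2 h0))
    rw [mem_ball_zero_iff] at this; linarith
  · refine le_trans (integral_mono (hf.integrable.sub
      (hc'.integrable_of_hasCompactSupport hs')).abs (hf.integrable.sub hi).norm fun x => ?_) hle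
    have h0 := hf.nonneg x
    simp only [Pi.sub_apply, Real.norm_eq_abs]
    rcases le_total (h x) 0 with h1 | h1
    · rw [max_eq_right h1, sub_zero, abs_of_nonneg h0, abs_of_nonneg (by linarith)]; linarith
    · rw [max_eq_left h1]

/-- The Riesz rearrangement inequality for a bounded symmetric nonincreasing kernel. -/
theorem radialEnergy_le_rearrangement (hn : 0 < n) {N : ℝ} {f : Rn n → ℝ} (hf : IsLayered N f)
    {g : ℝ → ℝ} (hg : Antitone g) {C : ℝ} (hC : ∀ r, |g r| ≤ C) :
    radialEnergy g f ≤ radialEnergy g (rearrangement f) := by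
  set m := ∫ x, f x
  have hC0 : 0 ≤ C := (abs_nonneg _).trans (hC 0)
  -- A continuous function ε-close to f in L¹ has a rearrangement ε-close to that of f, by the
  -- contraction property; both energies then change by the same error bound.
  have key : ∀ ε : ℝ, 0 < ε →
      radialEnergy g f ≤ radialEnergy g (rearrangement f) + 2 * (C * ((m + (m + ε)) * ε)) := by
    intro ε hε
    obtain ⟨h, r, M, huc, h0, hr, hle⟩ := exists_continuous_approx hf hε
    have hh := isLayered_of_vanishing huc.continuous h0 hr
    have hmh : ∫ x, h x ≤ m + ε := by
      have : (∫ x, h x) - m ≤ ∫ x, |f x - h x| := by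
        rw [← integral_sub hh.integrable hf.integrable]
        refine integral_mono (hh.integrable.sub hf.integrable)
          (hf.integrable.sub hh.integrable).abs fun x => ?_
        rw [abs_sub_comm]; exact le_abs_self _
      linarith
    have hm0 : 0 ≤ m := integral_nonneg hf.nonneg
    have e1 := abs_radialEnergy_sub_le hg.measurable hC hf.integrable hh.integrable
    have e2 := abs_radialEnergy_sub_le hg.measurable hC (integrable_rearrangement hn hf)
      (integrable_rearrangement hn hh)
    have e3 := integral_abs_rearrangement_sub_le hn (hf.mono (le_max_left N M))
      (hh.mono (le_max_right N M))
    have e4 := radialEnergy_le_rearrangement_of_continuous hn huc h0 hr hg hC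
    rw [integral_abs_of_nonneg hf.nonneg, integral_abs_of_nonneg hh.nonneg] at e1
    rw [integral_abs_of_nonneg (rearrangement_nonneg f),
      integral_abs_of_nonneg (rearrangement_nonneg h), integral_rearrangement hn hf,
      integral_rearrangement hn hh] at e2
    have hd0 : 0 ≤ ∫ x, |rearrangement f x - rearrangement h x| :=
      integral_nonneg fun _ => abs_nonneg _
    have hd1 : 0 ≤ ∫ x, |f x - h x| := integral_nonneg fun _ => abs_nonneg _
    have hh0 : 0 ≤ ∫ x, h x := integral_nonneg hh.nonneg
    have b1 : C * ((m + ∫ x, h x) * ∫ x, |f x - h x|) ≤ C * ((m + (m + ε)) * ε) := by gcongr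
    have b2 : C * ((m + ∫ x, h x) * ∫ x, |rearrangement f x - rearrangement h x|) ≤
        C * ((m + (m + ε)) * ε) := by
      gcongr
      exact e3.trans hle
    have a1 := abs_le.1 (e1.trans b1)
    have a2 := abs_le.1 (e2.trans b2)
    linarith [a1.1, a1.2, a2.1, a2.2]
  have hlim : Filter.Tendsto
      (fun ε : ℝ => radialEnergy g (rearrangement f) + 2 * (C * ((m + (m + ε)) * ε)))
      (nhdsWithin 0 (Ioi 0)) (nhds (radialEnergy g (rearrangement f))) := by
    have : Continuous fun ε : ℝ =>
        radialEnergy g (rearrangement f) + 2 * (C * ((m + (m + ε)) * ε)) := by fun_prop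
    exact (this.tendsto' 0 _ (by simp)).mono_left nhdsWithin_le_nhds
  exact ge_of_tendsto hlim (Filter.eventually_of_mem self_mem_nhdsWithin fun ε hε => key ε hε)

end Riesz

/-! ### Finiteness of the energy -/

section Energy
variable {n : ℕ}

/-- The truncated quadratic profile `(L² - r²)₊`. -/
def cap (L r : ℝ) : ℝ := max (L ^ 2 - r ^ 2) 0

theorem measurable_cap (L : ℝ) : Measurable (cap L) := by unfold cap; fun_prop

theorem abs_cap_le (L r : ℝ) : |cap L r| ≤ L ^ 2 := by
  unfold cap
  rw [abs_of_nonneg (le_max_right _ _)]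
  exact max_le (by nlinarith [sq_nonneg r]) (sq_nonneg L)

theorem cap_antitoneOn (L : ℝ) : AntitoneOn (cap L) (Ioi 0) := by
  intro r hr s _ hrs
  unfold cap
  have : r ^ 2 ≤ s ^ 2 := by have := mem_Ioi.1 hr; gcongr
  exact max_le_max (by linarith) le_rfl

/-- At distance less than 1, one factor is bounded by N and the positive part of W is integrable;
farther away W ≤ w 1. -/
theorem energyPos_ne_top {W : Rn n → ℝ} (hWm : Measurable W) {w : ℝ → ℝ}
    (hW : ∀ x, x ≠ 0 → W x = w ‖x‖) (hw : AntitoneOn w (Ioi 0))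
    (hpos : ∫⁻ x in Metric.ball 0 1, ENNReal.ofReal (W x) ≠ ∞) {N : ℝ} {u : Rn n → ℝ}
    (hu : Integrable u) (h0 : ∀ x, 0 ≤ u x) (hN : ∀ x, u x ≤ N) : energyPos W u ≠ ∞ := by
  set h : Rn n → ℝ≥0∞ := (Metric.ball 0 1).indicator fun x => ENNReal.ofReal (W x) with hh
  have hhm : Measurable h := hWm.ennreal_ofReal.indicator Metric.isOpen_ball.measurableSet
  have hhi : ∫⁻ x, h x ≠ ∞ := by rwa [lintegral_indicator Metric.isOpen_ball.measurableSet]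
  have hm : ∫⁻ x, ENNReal.ofReal (u x) ≠ ∞ := by
    rw [← ofReal_integral_eq_lintegral_ofReal hu (Filter.Eventually.of_forall h0)]
    exact ENNReal.ofReal_ne_top
  have hle : ∀ x y, ENNReal.ofReal (u x * u y * W (x - y)) ≤ ENNReal.ofReal (u x) *
      (ENNReal.ofReal N * h (x - y) + ENNReal.ofReal (w 1) * ENNReal.ofReal (u y)) := by
    intro x y
    rw [mul_assoc, ENNReal.ofReal_mul (h0 x), ENNReal.ofReal_mul (h0 y)]
    refine mul_le_mul_right ?_ _
    by_cases hxy : ‖x - y‖ < 1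
    · refine le_trans ?_ (le_add_right le_rfl)
      rw [hh, indicator_of_mem (by simpa using hxy)]
      exact mul_le_mul_left (ENNReal.ofReal_le_ofReal (hN y)) _
    · refine le_trans ?_ (le_add_left le_rfl)
      rw [mul_comm]
      refine mul_le_mul_left (ENNReal.ofReal_le_ofReal ?_) _
      have h1 : 1 ≤ ‖x - y‖ := not_lt.1 hxy
      rw [hW _ (norm_pos_iff.1 (by linarith))]
      exact hw (mem_Ioi.2 one_pos) (mem_Ioi.2 (by linarith)) h1
  refine ne_top_of_le_ne_top (b := (∫⁻ x, ENNReal.ofReal (u x)) *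
    (ENNReal.ofReal N * (∫⁻ x, h x) + ENNReal.ofReal (w 1) * ∫⁻ x, ENNReal.ofReal (u x))) ?_ ?_
  · exact ENNReal.mul_ne_top hm (ENNReal.add_ne_top.2
      ⟨ENNReal.mul_ne_top ENNReal.ofReal_ne_top hhi, ENNReal.mul_ne_top ENNReal.ofReal_ne_top hm⟩)
  · refine (lintegral_mono fun x => lintegral_mono fun y => hle x y).trans_eq ?_
    have : ∀ x, ∫⁻ y, ENNReal.ofReal (u x) *
        (ENNReal.ofReal N * h (x - y) + ENNReal.ofReal (w 1) * ENNReal.ofReal (u y)) =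
        ENNReal.ofReal (u x) * (ENNReal.ofReal N * (∫⁻ x, h x) +
          ENNReal.ofReal (w 1) * ∫⁻ x, ENNReal.ofReal (u x)) := by
      intro x
      rw [lintegral_const_mul' _ _ ENNReal.ofReal_ne_top, lintegral_add_left (by fun_prop),
        lintegral_const_mul' _ _ ENNReal.ofReal_ne_top,
        lintegral_const_mul' _ _ ENNReal.ofReal_ne_top, lintegral_sub_left_eq_self]
    simp_rw [this]
    rw [lintegral_mul_const'']
    exact hu.1.aemeasurable.ennreal_ofReal

/-- Points of the support are at distance at most 2R, where W ≥ w(2R) off the diagonal. -/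
theorem energyNeg_ne_top (hn : 0 < n) {W : Rn n → ℝ} {w : ℝ → ℝ}
    (hW : ∀ x, x ≠ 0 → W x = w ‖x‖) (hw : AntitoneOn w (Ioi 0)) {u : Rn n → ℝ}
    (hu : Integrable u) (h0 : ∀ x, 0 ≤ u x) {R : ℝ} (hR : 0 < R) (hs : ∀ x, R < ‖x‖ → u x = 0) :
    energyNeg W u ≠ ∞ := by
  have : Nonempty (Fin n) := ⟨⟨0, hn⟩⟩
  have hm : ∫⁻ x, ENNReal.ofReal (u x) ≠ ∞ := by
    rw [← ofReal_integral_eq_lintegral_ofReal hu (Filter.Eventually.of_forall h0)]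
    exact ENNReal.ofReal_ne_top
  have hle : ∀ x y, y ≠ x → ENNReal.ofReal (-(u x * u y * W (x - y))) ≤ ENNReal.ofReal (u x) *
      (ENNReal.ofReal (-w (2 * R)) * ENNReal.ofReal (u y)) := by
    intro x y hxy
    have hn : -(u x * u y * W (x - y)) = u x * (-W (x - y) * u y) := by ring
    rw [hn, ENNReal.ofReal_mul (h0 x), mul_comm (-W (x - y)), ENNReal.ofReal_mul (h0 y),
      mul_comm (ENNReal.ofReal (u y))]
    by_cases hx : R < ‖x‖
    · simp [hs x hx]
    by_cases hy : R < ‖y‖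
    · simp [hs y hy]
    gcongr
    have hd : x - y ≠ 0 := sub_ne_zero.2 hxy.symm
    rw [hW _ hd]
    exact hw (mem_Ioi.2 (norm_pos_iff.2 hd)) (mem_Ioi.2 (by positivity))
      ((norm_sub_le x y).trans (by linarith))
  refine ne_top_of_le_ne_top (b := (∫⁻ x, ENNReal.ofReal (u x)) *
    (ENNReal.ofReal (-w (2 * R)) * ∫⁻ x, ENNReal.ofReal (u x))) ?_ ?_
  · exact ENNReal.mul_ne_top hm (ENNReal.mul_ne_top ENNReal.ofReal_ne_top hm)
  · have hmono : ∀ x, ∫⁻ y, ENNReal.ofReal (-(u x * u y * W (x - y))) ≤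
        ∫⁻ y, ENNReal.ofReal (u x) * (ENNReal.ofReal (-w (2 * R)) * ENNReal.ofReal (u y)) := by
      intro x
      have hae : ∀ᵐ y : Rn n, y ≠ x := compl_mem_ae_iff.2 (measure_singleton x)
      exact lintegral_mono_ae (hae.mono fun y hy => hle x y hy)
    refine (lintegral_mono hmono).trans_eq ?_
    simp_rw [lintegral_const_mul' _ _ ENNReal.ofReal_ne_top]
    rw [lintegral_mul_const'']
    exact hu.1.aemeasurable.ennreal_ofReal

theorem integrable_and_energy_eq {W : Rn n → ℝ} (hWm : Measurable W) {u : Rn n → ℝ}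
    (hu : Integrable u) (hp : energyPos W u ≠ ∞) (hq : energyNeg W u ≠ ∞) :
    Integrable (fun p : Rn n × Rn n => u p.1 * u p.2 * W (p.1 - p.2)) ∧
      energy W u = ((∫ p : Rn n × Rn n, u p.1 * u p.2 * W (p.1 - p.2) : ℝ) : EReal) := by
  have hm : AEStronglyMeasurable (fun p : Rn n × Rn n => u p.1 * u p.2 * W (p.1 - p.2))
      (volume.prod volume) := (hu.mul_prod hu).1.mul
    (hWm.comp (measurable_fst.sub measurable_snd)).aestronglyMeasurable
  have e1 : energyPos W u = ∫⁻ p : Rn n × Rn n,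
      ENNReal.ofReal (u p.1 * u p.2 * W (p.1 - p.2)) := by
    rw [Measure.volume_eq_prod, lintegral_prod _ hm.aemeasurable.ennreal_ofReal]; rfl
  have e2 : energyNeg W u = ∫⁻ p : Rn n × Rn n,
      ENNReal.ofReal (-(u p.1 * u p.2 * W (p.1 - p.2))) := by
    have hm' : AEMeasurable (fun p : Rn n × Rn n =>
        ENNReal.ofReal (-(u p.1 * u p.2 * W (p.1 - p.2)))) (volume.prod volume) :=
      hm.aemeasurable.neg.ennreal_ofReal
    rw [Measure.volume_eq_prod, lintegral_prod _ hm']; rfl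
  have hi : Integrable (fun p : Rn n × Rn n => u p.1 * u p.2 * W (p.1 - p.2)) := by
    refine ⟨hm, ?_⟩
    rw [hasFiniteIntegral_iff_norm]
    have : ∀ a : ℝ, ENNReal.ofReal ‖a‖ ≤ ENNReal.ofReal a + ENNReal.ofReal (-a) := by
      intro a
      rcases le_total 0 a with h | h
      · rw [Real.norm_of_nonneg h]; exact le_add_right le_rfl
      · rw [Real.norm_of_nonpos h]; exact le_add_left le_rfl
    refine (lintegral_mono fun p => this _).trans_lt ?_
    rw [lintegral_add_left' (Measure.volume_eq_prod (Rn n) (Rn n) ▸ hm.aemeasurable.ennreal_ofReal),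
      ← e1, ← e2]
    exact ENNReal.add_lt_top.2 ⟨hp.lt_top, hq.lt_top⟩
  refine ⟨hi, ?_⟩
  rw [integral_eq_lintegral_pos_part_sub_lintegral_neg_part hi, ← e1, ← e2, energy,
    EReal.coe_sub, EReal.coe_ennreal_toReal hp, EReal.coe_ennreal_toReal hq]

/-- The truncation of a profile on `(0, ∞)` at the levels `±j`. -/
def clampProfile (k : ℝ → ℝ) (j : ℕ) (r : ℝ) : ℝ :=
  -- The value j on r ≤ 0 is the upper bound, so the clamp is antitone on all of ℝ whatever k is
  -- there.
  if r ≤ 0 then j else max (-(j : ℝ)) (min j (k r))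

theorem abs_clampProfile_le (k : ℝ → ℝ) (j : ℕ) (r : ℝ) : |clampProfile k j r| ≤ j := by
  have : (0 : ℝ) ≤ j := j.cast_nonneg
  unfold clampProfile
  split_ifs
  · rw [abs_of_nonneg this]
  · rw [abs_le]; exact ⟨le_max_left _ _, max_le (by linarith) (min_le_left _ _)⟩

theorem antitone_clampProfile {k : ℝ → ℝ} (hk : AntitoneOn k (Ioi 0)) (j : ℕ) :
    Antitone (clampProfile k j) := by
  have h0 : (0 : ℝ) ≤ j := j.cast_nonneg
  intro r s hrs
  by_cases hr : r ≤ 0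
  · conv_rhs => rw [clampProfile, if_pos hr]
    exact (le_abs_self _).trans (abs_clampProfile_le k j s)
  · have hs : ¬ s ≤ 0 := by intro h; exact hr (hrs.trans h)
    simp only [clampProfile, if_neg hr, if_neg hs]
    exact max_le_max le_rfl (min_le_min le_rfl (hk (not_le.1 hr) (not_le.1 hs) hrs))

theorem ae_fst_sub_snd_ne_zero (hn : 0 < n) : ∀ᵐ p : Rn n × Rn n, p.1 - p.2 ≠ 0 := by
  have : Nonempty (Fin n) := ⟨⟨0, hn⟩⟩
  have h : ∀ᵐ z : Rn n, z ≠ 0 := compl_mem_ae_iff.2 (measure_singleton 0)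
  exact (quasiMeasurePreserving_sub_of_right_invariant volume volume).ae h

theorem tendsto_radialEnergy_clamp (hn : 0 < n) {k : ℝ → ℝ} (hk : AntitoneOn k (Ioi 0))
    {u : Rn n → ℝ} {K : Rn n → ℝ} (hK : ∀ x, x ≠ 0 → K x = k ‖x‖) (hu : Integrable u)
    (hi : Integrable (fun p : Rn n × Rn n => u p.1 * u p.2 * K (p.1 - p.2))) :
    Filter.Tendsto (fun j => radialEnergy (clampProfile k j) u) Filter.atTop
      (nhds (∫ p : Rn n × Rn n, u p.1 * u p.2 * K (p.1 - p.2))) := by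
  refine tendsto_integral_of_dominated_convergence
    (fun p => ‖u p.1 * u p.2 * K (p.1 - p.2)‖)
    (fun j => (integrable_radialEnergy (antitone_clampProfile hk j).measurable
      (abs_clampProfile_le k j) hu hu).1) hi.norm ?_ ?_
  · intro j
    filter_upwards [ae_fst_sub_snd_ne_zero hn] with p hp
    rw [norm_mul, norm_mul (u p.1 * u p.2), hK _ hp]
    refine mul_le_mul_of_nonneg_left ?_ (norm_nonneg _)
    rw [clampProfile, if_neg (not_le.2 (norm_pos_iff.2 hp)), Real.norm_eq_abs, Real.norm_eq_abs]
    have h0 : (0 : ℝ) ≤ j := j.cast_nonneg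
    rw [abs_le]
    constructor
    · refine le_trans ?_ (le_max_right _ _)
      exact le_min (by linarith [abs_nonneg (k ‖p.1 - p.2‖)]) (neg_abs_le _)
    · exact max_le (by linarith [abs_nonneg (k ‖p.1 - p.2‖)])
        ((min_le_right _ _).trans (le_abs_self _))
  · filter_upwards [ae_fst_sub_snd_ne_zero hn] with p hp
    rw [hK _ hp]
    refine tendsto_const_nhds.congr' ?_
    obtain ⟨j₀, hj₀⟩ := exists_nat_ge |k ‖p.1 - p.2‖|
    filter_upwards [Filter.eventually_ge_atTop j₀] with j hj
    have : |k ‖p.1 - p.2‖| ≤ j := hj₀.trans (by exact_mod_cast hj)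
    rw [abs_le] at this
    rw [clampProfile, if_neg (not_le.2 (norm_pos_iff.2 hp)), min_eq_right this.2,
      max_eq_right this.1]

/-- Reduction to the truncated quadratic profile: if `W - c (L² - |x|²)₊` is radially
nonincreasing, then the energy gap of `W` is bounded below by that of the profile. -/
theorem energy_gap_ge (hn : 0 < n) {W : Rn n → ℝ} (hWm : Measurable W) {w : ℝ → ℝ}
    (hW : ∀ x, x ≠ 0 → W x = w ‖x‖) {c L : ℝ} (hc : 0 ≤ c)
    (hw : AntitoneOn (fun r => w r - c * cap L r) (Ioi 0))
    (hpos : ∫⁻ x in Metric.ball 0 1, ENNReal.ofReal (W x) ≠ ∞) {N : ℝ} {f : Rn n → ℝ}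
    (hf : IsLayered N f) {R : ℝ} (hR : 0 < R) (hs : ∀ x, R < ‖x‖ → rearrangement f x = 0) {D : ℝ}
    (hD : D ≤ c * (radialEnergy (cap L) (rearrangement f) - radialEnergy (cap L) f)) :
    energyPos W f ≠ ∞ ∧ energyPos W (rearrangement f) ≠ ∞ ∧ energyNeg W (rearrangement f) ≠ ∞ ∧
      (D : EReal) ≤ energy W (rearrangement f) - energy W f := by
  have hw' : AntitoneOn w (Ioi 0) := by
    intro r hr s hs hrs
    have h1 := hw hr hs hrs
    have h2 := mul_le_mul_of_nonneg_left (cap_antitoneOn L hr hs hrs) hc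
    simp only at h1
    linarith
  have p1 := energyPos_ne_top hWm hW hw' hpos hf.integrable hf.nonneg hf.le
  have hri := integrable_rearrangement hn hf
  have p2 := energyPos_ne_top hWm hW hw' hpos hri (rearrangement_nonneg f) (rearrangement_le hn hf)
  have p3 := energyNeg_ne_top hn hW hw' hri (rearrangement_nonneg f) hR hs
  refine ⟨p1, p2, p3, ?_⟩
  obtain ⟨j1, e1⟩ := integrable_and_energy_eq hWm hri p2 p3
  -- If f spreads so far that its energy is -∞, the estimate is trivial.
  by_cases p4 : energyNeg W f = ∞
  · have : energy W f = ⊥ := by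
      rw [energy, p4, EReal.coe_ennreal_top, ← EReal.coe_ennreal_toReal p1]
      exact EReal.sub_top _
    rw [this, e1, EReal.coe_sub_bot]; exact le_top
  obtain ⟨j2, e2⟩ := integrable_and_energy_eq hWm hf.integrable p1 p4
  rw [e1, e2, ← EReal.coe_sub, EReal.coe_le_coe_iff]
  have key : ∀ {u : Rn n → ℝ}, Integrable u →
      Integrable (fun p : Rn n × Rn n => u p.1 * u p.2 * W (p.1 - p.2)) →
      Filter.Tendsto (fun j => radialEnergy (clampProfile (fun r => w r - c * cap L r) j) u)
        Filter.atTop (nhds ((∫ p : Rn n × Rn n, u p.1 * u p.2 * W (p.1 - p.2)) -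
          c * radialEnergy (cap L) u)) := by
    intro u hu hi
    have hq := (integrable_radialEnergy (measurable_cap L) (abs_cap_le L) hu hu).const_mul c
    have heq : ∀ p : Rn n × Rn n, u p.1 * u p.2 * W (p.1 - p.2) -
        c * (u p.1 * u p.2 * cap L ‖p.1 - p.2‖) =
        u p.1 * u p.2 * (W (p.1 - p.2) - c * cap L ‖p.1 - p.2‖) := fun p => by ring
    rw [radialEnergy, ← integral_const_mul, ← integral_sub hi hq]
    simp_rw [heq]
    refine tendsto_radialEnergy_clamp hn hw (K := fun x => W x - c * cap L ‖x‖)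
      (fun x hx => by simp only [hW x hx]) hu ?_
    exact (hi.sub hq).congr (Filter.Eventually.of_forall heq)
  -- Riesz for the bounded truncations of W - c·cap, in the limit: the remainder contributes a
  -- nonnegative gap.
  have := le_of_tendsto_of_tendsto' (key hf.integrable j2) (key hri j1) fun j =>
    radialEnergy_le_rearrangement hn hf (antitone_clampProfile hw j) (abs_clampProfile_le _ j)
  linarith

end Energy

/-! ### The energy of the truncated quadratic profile -/

section Quadratic
variable {n : ℕ}

/-- The nearest point of the closed ball of radius `K` around the origin. -/
def ballProj (K : ℝ) (v : Rn n) : Rn n := if ‖v‖ ≤ K then v else (K / ‖v‖) • v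

theorem norm_ballProj_le {K : ℝ} (hK : 0 ≤ K) (v : Rn n) : ‖ballProj K v‖ ≤ K := by
  unfold ballProj
  split_ifs with h
  · exact h
  · have : 0 < ‖v‖ := hK.trans_lt (not_le.1 h)
    rw [norm_smul, Real.norm_of_nonneg (by positivity), div_mul_cancel₀ _ this.ne']

theorem norm_ballProj_of_lt {K : ℝ} (hK : 0 ≤ K) {v : Rn n} (h : K < ‖v‖) :
    ‖ballProj K v‖ = K := by
  have : 0 < ‖v‖ := hK.trans_lt h
  rw [ballProj, if_neg (not_le.2 h), norm_smul, Real.norm_of_nonneg (by positivity),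
    div_mul_cancel₀ _ this.ne']

theorem norm_ballProj_le_norm {K : ℝ} (hK : 0 ≤ K) (v : Rn n) : ‖ballProj K v‖ ≤ ‖v‖ := by
  by_cases h : ‖v‖ ≤ K
  · rw [ballProj, if_pos h]
  · rw [norm_ballProj_of_lt hK (not_le.1 h)]; exact (not_le.1 h).le

/-- The variational inequality of the projection onto a convex set; used at two points it gives the
1-Lipschitz bound. -/
theorem inner_sub_ballProj_nonpos {K : ℝ} (hK : 0 ≤ K) (v : Rn n) {z : Rn n} (hz : ‖z‖ ≤ K) :
    inner ℝ (v - ballProj K v) (z - ballProj K v) ≤ 0 := by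
  by_cases h : ‖v‖ ≤ K
  · rw [ballProj, if_pos h]; simp
  · have hv : 0 < ‖v‖ := hK.trans_lt (not_le.1 h)
    rw [ballProj, if_neg h]
    have e1 : v - (K / ‖v‖) • v = (1 - K / ‖v‖) • v := by module
    rw [e1, real_inner_smul_left, inner_sub_right, inner_smul_right, real_inner_self_eq_norm_sq]
    have e2 : K / ‖v‖ * ‖v‖ ^ 2 = ‖v‖ * K := by field_simp
    rw [e2]
    refine mul_nonpos_of_nonneg_of_nonpos ?_ ?_
    · rw [sub_nonneg, div_le_one hv]; exact (not_le.1 h).le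
    · have := real_inner_le_norm v z
      nlinarith

theorem norm_ballProj_sub_le {K : ℝ} (hK : 0 ≤ K) (x y : Rn n) :
    ‖ballProj K x - ballProj K y‖ ≤ ‖x - y‖ := by
  have h1 := inner_sub_ballProj_nonpos hK x (norm_ballProj_le hK y)
  have h2 := inner_sub_ballProj_nonpos hK y (norm_ballProj_le hK x)
  set p := ballProj K x
  set q := ballProj K y
  have h3 : ‖p - q‖ ^ 2 = inner ℝ (x - y) (p - q) + inner ℝ (x - p) (q - p) +
      inner ℝ (y - q) (p - q) := by
    rw [← real_inner_self_eq_norm_sq]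
    simp only [inner_sub_left, inner_sub_right]; ring
  have h4 := real_inner_le_norm (x - y) (p - q)
  by_contra h
  have h5 := not_le.1 h
  nlinarith [norm_nonneg (x - y)]

theorem continuous_ballProj {K : ℝ} (hK : 0 ≤ K) : Continuous (ballProj (n := n) K) :=
  (LipschitzWith.of_dist_le_mul (K := 1) fun x y => by
    simpa [dist_eq_norm] using norm_ballProj_sub_le hK x y).continuous

/-- The second moment of differences in terms of the mean. -/
theorem integral_mul_norm_sub_sq {u : Rn n → ℝ} (hu : Integrable u) {T : Rn n → Rn n}
    (hT : Measurable T) {K : ℝ} (hK : ∀ x, ‖T x‖ ≤ K) :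
    Integrable (fun p : Rn n × Rn n => u p.1 * u p.2 * ‖T p.1 - T p.2‖ ^ 2) ∧
    ∫ p : Rn n × Rn n, u p.1 * u p.2 * ‖T p.1 - T p.2‖ ^ 2 =
      2 * ((∫ x, u x) * ∫ x, u x * ‖T x‖ ^ 2) - 2 * ‖∫ x, u x • T x‖ ^ 2 := by
  have hK0 : 0 ≤ K := (norm_nonneg _).trans (hK 0)
  have i1 : Integrable fun x => u x * ‖T x‖ ^ 2 :=
    hu.mul_bdd (c := K ^ 2) (hT.norm.pow_const 2).aestronglyMeasurable
      (Filter.Eventually.of_forall fun x => by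
        rw [Real.norm_of_nonneg (by positivity)]; have := hK x; gcongr)
  have i2 : Integrable fun x => u x • T x :=
    hu.smul_bdd K hT.aestronglyMeasurable (Filter.Eventually.of_forall hK)
  have j1 : Integrable (fun p : Rn n × Rn n => u p.1 * ‖T p.1‖ ^ 2 * u p.2)
      volume := i1.mul_prod hu
  have j2 : Integrable (fun p : Rn n × Rn n => u p.1 * (u p.2 * ‖T p.2‖ ^ 2))
      volume := hu.mul_prod i1
  have j3 : Integrable (fun p : Rn n × Rn n => inner ℝ (u p.1 • T p.1) (u p.2 • T p.2))
      volume := by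
    refine Integrable.mono (i2.norm.mul_prod i2.norm)
      ((i2.1.comp_fst).inner (i2.1.comp_snd)) (Filter.Eventually.of_forall fun p => ?_)
    refine (norm_inner_le_norm _ _).trans ?_
    simp
  have heq : (fun p : Rn n × Rn n => u p.1 * u p.2 * ‖T p.1 - T p.2‖ ^ 2) = fun p =>
      (u p.1 * ‖T p.1‖ ^ 2 * u p.2 + u p.1 * (u p.2 * ‖T p.2‖ ^ 2)) -
        2 * inner ℝ (u p.1 • T p.1) (u p.2 • T p.2) := by
    funext p
    rw [norm_sub_sq_real, real_inner_smul_left, inner_smul_right]; ring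
  rw [heq]
  have e1 : ∫ p : Rn n × Rn n, u p.1 * ‖T p.1‖ ^ 2 * u p.2 = (∫ x, u x * ‖T x‖ ^ 2) * ∫ x, u x :=
    integral_prod_mul (fun x => u x * ‖T x‖ ^ 2) u
  have e2 : ∫ p : Rn n × Rn n, u p.1 * (u p.2 * ‖T p.2‖ ^ 2) = (∫ x, u x) * ∫ x, u x * ‖T x‖ ^ 2 :=
    integral_prod_mul u (fun x => u x * ‖T x‖ ^ 2)
  have e3 : ∫ p : Rn n × Rn n, inner ℝ (u p.1 • T p.1) (u p.2 • T p.2) =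
      ‖∫ x, u x • T x‖ ^ 2 := by
    rw [Measure.volume_eq_prod, integral_prod _ j3]
    simp only [integral_inner i2]
    simp_rw [real_inner_comm (∫ x, u x • T x)]
    rw [integral_inner i2, real_inner_self_eq_norm_sq]
  refine ⟨(j1.add j2).sub (j3.const_mul 2), ?_⟩
  rw [integral_sub, integral_add j1 j2, integral_const_mul, e1, e2, e3]
  rotate_left
  · exact j1.add j2
  · exact j3.const_mul 2
  ring

theorem integral_mul_const_prod (u : Rn n → ℝ) (c : ℝ) :
    ∫ p : Rn n × Rn n, u p.1 * u p.2 * c = (∫ x, u x) ^ 2 * c := by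
  rw [integral_mul_const, sq]
  congr 1
  exact integral_prod_mul u u

/-- Lower bound for the energy of a function supported in a ball. -/
theorem radialEnergy_cap_ge {u : Rn n → ℝ} (hu : Integrable u) (h0 : ∀ x, 0 ≤ u x) {R L : ℝ}
    (hR : 0 ≤ R) (hs : ∀ x, R < ‖x‖ → u x = 0) :
    (∫ x, u x) ^ 2 * L ^ 2 - 2 * ((∫ x, u x) * ∫ x, u x * min (‖x‖ ^ 2) (R ^ 2)) ≤
      radialEnergy (cap L) u := by
  obtain ⟨i1, e1⟩ := integral_mul_norm_sub_sq hu (continuous_ballProj hR).measurable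
    (norm_ballProj_le hR)
  have hmin : ∀ x, u x * ‖ballProj R x‖ ^ 2 = u x * min (‖x‖ ^ 2) (R ^ 2) := by
    intro x
    by_cases hx : ‖x‖ ≤ R
    · rw [ballProj, if_pos hx, min_eq_left (by gcongr)]
    · rw [hs x (not_le.1 hx)]; simp
  simp_rw [hmin] at e1
  have i2 : Integrable fun p : Rn n × Rn n => u p.1 * u p.2 * L ^ 2 := (hu.mul_prod hu).mul_const _
  have hle : (∫ p : Rn n × Rn n, u p.1 * u p.2 * L ^ 2) -
      ∫ p : Rn n × Rn n, u p.1 * u p.2 * ‖ballProj R p.1 - ballProj R p.2‖ ^ 2 ≤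
      radialEnergy (cap L) u := by
    rw [← integral_sub i2 i1]
    refine integral_mono (i2.sub i1)
      (integrable_radialEnergy (measurable_cap L) (abs_cap_le L) hu hu) fun p => ?_
    simp only
    by_cases hx : R < ‖p.1‖
    · simp [hs _ hx]
    by_cases hy : R < ‖p.2‖
    · simp [hs _ hy]
    rw [ballProj, if_pos (not_lt.1 hx), ballProj, if_pos (not_lt.1 hy), ← mul_sub]
    exact mul_le_mul_of_nonneg_left (le_max_left _ _) (mul_nonneg (h0 _) (h0 _))
  rw [integral_mul_const_prod, e1] at hle
  -- The squared mean has the favourable sign, so u need not be centred.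
  nlinarith [sq_nonneg ‖∫ x, u x • ballProj R x‖]

/-- Upper bound for the energy of a spread out function. -/
theorem radialEnergy_cap_le_of_spread {u : Rn n → ℝ} (hu : Integrable u) (h0 : ∀ x, 0 ≤ u x)
    {L Q : ℝ} (hQ : ∀ a, Q ≤ ∫ y, u y * min (‖y - a‖ ^ 2) (L ^ 2)) :
    radialEnergy (cap L) u ≤ (∫ x, u x) ^ 2 * L ^ 2 - (∫ x, u x) * Q := by
  have hi := integrable_radialEnergy (measurable_cap L) (abs_cap_le L) hu hu
  -- Since cap L r = L² - min(r², L²), the hypothesis is applied with the centre a = x.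
  have hin : ∀ x, ∫ y, u x * u y * cap L ‖x - y‖ ≤ u x * ((∫ y, u y) * L ^ 2 - Q) := by
    intro x
    have i1 : Integrable fun y => u y * min (‖y - x‖ ^ 2) (L ^ 2) :=
      hu.mul_bdd (c := L ^ 2) (by fun_prop) (Filter.Eventually.of_forall fun y => by
        rw [Real.norm_of_nonneg (by positivity)]; exact min_le_right _ _)
    have : ∀ y, u x * u y * cap L ‖x - y‖ =
        u x * (u y * L ^ 2 - u y * min (‖y - x‖ ^ 2) (L ^ 2)) := by
      intro y
      have : cap L ‖x - y‖ = L ^ 2 - min (‖y - x‖ ^ 2) (L ^ 2) := by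
        rw [cap, norm_sub_rev]
        rcases le_total (‖y - x‖ ^ 2) (L ^ 2) with h | h
        · rw [min_eq_left h, max_eq_left (by linarith)]
        · rw [min_eq_right h, max_eq_right (by linarith)]; ring
      rw [this]; ring
    simp_rw [this]
    rw [integral_const_mul, integral_sub (hu.mul_const _) i1, integral_mul_const]
    exact mul_le_mul_of_nonneg_left (by linarith [hQ x]) (h0 x)
  calc radialEnergy (cap L) u = ∫ x, ∫ y, u x * u y * cap L ‖x - y‖ := by
        rw [radialEnergy, Measure.volume_eq_prod, integral_prod _ hi]
    _ ≤ ∫ x, u x * ((∫ y, u y) * L ^ 2 - Q) :=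
        integral_mono hi.integral_prod_left (hu.mul_const _) hin
    _ = _ := by rw [integral_mul_const]; ring

/-- Upper bound for the energy of a concentrated function. -/
theorem exists_radialEnergy_cap_le {u : Rn n → ℝ} (hu : Integrable u) (h0 : ∀ x, 0 ≤ u x)
    (hm : 0 < ∫ x, u x) {R : ℝ} (hR : 0 < R) {a : Rn n}
    (ha : ∫ y, u y * min (‖y - a‖ ^ 2) ((6 * R) ^ 2) ≤ 3 * (∫ x, u x) * R ^ 2) :
    ∃ b : Rn n, radialEnergy (cap (6 * R)) u ≤
      (∫ x, u x) ^ 2 * (6 * R) ^ 2 - 2 * ((∫ x, u x) * ∫ x, u x * min (‖x - b‖ ^ 2) (R ^ 2)) := by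
  set m := ∫ x, u x with hmdef
  have hK : 0 ≤ 3 * R := by positivity
  set T : Rn n → Rn n := fun x => ballProj (3 * R) (x - a) with hT
  have hTc : Continuous T := (continuous_ballProj hK).comp (continuous_id.sub continuous_const)
  have hTb : ∀ x, ‖T x‖ ≤ 3 * R := fun x => norm_ballProj_le hK _
  have iT : Integrable fun x => u x • T x :=
    hu.smul_bdd (3 * R) hTc.aestronglyMeasurable (Filter.Eventually.of_forall hTb)
  set z : Rn n := m⁻¹ • ∫ x, u x • T x with hz
  -- From s ≤ s²/(2R) + R/2: the second moment bound 3mR² gives (3/2 + 1/2)R for the mean.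
  have hzn : ‖z‖ ≤ 2 * R := by
    have h1 : ‖∫ x, u x • T x‖ ≤ 2 * m * R := by
      have i1 : Integrable fun y => u y * min (‖y - a‖ ^ 2) ((6 * R) ^ 2) :=
        hu.mul_bdd (c := (6 * R) ^ 2) (by fun_prop) (Filter.Eventually.of_forall fun y => by
          rw [Real.norm_of_nonneg (by positivity)]; exact min_le_right _ _)
      have i2 : Integrable fun y => (2 * R)⁻¹ * (u y * min (‖y - a‖ ^ 2) ((6 * R) ^ 2)) +
          R / 2 * u y := (i1.const_mul _).add (hu.const_mul _)
      refine (norm_integral_le_of_norm_le i2 (Filter.Eventually.of_forall fun y => ?_)).trans ?_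
      · rw [norm_smul, Real.norm_of_nonneg (h0 y)]
        have h2 : ‖T y‖ ≤ (2 * R)⁻¹ * ‖T y‖ ^ 2 + R / 2 := by
          rw [← sub_nonneg]
          have : (2 * R)⁻¹ * ‖T y‖ ^ 2 + R / 2 - ‖T y‖ = (2 * R)⁻¹ * (‖T y‖ - R) ^ 2 := by
            field_simp; ring
          rw [this]; positivity
        have h3 : ‖T y‖ ^ 2 ≤ min (‖y - a‖ ^ 2) ((6 * R) ^ 2) := by
          refine le_min ?_ ?_
          · have := norm_ballProj_le_norm hK (y - a)
            gcongr
          · have := hTb y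
            gcongr
            linarith
        have h4 : ‖T y‖ ≤ (2 * R)⁻¹ * min (‖y - a‖ ^ 2) ((6 * R) ^ 2) + R / 2 := by
          refine h2.trans ?_
          gcongr
        calc u y * ‖T y‖ ≤ u y * ((2 * R)⁻¹ * min (‖y - a‖ ^ 2) ((6 * R) ^ 2) + R / 2) :=
              mul_le_mul_of_nonneg_left h4 (h0 y)
          _ = _ := by ring
      · rw [integral_add (i1.const_mul _) (hu.const_mul _), integral_const_mul, integral_const_mul,
          ← hmdef]
        have : (2 * R)⁻¹ * ∫ y, u y * min (‖y - a‖ ^ 2) ((6 * R) ^ 2) ≤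
            (2 * R)⁻¹ * (3 * m * R ^ 2) := by gcongr
        have e : (2 * R)⁻¹ * (3 * m * R ^ 2) = 3 / 2 * m * R := by field_simp
        linarith
    rw [hz, norm_smul, norm_inv, Real.norm_of_nonneg hm.le, inv_mul_le_iff₀ hm]
    linarith
  refine ⟨a + z, ?_⟩
  obtain ⟨i1, e1⟩ := integral_mul_norm_sub_sq hu (T := fun x => T x - z)
    (hTc.sub continuous_const).measurable (K := 3 * R + 2 * R)
    fun x => (norm_sub_le _ _).trans (add_le_add (hTb x) hzn)
  have hmean : ∫ x, u x • (T x - z) = 0 := by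
    simp_rw [smul_sub]
    rw [integral_sub iT (hu.smul_const z), integral_smul_const, ← hmdef, hz, smul_smul,
      mul_inv_cancel₀ hm.ne', one_smul, sub_self]
  rw [hmean, norm_zero, ← hmdef] at e1
  -- Within distance 3R of a the projection is exact. Beyond it T x has norm 3R, and ‖z‖ ≤ 2R leaves
  -- a distance of at least R to z.
  have hlow : ∫ x, u x * min (‖x - (a + z)‖ ^ 2) (R ^ 2) ≤ ∫ x, u x * ‖T x - z‖ ^ 2 := by
    refine integral_mono ?_ ?_ fun x => mul_le_mul_of_nonneg_left ?_ (h0 x)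
    · exact hu.mul_bdd (c := R ^ 2) (by fun_prop) (Filter.Eventually.of_forall fun y => by
        rw [Real.norm_of_nonneg (by positivity)]; exact min_le_right _ _)
    · refine hu.mul_bdd (c := (5 * R) ^ 2) (by fun_prop) (Filter.Eventually.of_forall fun x => ?_)
      rw [Real.norm_of_nonneg (by positivity)]
      have : ‖T x - z‖ ≤ 5 * R := (norm_sub_le _ _).trans (by linarith [hTb x])
      gcongr
    · by_cases hx : ‖x - a‖ ≤ 3 * R
      · have : T x - z = x - (a + z) := by
          simp only [hT]; rw [ballProj, if_pos hx]; abel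
        rw [this]; exact min_le_left _ _
      · refine (min_le_right _ _).trans ?_
        have h1 : ‖T x‖ = 3 * R := norm_ballProj_of_lt hK (not_le.1 hx)
        have h2 := norm_sub_norm_le (T x) z
        have : R ≤ ‖T x - z‖ := by linarith
        gcongr
  have i2 : Integrable fun p : Rn n × Rn n => u p.1 * u p.2 * (6 * R) ^ 2 :=
    (hu.mul_prod hu).mul_const _
  -- The image of T has diameter at most 2·3R = 6R and T is 1-Lipschitz, so (6R)² - ‖T x - T y‖²
  -- dominates both branches of cap.
  have hup : radialEnergy (cap (6 * R)) u ≤ (∫ p : Rn n × Rn n, u p.1 * u p.2 * (6 * R) ^ 2) -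
      ∫ p : Rn n × Rn n, u p.1 * u p.2 * ‖T p.1 - z - (T p.2 - z)‖ ^ 2 := by
    rw [← integral_sub i2 i1]
    refine integral_mono (integrable_radialEnergy (measurable_cap _) (abs_cap_le _) hu hu)
      (i2.sub i1) fun p => ?_
    simp only
    rw [← mul_sub]
    refine mul_le_mul_of_nonneg_left ?_ (mul_nonneg (h0 _) (h0 _))
    rw [sub_sub_sub_cancel_right]
    have h1 : ‖T p.1 - T p.2‖ ≤ ‖p.1 - p.2‖ := by
      have := norm_ballProj_sub_le hK (p.1 - a) (p.2 - a)
      rwa [sub_sub_sub_cancel_right] at this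
    have h2 : ‖T p.1 - T p.2‖ ≤ 6 * R := (norm_sub_le _ _).trans (by linarith [hTb p.1, hTb p.2])
    refine max_le ?_ ?_
    · have : ‖T p.1 - T p.2‖ ^ 2 ≤ ‖p.1 - p.2‖ ^ 2 := by gcongr
      linarith
    · have : ‖T p.1 - T p.2‖ ^ 2 ≤ (6 * R) ^ 2 := by gcongr
      linarith
  rw [integral_mul_const_prod, ← hmdef, e1] at hup
  have := mul_le_mul_of_nonneg_left hlow hm.le
  linarith

end Quadratic

/-! ### The quantitative bathtub principle -/

section Bathtub
variable {n : ℕ} {N R : ℝ} {f : Rn n → ℝ}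

/-- The volume of the part of the symmetrized level set that the level set misses. -/
def missing (f : Rn n → ℝ) (t : ℝ) : ℝ := volume.real (symmSet {y | t < f y} \ {y | t < f y})

theorem missing_nonneg (f : Rn n → ℝ) (t : ℝ) : 0 ≤ missing f t := measureReal_nonneg

theorem missing_le (hn : 0 < n) (f : Rn n → ℝ) (t : ℝ) :
    missing f t ≤ volume.real {y | t < f y} := by
  rw [← volumeReal_symmSet hn {y | t < f y}]
  exact measureReal_mono sdiff_subset (volume_symmSet_ne_top _)

theorem symmLayer_eq_indicator (hf : IsLayered N f) (t : ℝ) :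
    (fun x => symmLayer f (t, x)) = (symmSet {y | t < f y}).indicator (fun _ => 1) := by
  funext x; simp only [symmLayer, hf.abs_eq]

/-- The bathtub principle for one level set. -/
theorem bathtub_level (hn : 0 < n) (hf : IsLayered N f) {t : ℝ} (ht : 0 < t)
    (hR : symmRadius {y | t < f y} ≤ R) :
    (4 * (n : ℝ))⁻¹ * (missing f t ^ 2 * symmRadius {y | t < f y} ^ 2 / volume.real {y | t < f y}) ≤
      (∫ x, layer f (t, x) * min (‖x‖ ^ 2) (R ^ 2)) -
        ∫ x, symmLayer f (t, x) * min (‖x‖ ^ 2) (R ^ 2) := by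
  set A : Set (Rn n) := {y | t < f y} with hA
  set r := symmRadius A with hr
  set v := volume.real A with hv
  set d := missing f t with hd
  -- By Bernoulli, the shell between radii r(1 - κ) and r has volume at most nκv = d/2, so at least
  -- half of the missing volume lies deeper.
  set κ := d / (2 * n * v) with hκ
  set s := r * (1 - κ) with hs
  have hn' : (1 : ℝ) ≤ n := by exact_mod_cast hn
  have hr0 : 0 ≤ r := symmRadius_nonneg A
  have hv0 : 0 ≤ v := measureReal_nonneg
  have hd0 : 0 ≤ d := missing_nonneg f t
  have hdv : d ≤ v := missing_le hn f t
  have hAm : MeasurableSet A := hf.measurableSet_level t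
  have hAfin : volume A ≠ ∞ := hf.volume_level_ne_top ht
  have hκ0 : 0 ≤ κ := by positivity
  have hκ1 : κ ≤ 1 / 2 := by
    rcases hv0.eq_or_lt with h | h
    · rw [hκ, ← h]; simp
    · rw [hκ, div_le_iff₀ (by positivity)]; nlinarith
  have hs0 : 0 ≤ s := mul_nonneg hr0 (by linarith)
  have hsr : s ≤ r := by rw [hs]; nlinarith
  have hnv : n * κ * v = d / 2 := by
    rcases hv0.eq_or_lt with h | h
    · have : d = 0 := le_antisymm (hdv.trans_eq h.symm) hd0
      rw [← h, this]; simp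
    · rw [hκ]; field_simp
  have hvr : r ^ n * unitVol n = v := by
    rw [hr, symmRadius_pow hn, div_mul_cancel₀ _ (unitVol_pos n).ne']
  set E : Set (Rn n) := Metric.ball 0 s \ A with hE
  have hEm : MeasurableSet E := Metric.isOpen_ball.measurableSet.diff hAm
  have hEfin : volume E ≠ ∞ := ne_top_of_le_ne_top measure_ball_lt_top.ne (measure_mono sdiff_subset)
  have hEvol : d / 2 ≤ volume.real E := by
    have h1 : d ≤ volume.real E + volume.real (Metric.ball (0 : Rn n) r \ Metric.ball 0 s) := by
      rw [hd, missing, symmSet_eq_ball]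
      refine le_trans (measureReal_mono (fun x hx => ?_) ?_) (measureReal_union_le _ _)
      · by_cases hxs : x ∈ Metric.ball (0 : Rn n) s
        · exact Or.inl ⟨hxs, hx.2⟩
        · exact Or.inr ⟨hx.1, hxs⟩
      · exact (measure_union_lt_top hEfin.lt_top
          ((measure_mono sdiff_subset).trans_lt measure_ball_lt_top)).ne
    have h2 : volume.real (Metric.ball (0 : Rn n) r \ Metric.ball 0 s) ≤ d / 2 := by
      rw [measureReal_sdiff (Metric.ball_subset_ball hsr) Metric.isOpen_ball.measurableSet
        measure_ball_lt_top.ne, volumeReal_ball hn _ hr0, volumeReal_ball hn _ hs0, hs, mul_pow]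
      have h3 := one_add_mul_le_pow (show (-2 : ℝ) ≤ -κ by linarith) n
      rw [← sub_eq_add_neg] at h3
      have : r ^ n * (1 - κ) ^ n * unitVol n = v * (1 - κ) ^ n := by rw [← hvr]; ring
      rw [this, hvr, ← hnv]
      nlinarith
    linarith
  have i1 : Integrable fun x => layer f (t, x) := integrable_layer_fst hf ht
  have i2 : Integrable fun x => symmLayer f (t, x) := integrable_symmLayer_fst f t
  have iE : Integrable (E.indicator fun _ => (1 : ℝ)) :=
    (integrable_indicator_iff hEm).2 (integrableOn_const hEfin)
  have hψ : ∀ {u : Rn n → ℝ}, Integrable u → Integrable fun x => u x * min (‖x‖ ^ 2) (R ^ 2) :=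
    fun hu => hu.mul_bdd (c := R ^ 2) (by fun_prop) (Filter.Eventually.of_forall fun y => by
      rw [Real.norm_of_nonneg (by positivity)]; exact min_le_right _ _)
  -- Subtracting the constant r² costs nothing in the integral, as both sets have equal volume. Then
  -- points of A outside the ball contribute at least 0, where r ≤ R is used, and missing points
  -- contribute r² - ‖x‖².
  have hpt : ∀ x, r ^ 2 * (layer f (t, x) - symmLayer f (t, x)) +
      (r ^ 2 - s ^ 2) * E.indicator (fun _ => (1 : ℝ)) x ≤
      layer f (t, x) * min (‖x‖ ^ 2) (R ^ 2) - symmLayer f (t, x) * min (‖x‖ ^ 2) (R ^ 2) := by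
    intro x
    have e1 := congrFun (layer_eq_indicator f t) x
    have e2 := congrFun (symmLayer_eq_indicator hf t) x
    rw [e1, e2]
    have hsr2 : s ^ 2 ≤ r ^ 2 := by gcongr
    by_cases hxA : x ∈ A
    · have hxE : x ∉ E := fun h => h.2 hxA
      rw [indicator_of_mem hxA, indicator_of_notMem hxE]
      by_cases hxB : x ∈ symmSet A
      · rw [indicator_of_mem hxB]; linarith
      · rw [indicator_of_notMem hxB]
        have hx : r ≤ ‖x‖ := not_lt.1 fun h => hxB (mem_symmSet.2 h)
        have : r ^ 2 ≤ min (‖x‖ ^ 2) (R ^ 2) := le_min (by gcongr) (by gcongr)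
        linarith
    · rw [indicator_of_notMem hxA]
      by_cases hxB : x ∈ symmSet A
      · rw [indicator_of_mem hxB]
        have hx : ‖x‖ < r := mem_symmSet.1 hxB
        have hmin : min (‖x‖ ^ 2) (R ^ 2) ≤ ‖x‖ ^ 2 := min_le_left _ _
        by_cases hxE : x ∈ E
        · rw [indicator_of_mem hxE]
          have : ‖x‖ < s := by simpa using hxE.1
          have : ‖x‖ ^ 2 ≤ s ^ 2 := by gcongr
          linarith
        · rw [indicator_of_notMem hxE]
          have : ‖x‖ ^ 2 ≤ r ^ 2 := by gcongr
          linarith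
      · rw [indicator_of_notMem hxB]
        have hxE : x ∉ E := fun h => hxB (mem_symmSet.2 (by
          have : ‖x‖ < s := by simpa using h.1
          linarith))
        rw [indicator_of_notMem hxE]; linarith
  have hmono := integral_mono (((i1.sub i2).const_mul (r ^ 2)).add (iE.const_mul (r ^ 2 - s ^ 2)))
    ((hψ i1).sub (hψ i2)) hpt
  have hl : ∫ x, ((fun x => r ^ 2 * ((fun x => layer f (t, x)) - fun x => symmLayer f (t, x)) x) +
      fun x => (r ^ 2 - s ^ 2) * E.indicator (fun _ => (1 : ℝ)) x) x =
      (r ^ 2 - s ^ 2) * volume.real E := by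
    rw [integral_add' ((i1.sub i2).const_mul (r ^ 2)) (iE.const_mul (r ^ 2 - s ^ 2)),
      integral_const_mul, integral_const_mul, integral_sub' i1 i2, integral_layer_fst hf,
      integral_symmLayer_fst hn hf, integral_indicator hEm]
    simp
  have hr' := integral_sub (hψ i1) (hψ i2)
  rw [← hr']
  refine le_trans ?_ ((hl.symm.le).trans hmono)
  have hrs : r ^ 2 * κ ≤ r ^ 2 - s ^ 2 := by
    have : r ^ 2 - s ^ 2 = r ^ 2 * (κ * (2 - κ)) := by rw [hs]; ring
    rw [this]
    refine mul_le_mul_of_nonneg_left ?_ (sq_nonneg r)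
    nlinarith
  calc (4 * (n : ℝ))⁻¹ * (d ^ 2 * r ^ 2 / v) = r ^ 2 * κ * (d / 2) := by
        rw [hκ]
        rcases hv0.eq_or_lt with h | h
        · rw [← h]; simp
        · field_simp; ring
    _ ≤ (r ^ 2 - s ^ 2) * volume.real E := by gcongr; nlinarith

/-- A set and its symmetrization have equal volume, so the two parts of the symmetric difference do
too. -/
theorem integral_abs_layer_sub_symmLayer (hn : 0 < n) (hf : IsLayered N f) {t : ℝ} (ht : 0 < t) :
    ∫ x, |layer f (t, x) - symmLayer f (t, x)| = 2 * missing f t := by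
  have i1 : Integrable fun x => layer f (t, x) := integrable_layer_fst hf ht
  have i2 : Integrable fun x => symmLayer f (t, x) := integrable_symmLayer_fst f t
  have hAm := hf.measurableSet_level t
  have hBm : MeasurableSet (symmSet {y | t < f y}) := (isOpen_symmSet _).measurableSet
  have hm : MeasurableSet (symmSet {y | t < f y} \ {y | t < f y}) := hBm.diff hAm
  have i3 : Integrable ((symmSet {y | t < f y} \ {y | t < f y}).indicator fun _ => (1 : ℝ)) :=
    (integrable_indicator_iff hm).2 (integrableOn_const
      (ne_top_of_le_ne_top (volume_symmSet_ne_top _) (measure_mono sdiff_subset)))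
  have hpt : ∀ x, |layer f (t, x) - symmLayer f (t, x)| =
      (layer f (t, x) - symmLayer f (t, x)) +
        2 * (symmSet {y | t < f y} \ {y | t < f y}).indicator (fun _ => (1 : ℝ)) x := by
    intro x
    have e1 := congrFun (layer_eq_indicator f t) x
    have e2 := congrFun (symmLayer_eq_indicator hf t) x
    rw [e1, e2]
    by_cases hxA : x ∈ {y | t < f y} <;> by_cases hxB : x ∈ symmSet {y | t < f y} <;>
      simp only [indicator, hxA, hxB, if_true, if_false, mem_sdiff, not_true_eq_false, and_false,
        and_true, not_false_eq_true] <;> norm_num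
  simp_rw [hpt]
  have i12 : Integrable fun x => layer f (t, x) - symmLayer f (t, x) := i1.sub i2
  rw [integral_add i12 (i3.const_mul 2), integral_const_mul, integral_sub i1 i2,
    integral_layer_fst hf, integral_symmLayer_fst hn hf, integral_indicator hm]
  simp [missing]

theorem integrableOn_missing (hn : 0 < n) (hf : IsLayered N f) :
    IntegrableOn (missing f) (Ioo 0 N) := by
  have h := ((integrable_layer hf).sub (integrable_symmLayer hn hf)).abs.integral_prod_left
  refine IntegrableOn.congr_fun (h.const_mul (1 / 2)) (fun t ht => ?_) measurableSet_Ioo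
  have := integral_abs_layer_sub_symmLayer hn hf ht.1
  simp only [Pi.sub_apply]
  rw [this]; ring

theorem integral_abs_sub_rearrangement_le (hn : 0 < n) (hf : IsLayered N f) :
    ∫ x, |f x - rearrangement f x| ≤ 2 * ∫ t in Ioo 0 N, missing f t := by
  have hS : Integrable (fun p => layer f p - symmLayer f p) (layerMeasure n N) :=
    (integrable_layer hf).sub (integrable_symmLayer hn hf)
  calc ∫ x, |f x - rearrangement f x|
      ≤ ∫ x, ∫ t in Ioo 0 N, |layer f (t, x) - symmLayer f (t, x)| := by
        refine integral_mono_ae (hf.integrable.sub (integrable_rearrangement hn hf)).abs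
          hS.abs.integral_prod_right ?_
        filter_upwards [(integrable_layer hf).prod_left_ae,
          (integrable_symmLayer hn hf).prod_left_ae] with x h1 h2
        rw [rearrangement_eq_integral hn hf]
        nth_rewrite 1 [← integral_layer_snd hf.nonneg hf.le x]
        rw [← integral_sub h1 h2]
        exact abs_integral_le_integral_abs
    _ = ∫ t in Ioo 0 N, ∫ x, |layer f (t, x) - symmLayer f (t, x)| :=
        (integral_integral_swap (f := fun t x => |layer f (t, x) - symmLayer f (t, x)|)
          hS.abs).symm
    _ = ∫ t in Ioo 0 N, 2 * missing f t :=
        setIntegral_congr_fun measurableSet_Ioo fun t ht =>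
          integral_abs_layer_sub_symmLayer hn hf ht.1
    _ = 2 * ∫ t in Ioo 0 N, missing f t := integral_const_mul _ _

/-- The increase of the truncated second moment over that of the rearrangement. -/
def momentGap (R : ℝ) (f : Rn n → ℝ) : ℝ :=
  (∫ x, f x * min (‖x‖ ^ 2) (R ^ 2)) - ∫ x, rearrangement f x * min (‖x‖ ^ 2) (R ^ 2)

/-- The constant in the bathtub principle. -/
def bathtubConst (n : ℕ) : ℝ := (4 * (n : ℝ))⁻¹ * (unitVol n ^ (2 / (n : ℝ)))⁻¹

theorem bathtubConst_pos (hn : 0 < n) : 0 < bathtubConst n := by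
  have := unitVol_pos n
  have : (0 : ℝ) < n := by exact_mod_cast hn
  unfold bathtubConst; positivity

theorem symmRadius_sq (A : Set (Rn n)) :
    symmRadius A ^ 2 = volume.real A ^ (2 / (n : ℝ)) * (unitVol n ^ (2 / (n : ℝ)))⁻¹ := by
  have h0 : 0 ≤ volume.real A := measureReal_nonneg
  rw [symmRadius_eq, ← Real.rpow_natCast, ← Real.rpow_mul (by have := unitVol_pos n; positivity),
    Real.div_rpow h0 (unitVol_pos n).le, div_eq_mul_inv]
  rw [show 1 / (n : ℝ) * ((2 : ℕ) : ℝ) = 2 / (n : ℝ) by push_cast; ring]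

/-- Linear lower bounds on the level sets integrate to lower bounds of the gap. -/
theorem momentGap_ge (hn : 0 < n) (hf : IsLayered N f)
    (hR : ∀ t, 0 < t → symmRadius {y | t < f y} ≤ R) {α β γ τ : ℝ} (hα : 0 ≤ α)
    (hτ : 2 * τ ≤ ∫ x, |f x - rearrangement f x|)
    (h : ∀ t ∈ Ioo 0 N, α * missing f t - β * volume.real {y | t < f y} - γ ≤
      missing f t ^ 2 * volume.real {y | t < f y} ^ (2 / (n : ℝ)) / volume.real {y | t < f y}) :
    bathtubConst n * (α * τ - β * (∫ x, f x) - γ * N) ≤ momentGap R f := by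
  have hψm : Measurable fun x : Rn n => min (‖x‖ ^ 2) (R ^ 2) := by fun_prop
  have hψb : ∀ x : Rn n, |min (‖x‖ ^ 2) (R ^ 2)| ≤ R ^ 2 := fun x => by
    rw [abs_of_nonneg (by positivity)]; exact min_le_right _ _
  have i1 := (integrable_layer_mul hf hψm hψb).integral_prod_left
  have i2 := (integrable_symmLayer_mul hn hf hψm hψb).integral_prod_left
  have iv : IntegrableOn (fun t => volume.real {y | t < f y}) (Ioo 0 N) := by
    have := (integrable_layer hf).integral_prod_left
    simp only [integral_layer_fst hf] at this
    exact this
  have im := integrableOn_missing hn hf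
  rw [momentGap, integral_mul_eq_layer hf hψm hψb, integral_rearrangement_mul_eq hn hf hψm hψb,
    ← integral_sub i1 i2]
  have hlow : ∫ t in Ioo 0 N, bathtubConst n *
      (α * missing f t - β * volume.real {y | t < f y} - γ) ≤
      ∫ t in Ioo 0 N, ((∫ x, layer f (t, x) * min (‖x‖ ^ 2) (R ^ 2)) -
        ∫ x, symmLayer f (t, x) * min (‖x‖ ^ 2) (R ^ 2)) := by
    refine setIntegral_mono_on ?_ (i1.sub i2) measurableSet_Ioo fun t ht => ?_
    · exact (((im.const_mul α).sub (iv.const_mul β)).sub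
        (integrableOn_const (by simp))).const_mul _
    · refine le_trans ?_ (bathtub_level hn hf ht.1 (hR t ht.1))
      rw [symmRadius_sq, bathtubConst]
      refine (mul_le_mul_of_nonneg_left (h t ht) (bathtubConst_pos hn).le).trans_eq ?_
      rw [bathtubConst]; ring
  refine le_trans ?_ hlow
  have imv : IntegrableOn (fun t => α * missing f t - β * volume.real {y | t < f y}) (Ioo 0 N) :=
    (im.const_mul α).sub (iv.const_mul β)
  rw [integral_const_mul, integral_sub imv (integrableOn_const (by simp)),
    integral_sub (im.const_mul α) (iv.const_mul β),
    integral_const_mul, integral_const_mul, ← integral_eq_integral_level hf]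
  refine mul_le_mul_of_nonneg_left ?_ (bathtubConst_pos hn).le
  have hτ' : τ ≤ ∫ t in Ioo 0 N, missing f t := by
    linarith [hτ.trans (integral_abs_sub_rearrangement_le hn hf)]
  have := mul_le_mul_of_nonneg_left hτ' hα
  simp only [integral_const, measureReal_restrict_apply_univ, smul_eq_mul, Real.volume_real_Ioo,
    sub_zero, max_eq_left hf.bound_nonneg]
  linarith

/-- Cauchy–Schwarz and Jensen in linearized form. With a = 1 - 2/n, d²/v^a ≥ 2ld - l²v^a, and v^a
lies below its tangent at V = m/N, the mean level volume; n ≥ 2 makes 0 ≤ a ≤ 1. The value l =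
τ/(V^a N) is optimal. -/
theorem momentGap_ge_of_two_le (hn : 2 ≤ n) (hf : IsLayered N f)
    (hR : ∀ t, 0 < t → symmRadius {y | t < f y} ≤ R) (hN : 0 < N) (hm : 0 < ∫ x, f x) {τ : ℝ}
    (hτ0 : 0 ≤ τ) (hτ : 2 * τ ≤ ∫ x, |f x - rearrangement f x|) :
    bathtubConst n * (τ ^ 2 / (((∫ x, f x) / N) ^ (1 - 2 / (n : ℝ)) * N)) ≤ momentGap R f := by
  set m := ∫ x, f x with hmd
  set V := m / N with hV
  have hV0 : 0 < V := by positivity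
  set a : ℝ := 1 - 2 / (n : ℝ) with ha
  have hn2 : (2 : ℝ) ≤ n := by exact_mod_cast hn
  have ha0 : 0 ≤ a := by
    rw [ha, sub_nonneg, div_le_one (by linarith)]; exact hn2
  have ha1 : a ≤ 1 := by rw [ha]; linarith [show 0 ≤ 2 / (n : ℝ) by positivity]
  have hVa : 0 < V ^ a := Real.rpow_pos_of_pos hV0 a
  set l := τ / (V ^ a * N) with hl
  have hl0 : 0 ≤ l := by positivity
  have key := momentGap_ge (by omega) hf hR (α := 2 * l) (β := l ^ 2 * (a * V ^ a / V))
    (γ := l ^ 2 * (V ^ a * (1 - a))) (τ := τ) (by positivity) hτ ?_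
  · refine le_trans (mul_le_mul_of_nonneg_left (le_of_eq ?_) (bathtubConst_pos (by omega)).le) key
    rw [← hmd, show m = V * N by rw [hV]; field_simp, hl]
    field_simp; ring
  · intro t _
    set v := volume.real {y | t < f y} with hv
    set d := missing f t
    have hv0 : 0 ≤ v := measureReal_nonneg
    have hd0 : 0 ≤ d := missing_nonneg f t
    have hdv : d ≤ v := missing_le (by omega) f t
    rcases hv0.eq_or_lt with h | h
    · have hd : d = 0 := le_antisymm (hdv.trans_eq h.symm) hd0
      rw [← h, hd]
      have : 0 ≤ l ^ 2 * (V ^ a * (1 - a)) := by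
        have : 0 ≤ 1 - a := by linarith
        positivity
      simp only [mul_zero, div_zero]; linarith
    · have hva : 0 < v ^ a := Real.rpow_pos_of_pos h a
      have e1 : v ^ (2 / (n : ℝ)) / v = (v ^ a)⁻¹ := by
        rw [ha, Real.rpow_sub h, Real.rpow_one]; field_simp
      rw [mul_div_assoc (d ^ 2), e1]
      have h2 : v ^ a ≤ V ^ a * (1 - a) + a * V ^ a / V * v := by
        have hb := rpow_one_add_le_one_add_mul_self (show -1 ≤ v / V - 1 by
          have : 0 ≤ v / V := by positivity
          linarith) ha0 ha1
        rw [show 1 + (v / V - 1) = v / V by ring, Real.div_rpow hv0 hV0.le, div_le_iff₀ hVa] at hb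
        refine hb.trans_eq ?_
        field_simp; ring
      have h3 : 0 ≤ (d - l * v ^ a) ^ 2 * (v ^ a)⁻¹ := by positivity
      have e2 : (d - l * v ^ a) ^ 2 * (v ^ a)⁻¹ =
          d ^ 2 * (v ^ a)⁻¹ - 2 * l * d + l ^ 2 * v ^ a := by field_simp; ring
      have h4 := mul_le_mul_of_nonneg_left h2 (sq_nonneg l)
      nlinarith

theorem rpow_two_div_one_div {v : ℝ} : v ^ (2 / ((1 : ℕ) : ℝ)) / v = v := by
  norm_num
  rcases eq_or_ne v 0 with h | h
  · simp [h]
  · field_simp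

/-- For n = 1 the weight is v ≥ d, so d²v ≥ d³, and d³ - 3l²d + 2l³ = (d - l)²(d + 2l) ≥ 0 is the
tangent bound at the mean l = τ/N. -/
theorem momentGap_ge_cube {f : Rn 1 → ℝ} (hf : IsLayered N f)
    (hR : ∀ t, 0 < t → symmRadius {y | t < f y} ≤ R) (hN : 0 < N) {τ : ℝ}
    (hτ0 : 0 ≤ τ) (hτ : 2 * τ ≤ ∫ x, |f x - rearrangement f x|) :
    bathtubConst 1 * (τ ^ 3 / N ^ 2) ≤ momentGap R f := by
  set l := τ / N with hl
  have hl0 : 0 ≤ l := by positivity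
  have key := momentGap_ge one_pos hf hR (α := 3 * l ^ 2) (β := 0) (γ := 2 * l ^ 3) (τ := τ)
    (by positivity) hτ ?_
  · refine le_trans (mul_le_mul_of_nonneg_left (le_of_eq ?_) (bathtubConst_pos one_pos).le) key
    rw [hl]; field_simp; ring
  · intro t _
    rw [mul_div_assoc (missing f t ^ 2), rpow_two_div_one_div]
    have hd0 := missing_nonneg f t
    have hdv := missing_le one_pos f t
    have h1 : 0 ≤ (missing f t - l) ^ 2 * (missing f t + 2 * l) := by positivity
    nlinarith [mul_le_mul_of_nonneg_left hdv (sq_nonneg (missing f t))]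

/-- With a constant weight V, Cauchy–Schwarz alone gives the square. -/
theorem momentGap_ge_of_level_const {f : Rn 1 → ℝ} (hf : IsLayered N f)
    (hR : ∀ t, 0 < t → symmRadius {y | t < f y} ≤ R) (hN : 0 < N) {τ V : ℝ}
    (hV : ∀ t ∈ Ioo 0 N, volume.real {y | t < f y} = V) (hV0 : 0 ≤ V)
    (hτ0 : 0 ≤ τ) (hτ : 2 * τ ≤ ∫ x, |f x - rearrangement f x|) :
    bathtubConst 1 * (V * τ ^ 2 / N) ≤ momentGap R f := by
  set l := τ / N with hl
  have hl0 : 0 ≤ l := by positivity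
  have key := momentGap_ge one_pos hf hR (α := 2 * l * V) (β := 0) (γ := l ^ 2 * V) (τ := τ)
    (by positivity) hτ ?_
  · refine le_trans (mul_le_mul_of_nonneg_left (le_of_eq ?_) (bathtubConst_pos one_pos).le) key
    rw [hl]; field_simp; ring
  · intro t ht
    rw [mul_div_assoc (missing f t ^ 2), rpow_two_div_one_div, hV t ht]
    have h1 : 0 ≤ (missing f t - l) ^ 2 * V := by positivity
    nlinarith

end Bathtub

/-! ### Stability for the truncated quadratic profile -/

section Gap
variable {n : ℕ} {N R : ℝ} {f : Rn n → ℝ}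

/-- The gap between the energies of the rearrangement and of the function, for the truncated
quadratic profile at scale `6R`. -/
def capGap (R : ℝ) (f : Rn n → ℝ) : ℝ :=
  radialEnergy (cap (6 * R)) (rearrangement f) - radialEnergy (cap (6 * R)) f

theorem rearrangement_comp_add (hf : IsLayered N f) (b : Rn n) :
    rearrangement (fun x => f (x + b)) = rearrangement f :=
  rearrangement_congr_level hf.nonneg (hf.comp_add b).nonneg fun t _ =>
    measure_preimage_add_right volume b {y | t < f y}

theorem rearrangement_eq_zero_of_lt (hs : tsupport (rearrangement f) ⊆ Metric.closedBall 0 R)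
    {x : Rn n} (hx : R < ‖x‖) : rearrangement f x = 0 := by
  by_contra h
  have := hs (subset_tsupport _ (Function.mem_support.2 h))
  rw [mem_closedBall_zero_iff] at this
  linarith

/-- Otherwise a point z with R < ‖z‖ lies in all symmetrized levels below t, so the rearrangement at
z is at least t > 0. -/
theorem symmRadius_level_le (hn : 0 < n) (hf : IsLayered N f) (hR : 0 < R)
    (hs : tsupport (rearrangement f) ⊆ Metric.closedBall 0 R) {t : ℝ} (ht : 0 < t) :
    symmRadius {y | t < f y} ≤ R := by
  by_contra hlt
  have hlt := not_le.1 hlt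
  obtain ⟨r, hr1, hr2⟩ := exists_between hlt
  obtain ⟨z, hz⟩ : ∃ z : Rn n, ‖z‖ = r :=
    ⟨EuclideanSpace.single ⟨0, hn⟩ r, by simp [abs_of_pos (hR.trans hr1)]⟩
  have htN : t < N := by
    by_contra h
    have : {y | t < f y} = ∅ := by
      ext y; simpa using (hf.le y).trans (not_lt.1 h)
    rw [this, symmRadius_of_volume_zero hn (by simp)] at hlt
    linarith
  have hone : ∀ s ∈ Ioo 0 t, symmLayer f (s, z) = 1 := by
    intro s hs'
    refine indicator_of_mem (mem_symmSet.2 ?_) _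
    rw [hz]
    refine hr2.trans_le ?_
    have := antitoneOn_symmRadius_level hf (mem_Ioi.2 hs'.1) (mem_Ioi.2 ht) hs'.2.le
    simpa only [hf.abs_eq] using this
  have hanti : AntitoneOn (fun s => symmLayer f (s, z)) (Ioo 0 N) := by
    intro s hs1 s' hs2 hss
    refine indicator_le_indicator_of_subset (Metric.ball_subset_ball ?_) (fun _ => zero_le_one) z
    exact antitoneOn_symmRadius_level hf (mem_Ioi.2 hs1.1) (mem_Ioi.2 hs2.1) hss
  have hmono : IntegrableOn (fun s => symmLayer f (s, z)) (Ioo 0 N) := by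
    refine Integrable.of_bound
      (aemeasurable_restrict_of_antitoneOn measurableSet_Ioo hanti).aestronglyMeasurable 1
      (Filter.Eventually.of_forall fun s => ?_)
    rw [Real.norm_of_nonneg (symmLayer_nonneg _ _)]; exact symmLayer_le_one _ _
  have h0 : rearrangement f z = 0 := rearrangement_eq_zero_of_lt hs (by rw [hz]; exact hr1)
  rw [rearrangement_eq_integral hn hf] at h0
  have h1 : ∫ s in Ioo 0 t, symmLayer f (s, z) ≤ ∫ s in Ioo 0 N, symmLayer f (s, z) :=
    setIntegral_mono_set hmono (Filter.Eventually.of_forall fun s => symmLayer_nonneg _ _)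
      (Ioo_subset_Ioo_right htN.le).eventuallyLE
  rw [setIntegral_congr_fun measurableSet_Ioo hone, h0] at h1
  simp [ht.le] at h1
  linarith

/-- The threshold 3mR² is chosen so that in the spread case 3m²R² exceeds the at most 2m²R² lost by
the rearrangement. -/
theorem capGap_dichotomy (hn : 0 < n) (hf : IsLayered N f) (hR : 0 < R)
    (hs : tsupport (rearrangement f) ⊆ Metric.closedBall 0 R) (hm : 0 < ∫ x, f x) :
    (∫ x, f x) ^ 2 * R ^ 2 ≤ capGap R f ∨
      ∃ b : Rn n, 2 * ((∫ x, f x) * momentGap R (fun x => f (x + b))) ≤ capGap R f := by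
  have hri := integrable_rearrangement hn hf
  have hlow := radialEnergy_cap_ge (L := 6 * R) hri (rearrangement_nonneg f) hR.le
    fun x hx => rearrangement_eq_zero_of_lt hs hx
  rw [integral_rearrangement hn hf] at hlow
  set m := ∫ x, f x with hmd
  by_cases h : ∃ a, ∫ y, f y * min (‖y - a‖ ^ 2) ((6 * R) ^ 2) ≤ 3 * m * R ^ 2
  · right
    obtain ⟨a, ha⟩ := h
    obtain ⟨b, hb⟩ := exists_radialEnergy_cap_le hf.integrable hf.nonneg hm hR ha
    refine ⟨b, ?_⟩
    have e1 : ∫ x, f (x + b) * min (‖x‖ ^ 2) (R ^ 2) = ∫ x, f x * min (‖x - b‖ ^ 2) (R ^ 2) := by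
      rw [← integral_add_right_eq_self (fun x => f x * min (‖x - b‖ ^ 2) (R ^ 2)) b]
      simp
    rw [momentGap, rearrangement_comp_add hf, e1, capGap, mul_sub]
    rw [← hmd] at hb
    linarith
  · left
    push Not at h
    have hup := radialEnergy_cap_le_of_spread (L := 6 * R) hf.integrable hf.nonneg
      fun a => (h a).le
    have hle : ∫ x, rearrangement f x * min (‖x‖ ^ 2) (R ^ 2) ≤ m * R ^ 2 := by
      rw [hmd, ← integral_rearrangement hn hf, ← integral_mul_const]
      refine integral_mono (hri.mul_bdd (c := R ^ 2) (by fun_prop)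
        (Filter.Eventually.of_forall fun y => by
          rw [Real.norm_of_nonneg (by positivity)]; exact min_le_right _ _)) (hri.mul_const _)
        fun x => mul_le_mul_of_nonneg_left (min_le_right _ _) (rearrangement_nonneg f x)
    rw [← hmd] at hup
    have := mul_le_mul_of_nonneg_left hle hm.le
    rw [capGap]
    nlinarith

theorem normLp_one_eq {g : Rn n → ℝ} (hg : Integrable g) : normLp 1 g = ∫ x, |g x| := by
  rw [normLp, eLpNorm_one_eq_lintegral_enorm, ← integral_norm_eq_lintegral_enorm hg.1]
  rfl

theorem normLp_one_eq_integral (hf : IsLayered N f) : normLp 1 f = ∫ x, f x := by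
  rw [normLp_one_eq hf.integrable, integral_abs_of_nonneg hf.nonneg]

theorem normLp_sub_rearrangement (hn : 0 < n) (hf : IsLayered N f) (a : Rn n) :
    normLp 1 (fun x => f (x + a) - rearrangement f x) = ∫ x, |f (x + a) - rearrangement f x| :=
  normLp_one_eq ((hf.comp_add a).integrable.sub (integrable_rearrangement hn hf))

theorem asymmetry_nonneg (f : Rn n → ℝ) : 0 ≤ asymmetry f :=
  Real.iInf_nonneg fun _ => div_nonneg ENNReal.toReal_nonneg
    (mul_nonneg zero_le_two ENNReal.toReal_nonneg)

theorem two_mul_asymmetry_le (hn : 0 < n) (hf : IsLayered N f) (hm : 0 < ∫ x, f x) (a : Rn n) :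
    2 * ((∫ x, f x) * asymmetry f) ≤ ∫ x, |f (x + a) - rearrangement f x| := by
  have h : asymmetry f ≤ (∫ x, |f (x + a) - rearrangement f x|) / (2 * ∫ x, f x) := by
    rw [← normLp_sub_rearrangement hn hf, ← normLp_one_eq_integral hf]
    refine ciInf_le ⟨0, ?_⟩ a
    rintro _ ⟨a, rfl⟩
    exact div_nonneg ENNReal.toReal_nonneg (mul_nonneg zero_le_two ENNReal.toReal_nonneg)
  rw [le_div_iff₀ (by positivity)] at h
  linarith

theorem asymmetry_le_one (hn : 0 < n) (hf : IsLayered N f) (hm : 0 < ∫ x, f x) :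
    asymmetry f ≤ 1 := by
  have h := two_mul_asymmetry_le hn hf hm 0
  have hri := integrable_rearrangement hn hf
  have h2 : ∫ x, |f (x + 0) - rearrangement f x| ≤ ∫ x, (f x + rearrangement f x) := by
    refine integral_mono ((hf.comp_add 0).integrable.sub hri).abs (hf.integrable.add hri)
      fun x => ?_
    simp only [add_zero]
    rw [abs_le]
    constructor <;> linarith [hf.nonneg x, rearrangement_nonneg f x]
  rw [integral_add hf.integrable hri, integral_rearrangement hn hf] at h2
  by_contra h1
  nlinarith [not_le.1 h1]

/-- m/N is the mean volume of the level sets, each no larger than the ball of radius R. -/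
theorem integral_div_rpow_le (hn : 0 < n) (hf : IsLayered N f) (hR : 0 < R) (hN : 0 < N)
    (hrad : ∀ t, 0 < t → symmRadius {y | t < f y} ≤ R) :
    ((∫ x, f x) / N) ^ (2 / (n : ℝ)) ≤ unitVol n ^ (2 / (n : ℝ)) * R ^ 2 := by
  have hω := unitVol_pos n
  have hm : ∫ x, f x ≤ N * (R ^ n * unitVol n) := by
    rw [integral_eq_integral_level hf]
    calc ∫ t in Ioo 0 N, volume.real {y | t < f y} ≤ ∫ t in Ioo 0 N, R ^ n * unitVol n := by
          refine setIntegral_mono_on ?_ (integrableOn_const (by simp)) measurableSet_Ioo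
            fun t ht => ?_
          · have := (integrable_layer hf).integral_prod_left
            simp only [integral_layer_fst hf] at this
            exact this
          · have h1 := symmRadius_pow hn {y | t < f y}
            rw [eq_div_iff hω.ne'] at h1
            rw [← h1]
            have h2 := hrad t ht.1
            have h3 := symmRadius_nonneg {y | t < f y}
            gcongr
      _ = N * (R ^ n * unitVol n) := by simp [hN.le]
  have h0 : 0 ≤ ∫ x, f x := integral_nonneg hf.nonneg
  have hn' : (n : ℝ) ≠ 0 := by exact_mod_cast hn.ne'
  calc ((∫ x, f x) / N) ^ (2 / (n : ℝ)) ≤ (R ^ n * unitVol n) ^ (2 / (n : ℝ)) := by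
        refine Real.rpow_le_rpow (by positivity) ?_ (by positivity)
        rw [div_le_iff₀ hN]; linarith
    _ = unitVol n ^ (2 / (n : ℝ)) * R ^ 2 := by
        rw [Real.mul_rpow (by positivity) hω.le, ← Real.rpow_natCast, ← Real.rpow_mul hR.le,
          mul_div_cancel₀ _ hn', Real.rpow_two, mul_comm]

/-- The right-hand side of the stability estimate. -/
def deficitBound (p : ℕ) (f : Rn n → ℝ) : ℝ :=
  normLp 1 f ^ (2 + 2 / (n : ℝ)) * normLp ∞ f ^ (-(2 / (n : ℝ))) * asymmetry f ^ p

/-- Lower bounds for the moment gap of all translates give lower bounds for the energy gap. -/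
theorem capGap_ge (hn : 0 < n) (hf : IsLayered (normLp ∞ f) f) (hR : 0 < R)
    (hs : tsupport (rearrangement f) ⊆ Metric.closedBall 0 R) (p : ℕ)
    (h : ∀ (b : Rn n) (τ : ℝ), 0 < ∫ x, f x → 0 < normLp ∞ f → 0 ≤ τ →
      2 * τ ≤ ∫ x, |f (x + b) - rearrangement f x| → τ = (∫ x, f x) * asymmetry f →
      bathtubConst n * ((∫ x, f x) * ((∫ x, f x) / normLp ∞ f) ^ (2 / (n : ℝ)) * asymmetry f ^ p) ≤
        momentGap R (fun x => f (x + b))) :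
    bathtubConst n * deficitBound p f ≤ capGap R f := by
  have hrad : ∀ t, 0 < t → symmRadius {y | t < f y} ≤ R := fun t ht =>
    symmRadius_level_le hn hf hR hs ht
  have hm0 : 0 ≤ ∫ x, f x := integral_nonneg hf.nonneg
  have hn1 : (1 : ℝ) ≤ n := by exact_mod_cast hn
  rcases hm0.eq_or_lt with hm | hm
  · have h1 := abs_radialEnergy_sub_le (measurable_cap (6 * R)) (abs_cap_le (6 * R))
      (integrable_rearrangement hn hf) hf.integrable
    rw [integral_abs_of_nonneg (rearrangement_nonneg f), integral_abs_of_nonneg hf.nonneg,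
      integral_rearrangement hn hf, ← hm, add_zero, zero_mul, mul_zero] at h1
    have h2 := abs_nonpos_iff.1 h1
    rw [capGap, h2, deficitBound, normLp_one_eq_integral hf, ← hm, Real.zero_rpow (by positivity)]
    simp
  set m := ∫ x, f x with hmd
  have hN : 0 < normLp ∞ f := by
    rcases hf.bound_nonneg.eq_or_lt with h0 | h0
    · have : ∀ x, f x = 0 := fun x => le_antisymm ((hf.le x).trans_eq h0.symm) (hf.nonneg x)
      rw [hmd] at hm
      simp [this] at hm
    · exact h0
  set N := normLp ∞ f with hNd
  set δ := asymmetry f with hδ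
  have hδ0 : 0 ≤ δ := asymmetry_nonneg f
  have hδ1 : δ ≤ 1 := asymmetry_le_one hn hf hm
  set X := (m / N) ^ (2 / (n : ℝ)) with hX
  have hX0 : 0 ≤ X := by positivity
  have hκ := bathtubConst_pos hn
  have e : deficitBound p f = m ^ 2 * X * δ ^ p := by
    rw [deficitBound, normLp_one_eq_integral hf, ← hmd, ← hNd, ← hδ, Real.rpow_add hm,
      Real.rpow_two, Real.rpow_neg hN.le, hX, Real.div_rpow hm.le hN.le]
    ring
  rw [e]
  rcases capGap_dichotomy hn hf hR hs hm with hg | ⟨b, hb⟩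
  · refine le_trans ?_ hg
    have h1 := integral_div_rpow_le hn hf hR hN hrad
    have hω := Real.rpow_pos_of_pos (unitVol_pos n) (2 / (n : ℝ))
    have h2 : bathtubConst n * unitVol n ^ (2 / (n : ℝ)) ≤ 1 := by
      rw [bathtubConst, mul_assoc, inv_mul_cancel₀ hω.ne', mul_one]
      exact inv_le_one_of_one_le₀ (by linarith)
    have h3 : δ ^ p ≤ 1 := pow_le_one₀ hδ0 hδ1
    calc bathtubConst n * (m ^ 2 * X * δ ^ p)
        ≤ bathtubConst n * (m ^ 2 * (unitVol n ^ (2 / (n : ℝ)) * R ^ 2) * 1) := by gcongr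
      _ = m ^ 2 * (bathtubConst n * unitVol n ^ (2 / (n : ℝ))) * R ^ 2 := by ring
      _ ≤ m ^ 2 * 1 * R ^ 2 := by gcongr
      _ = m ^ 2 * R ^ 2 := by ring
  · refine le_trans ?_ hb
    have h1 := h b (m * δ) hm hN (by positivity) (two_mul_asymmetry_le hn hf hm b) rfl
    have h2 := mul_le_mul_of_nonneg_left h1 hm.le
    have h3 : 0 ≤ bathtubConst n * (m ^ 2 * X * δ ^ p) := by positivity
    calc bathtubConst n * (m ^ 2 * X * δ ^ p) ≤ 2 * (bathtubConst n * (m ^ 2 * X * δ ^ p)) := by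
          linarith
      _ = 2 * (m * (bathtubConst n * (m * X * δ ^ p))) := by ring
      _ ≤ _ := by linarith

theorem symmRadius_level_comp_add (b : Rn n) (t : ℝ) :
    symmRadius {y | t < f (y + b)} = symmRadius {y | t < f y} := by
  have : volume {y | t < f (y + b)} = volume {y | t < f y} :=
    measure_preimage_add_right volume b {y | t < f y}
  rw [symmRadius, symmRadius, this]

theorem capGap_ge_of_two_le (hn : 2 ≤ n) (hf : IsLayered (normLp ∞ f) f) (hR : 0 < R)
    (hs : tsupport (rearrangement f) ⊆ Metric.closedBall 0 R) :
    bathtubConst n * deficitBound 2 f ≤ capGap R f := by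
  have hn0 : 0 < n := by omega
  refine capGap_ge hn0 hf hR hs 2 fun b τ hm hN hτ0 hτ hτe => ?_
  have hi : ∫ x, f (x + b) = ∫ x, f x := integral_add_right_eq_self f b
  have h := momentGap_ge_of_two_le (R := R) hn (hf.comp_add b)
    (fun t ht => by rw [symmRadius_level_comp_add]; exact symmRadius_level_le hn0 hf hR hs ht)
    hN (by rwa [hi]) hτ0 (by rwa [rearrangement_comp_add hf])
  rw [hi, hτe] at h
  refine le_trans (mul_le_mul_of_nonneg_left (le_of_eq ?_) (bathtubConst_pos hn0).le) h
  have hX := Real.rpow_pos_of_pos (div_pos hm hN) (2 / (n : ℝ))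
  rw [Real.rpow_sub (div_pos hm hN), Real.rpow_one]
  field_simp

theorem capGap_ge_cube {f : Rn 1 → ℝ} (hf : IsLayered (normLp ∞ f) f) (hR : 0 < R)
    (hs : tsupport (rearrangement f) ⊆ Metric.closedBall 0 R) :
    bathtubConst 1 * deficitBound 3 f ≤ capGap R f := by
  refine capGap_ge one_pos hf hR hs 3 fun b τ hm hN hτ0 hτ hτe => ?_
  have h := momentGap_ge_cube (R := R) (hf.comp_add b)
    (fun t ht => by rw [symmRadius_level_comp_add]; exact symmRadius_level_le one_pos hf hR hs ht)
    hN hτ0 (by rwa [rearrangement_comp_add hf])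
  rw [hτe] at h
  refine le_trans (mul_le_mul_of_nonneg_left (le_of_eq ?_) (bathtubConst_pos one_pos).le) h
  rw [Nat.cast_one, div_one, Real.rpow_two]
  field_simp

/-- Positive mass forces b > 0 and b = ‖f‖_∞, and every level set between 0 and b is D up to a null
set. -/
theorem level_of_isMultipleOfCharFun {f : Rn n → ℝ} (hc : IsMultipleOfCharFun f)
    (hm : 0 < ∫ x, f x) : ∀ t ∈ Ioo 0 (normLp ∞ f), volume.real {y | t < f y} = (∫ x, f x) / normLp ∞ f := by
  obtain ⟨b, D, hD, hfD⟩ := hc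
  have hmono : ∫ x, f x = volume.real D * b := by
    rw [integral_congr_ae hfD, integral_indicator hD]; simp
  have hD0 : volume D ≠ 0 := by
    intro h; rw [hmono, measureReal_def, h] at hm; simp at hm
  have hb : 0 < b := by
    rw [hmono] at hm
    exact pos_of_mul_pos_right hm measureReal_nonneg
  have hN : normLp ∞ f = b := by
    rw [normLp, eLpNorm_congr_ae hfD, eLpNorm_exponent_top, eLpNormEssSup_indicator_const_eq _ _ hD0]
    simp [abs_of_pos hb]
  intro t ht
  rw [hN] at ht ⊢
  rw [hmono, mul_div_assoc, div_self hb.ne', mul_one]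
  refine measureReal_congr ?_
  filter_upwards [hfD] with y hy
  refine propext ?_
  change t < f y ↔ y ∈ D
  rw [hy]
  by_cases hyD : y ∈ D
  · simp [hyD, ht.2]
  · simp [hyD, ht.1.le]

theorem capGap_ge_of_isMultipleOfCharFun {f : Rn 1 → ℝ} (hf : IsLayered (normLp ∞ f) f)
    (hc : IsMultipleOfCharFun f) (hR : 0 < R)
    (hs : tsupport (rearrangement f) ⊆ Metric.closedBall 0 R) :
    bathtubConst 1 * deficitBound 2 f ≤ capGap R f := by
  refine capGap_ge one_pos hf hR hs 2 fun b τ hm hN hτ0 hτ hτe => ?_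
  have h := momentGap_ge_of_level_const (R := R) (V := (∫ x, f x) / normLp ∞ f) (hf.comp_add b)
    (fun t ht => by rw [symmRadius_level_comp_add]; exact symmRadius_level_le one_pos hf hR hs ht)
    hN (fun t ht => by
      rw [← level_of_isMultipleOfCharFun hc hm t ht, measureReal_def, measureReal_def]
      congr 1
      exact measure_preimage_add_right volume b {y | t < f y}) (by positivity) hτ0
    (by rwa [rearrangement_comp_add hf])
  rw [hτe] at h
  refine le_trans (mul_le_mul_of_nonneg_left (le_of_eq ?_) (bathtubConst_pos one_pos).le) h
  rw [Nat.cast_one, div_one, Real.rpow_two]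
  field_simp

end Gap

/-! ### Densities up to null sets -/

section Representative
variable {n : ℕ}

/-- A measurable representative, clamped between 0 and the essential supremum. -/
theorem exists_isLayered {ρ : Rn n → ℝ} (hρ : IsDensity ρ) :
    ∃ f : Rn n → ℝ, IsLayered (normLp ∞ f) f ∧ f =ᵐ[volume] ρ := by
  obtain ⟨h1, h2, h3⟩ := hρ
  set N := normLp ∞ ρ with hN
  have hN0 : 0 ≤ N := ENNReal.toReal_nonneg
  set g := h1.1.mk ρ with hg
  have hgm : Measurable g := h1.1.stronglyMeasurable_mk.measurable
  have hgρ : g =ᵐ[volume] ρ := h1.1.ae_eq_mk.symm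
  have hle : ∀ᵐ x, ρ x ≤ N := by
    filter_upwards [ae_le_eLpNormEssSup (f := ρ) (μ := (volume : Measure (Rn n)))] with x hx
    have := ENNReal.toReal_mono (by simpa [eLpNorm_exponent_top] using h2.2.ne) hx
    rw [toReal_enorm, Real.norm_eq_abs, ← eLpNorm_exponent_top] at this
    exact (le_abs_self _).trans this
  have hae : (fun x => max 0 (min N (g x))) =ᵐ[volume] ρ := by
    filter_upwards [hgρ, hle, h3] with x hx1 hx2 hx3
    rw [hx1, min_eq_right hx2]
    exact max_eq_right hx3
  refine ⟨fun x => max 0 (min N (g x)), ?_, hae⟩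
  rw [normLp, eLpNorm_congr_ae hae]
  exact ⟨by fun_prop, fun x => le_max_left _ _, fun x => max_le hN0 (min_le_left _ _),
    (memLp_one_iff_integrable.1 h1).congr hae.symm⟩

variable {f ρ : Rn n → ℝ}

theorem rearrangement_congr_ae (h : f =ᵐ[volume] ρ) : rearrangement f = rearrangement ρ := by
  funext x
  refine setIntegral_congr_fun measurableSet_Ioi fun t _ => ?_
  have : volume {y | t < |f y|} = volume {y | t < |ρ y|} := by
    refine measure_congr ?_
    filter_upwards [h] with y hy
    exact propext (by change t < |f y| ↔ t < |ρ y|; rw [hy])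
  simp only [symmSet, this]

theorem normLp_congr_ae (h : f =ᵐ[volume] ρ) (p : ℝ≥0∞) : normLp p f = normLp p ρ := by
  rw [normLp, normLp, eLpNorm_congr_ae h]

theorem asymmetry_congr_ae (h : f =ᵐ[volume] ρ) : asymmetry f = asymmetry ρ := by
  unfold asymmetry
  refine iInf_congr fun a => ?_
  rw [normLp_congr_ae h 1, rearrangement_congr_ae h]
  congr 1
  refine normLp_congr_ae ?_ 1
  filter_upwards [(measurePreserving_add_right volume a).quasiMeasurePreserving.ae_eq_comp h]
    with x hx
  simp only [Function.comp] at hx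
  rw [hx]

theorem energyPos_congr_ae (W : Rn n → ℝ) (h : f =ᵐ[volume] ρ) :
    energyPos W f = energyPos W ρ := by
  refine lintegral_congr_ae ?_
  filter_upwards [h] with x hx
  refine lintegral_congr_ae ?_
  filter_upwards [h] with y hy
  rw [hx, hy]

theorem energyNeg_congr_ae (W : Rn n → ℝ) (h : f =ᵐ[volume] ρ) :
    energyNeg W f = energyNeg W ρ := by
  refine lintegral_congr_ae ?_
  filter_upwards [h] with x hx
  refine lintegral_congr_ae ?_
  filter_upwards [h] with y hy
  rw [hx, hy]

theorem stabilityEstimate_congr_ae {W : Rn n → ℝ} {c : ℝ} {p : ℕ} (h : f =ᵐ[volume] ρ)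
    (hf : StabilityEstimate W f c p) : StabilityEstimate W ρ c p := by
  unfold StabilityEstimate energy at *
  rwa [energyPos_congr_ae W h, energyNeg_congr_ae W h, rearrangement_congr_ae h, normLp_congr_ae h,
    normLp_congr_ae h, asymmetry_congr_ae h] at hf

/-- A potential that dominates `c (L² - |x|²)₊` in the sense of radial monotonicity, with `L = 6R`,
inherits the stability of the truncated quadratic profile. -/
theorem stabilityEstimate_of_capGap (hn : 0 < n) {W : Rn n → ℝ} (hWm : Measurable W) {w : ℝ → ℝ}
    (hW : ∀ x, x ≠ 0 → W x = w ‖x‖) {c R : ℝ} (hc : 0 ≤ c) (hR : 0 < R)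
    (hw : AntitoneOn (fun r => w r - c * cap (6 * R) r) (Ioi 0))
    (hpos : ∫⁻ x in Metric.ball 0 1, ENNReal.ofReal (W x) ≠ ∞) (hρ : IsDensity ρ)
    (hs : tsupport (rearrangement ρ) ⊆ Metric.closedBall 0 R) (p : ℕ)
    (hgap : ∀ f : Rn n → ℝ, f =ᵐ[volume] ρ → IsLayered (normLp ∞ f) f →
      tsupport (rearrangement f) ⊆ Metric.closedBall 0 R →
      bathtubConst n * deficitBound p f ≤ capGap R f) :
    StabilityEstimate W ρ (c * bathtubConst n) p := by
  obtain ⟨f, hf, hfρ⟩ := exists_isLayered hρ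
  rw [← rearrangement_congr_ae hfρ] at hs
  refine stabilityEstimate_congr_ae hfρ (energy_gap_ge hn hWm hW hc hw hpos hf hR
    (fun x hx => rearrangement_eq_zero_of_lt hs hx) ?_)
  have := mul_le_mul_of_nonneg_left (hgap f hfρ hf hs) hc
  rw [capGap, deficitBound] at this
  refine le_trans (le_of_eq ?_) this
  ring

theorem IsMultipleOfCharFun.congr_ae (h : f =ᵐ[volume] ρ) (hρ : IsMultipleOfCharFun ρ) :
    IsMultipleOfCharFun f := by
  obtain ⟨b, D, hD, hb⟩ := hρ
  exact ⟨b, D, hD, h.trans hb⟩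

end Representative

/-! ### Admissible potentials and power laws -/

section Potentials
variable {n : ℕ}

/-- The derivative of cap is -2r on (0, L) and 0 beyond L; the two pieces are glued at the kink. -/
theorem antitoneOn_sub_cap {w w' : ℝ → ℝ} {c L : ℝ} (hL : 0 < L)
    (hw : ∀ r, 0 < r → HasDerivAt w (w' r) r) (h0 : ∀ r, 0 < r → w' r ≤ 0)
    (h1 : ∀ r ∈ Ioo 0 L, w' r ≤ -(2 * c) * r) :
    AntitoneOn (fun r => w r - c * cap L r) (Ioi 0) := by
  have hs : AntitoneOn (fun r => w r - c * cap L r) (Ioc 0 L) := by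
    have hd : ∀ r, 0 < r → HasDerivAt (fun r => w r - c * (L ^ 2 - r ^ 2)) (w' r + 2 * c * r) r := by
      intro r hr
      have := (hw r hr).sub (((hasDerivAt_pow 2 r).const_sub (L ^ 2)).const_mul c)
      refine this.congr_deriv ?_
      push_cast
      ring
    have ha : AntitoneOn (fun r => w r - c * (L ^ 2 - r ^ 2)) (Ioc 0 L) := by
      refine antitoneOn_of_deriv_nonpos (convex_Ioc 0 L)
        (fun r hr => (hd r hr.1).continuousAt.continuousWithinAt) ?_ ?_
      · rw [interior_Ioc]
        exact fun r hr => (hd r hr.1).differentiableAt.differentiableWithinAt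
      · rw [interior_Ioc]
        intro r hr
        rw [(hd r hr.1).deriv]
        linarith [h1 r hr]
    refine ha.congr fun r hr => ?_
    have : r ^ 2 ≤ L ^ 2 := by have := hr.1; have := hr.2; gcongr
    simp only [cap, max_eq_left (sub_nonneg.2 this)]
  have ht : AntitoneOn (fun r => w r - c * cap L r) (Ici L) := by
    have ha : AntitoneOn w (Ici L) := by
      have hp : ∀ r ∈ Ici L, 0 < r := fun r hr => hL.trans_le hr
      refine antitoneOn_of_deriv_nonpos (convex_Ici L)
        (fun r hr => (hw r (hp r hr)).continuousAt.continuousWithinAt) ?_ ?_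
      · exact fun r hr => (hw r (hp r (interior_subset hr))).differentiableAt.differentiableWithinAt
      · intro r hr
        rw [(hw r (hp r (interior_subset hr))).deriv]
        exact h0 r (hp r (interior_subset hr))
    refine ha.congr fun r hr => ?_
    have : L ^ 2 ≤ r ^ 2 := by have := mem_Ici.1 hr; gcongr
    simp only [cap, max_eq_right (sub_nonpos.2 this), mul_zero, sub_zero]
  have := hs.union_right ht (isGreatest_Ioc hL) isLeast_Ici
  rwa [Ioc_union_Ici_eq_Ioi hL] at this

theorem admissible_profile (hn : 0 < n) {W : Rn n → ℝ} (hW : IsAdmissible W) {L : ℝ} (hL : 0 < L) :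
    ∃ (w : ℝ → ℝ) (c : ℝ), 0 < c ∧ (∀ x, x ≠ 0 → W x = w ‖x‖) ∧
      AntitoneOn (fun r => w r - c * cap L r) (Ioi 0) := by
  obtain ⟨hC, -, w, hw, hneg, c, hc, hc1⟩ := hW
  set e : Rn n := EuclideanSpace.single ⟨0, hn⟩ 1 with he
  have hen : ‖e‖ = 1 := by simp [he]
  have hwC : ContDiffOn ℝ 1 w (Ioi 0) := by
    have h1 : ContDiffOn ℝ 1 (fun r : ℝ => W (r • e)) (Ioi 0) := by
      refine hC.comp (contDiff_id.smul contDiff_const).contDiffOn fun r hr => ?_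
      have : r ≠ 0 := (mem_Ioi.1 hr).ne'
      simp only [mem_compl_iff, mem_singleton_iff, smul_eq_zero, not_or]
      exact ⟨this, fun h => by simp [h] at hen⟩
    refine h1.congr fun r hr => ?_
    have hr' : 0 < r := hr
    rw [hw _ (smul_ne_zero hr'.ne' (fun h => by simp [h] at hen)), norm_smul, hen,
      Real.norm_of_nonneg hr'.le, mul_one]
  have hcont : ContinuousOn (deriv w) (Ioi 0) := hwC.continuousOn_deriv_of_isOpen isOpen_Ioi le_rfl
  have hder : ∀ r, 0 < r → HasDerivAt w (deriv w r) r := fun r hr =>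
    ((hwC.differentiableOn one_ne_zero).differentiableAt (Ioi_mem_nhds hr)).hasDerivAt
  -- Beyond the unit interval the bound comes from compactness: the continuous negative w' has a
  -- negative maximum on [1, max 1 L].
  obtain ⟨c', hc', hc2⟩ : ∃ c', 0 < c' ∧ ∀ r ∈ Icc 1 (max 1 L), deriv w r ≤ -c' * r := by
    obtain ⟨r₀, hr₀, hmax⟩ := isCompact_Icc.exists_isMaxOn
      (nonempty_Icc.2 (le_max_left 1 L))
      (hcont.mono fun r hr => mem_Ioi.2 (lt_of_lt_of_le one_pos hr.1))
    have hr₀' : 0 < r₀ := lt_of_lt_of_le one_pos hr₀.1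
    have hM : 0 < max 1 L := lt_of_lt_of_le one_pos (le_max_left _ _)
    refine ⟨-deriv w r₀ / max 1 L, div_pos (by linarith [hneg r₀ hr₀']) hM, fun r hr => ?_⟩
    have h1 : deriv w r ≤ deriv w r₀ := hmax hr
    refine h1.trans ?_
    rw [neg_mul, div_mul_eq_mul_div, neg_mul, neg_div, neg_neg, le_div_iff₀ hM]
    have := hneg r₀ hr₀'
    nlinarith [hr.2]
  refine ⟨w, min c c' / 2, by positivity, hw,
    antitoneOn_sub_cap hL hder (fun r hr => (hneg r hr).le) fun r hr => ?_⟩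
  rw [mul_div_cancel₀ _ two_ne_zero]
  have h1 := min_le_left c c'
  have h2 := min_le_right c c'
  have hr0 := hr.1
  by_cases hr1 : r < 1
  · refine (hc1 r ⟨hr0, hr1⟩).trans ?_
    nlinarith
  · refine (hc2 r ⟨not_lt.1 hr1, hr.2.le.trans (le_max_right _ _)⟩).trans ?_
    nlinarith

theorem admissible_lintegral_ne_top {W : Rn n → ℝ} (hW : IsAdmissible W) :
    ∫⁻ x in Metric.ball 0 1, ENNReal.ofReal (W x) ≠ ∞ := by
  have h : IntegrableOn W (Metric.ball 0 1) :=
    (hW.2.1.integrableOn_isCompact (isCompact_closedBall 0 1)).mono_set Metric.ball_subset_closedBall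
  refine ne_top_of_le_ne_top h.2.ne (lintegral_mono fun x => ?_)
  rw [← ofReal_norm]
  exact ENNReal.ofReal_le_ofReal (le_abs_self _)

theorem admissible_measurable {W : Rn n → ℝ} (hW : IsAdmissible W) : Measurable W :=
  measurable_of_continuousOn_compl_singleton 0 hW.1.continuousOn

theorem measurable_powerLaw (n : ℕ) (k : ℝ) : Measurable (powerLaw n k) := by
  unfold powerLaw
  split_ifs <;> fun_prop

/-- The radial profile of the power-law potential. -/
def powerProfile (k r : ℝ) : ℝ := if k = 0 then -Real.log r else -(r ^ k) / k

theorem hasDerivAt_powerProfile (k : ℝ) {r : ℝ} (hr : 0 < r) :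
    HasDerivAt (powerProfile k) (-r ^ (k - 1)) r := by
  by_cases hk : k = 0
  · have : powerProfile k = fun r => -Real.log r := by ext; simp [powerProfile, hk]
    rw [this, hk, zero_sub, Real.rpow_neg_one]
    exact (Real.hasDerivAt_log hr.ne').neg
  · have : powerProfile k = fun r => -(r ^ k) / k := by ext; simp [powerProfile, hk]
    rw [this]
    have h := ((Real.hasDerivAt_rpow_const (p := k) (Or.inl hr.ne')).neg).div_const k
    refine h.congr_deriv ?_
    rw [neg_div, mul_div_cancel_left₀ _ hk]

/-- The derivative is -r^(k-2)·r with k - 2 ≤ 0, so r^(k-2) ≥ (6R)^(k-2) on (0, 6R). Since k > -n,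
6^(k-2) ≥ 6^(-n-2), which makes the numerical factor independent of k. -/
theorem antitoneOn_powerProfile_sub_cap {k R : ℝ} (hk : -(n : ℝ) < k) (hk2 : k ≤ 2)
    (hR : 0 < R) :
    AntitoneOn (fun r => powerProfile k r -
      6 ^ (-(n : ℝ) - 2) / 2 * R ^ (k - 2) * cap (6 * R) r) (Ioi 0) := by
  refine antitoneOn_sub_cap (by positivity) (fun r hr => hasDerivAt_powerProfile k hr)
    (fun r hr => by have := Real.rpow_pos_of_pos hr (k - 1); linarith) fun r hr => ?_
  have hr0 : 0 < r := hr.1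
  have h1 : (6 : ℝ) ^ (-(n : ℝ) - 2) * R ^ (k - 2) ≤ r ^ (k - 2) := by
    calc (6 : ℝ) ^ (-(n : ℝ) - 2) * R ^ (k - 2) ≤ 6 ^ (k - 2) * R ^ (k - 2) := by
          have : (6 : ℝ) ^ (-(n : ℝ) - 2) ≤ 6 ^ (k - 2) :=
            Real.rpow_le_rpow_of_exponent_le (by norm_num) (by linarith)
          gcongr
      _ = (6 * R) ^ (k - 2) := (Real.mul_rpow (by norm_num) hR.le).symm
      _ ≤ r ^ (k - 2) := Real.rpow_le_rpow_of_nonpos hr0 hr.2.le (by linarith)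
  have h2 : r ^ (k - 1) = r ^ (k - 2) * r := by
    rw [← Real.rpow_add_one hr0.ne']; congr 1; ring
  rw [h2]
  nlinarith

theorem lintegral_rpow_ball_ne_top (hn : 0 < n) {s : ℝ} (hs : -(n : ℝ) < s) :
    ∫⁻ x in Metric.ball (0 : Rn n) 1, ENNReal.ofReal (‖x‖ ^ s) ≠ ∞ := by
  have : Nonempty (Fin n) := ⟨⟨0, hn⟩⟩
  have h : IntegrableOn (fun x : Rn n => ‖x‖ ^ s) (Metric.ball 0 1) := by
    rw [integrableOn_fun_norm_addHaar volume (f := fun r : ℝ => r ^ s), finrank_euclideanSpace,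
      Fintype.card_fin]
    have h1 : IntegrableOn (fun y : ℝ => y ^ ((n : ℝ) - 1 + s)) (Ioo 0 1) :=
      (intervalIntegral.integrableOn_Ioo_rpow_iff one_pos).2 (by linarith)
    refine h1.congr_fun (fun y hy => ?_) measurableSet_Ioo
    simp only [smul_eq_mul]
    rw [Real.rpow_add hy.1, ← Real.rpow_natCast, Nat.cast_sub hn, Nat.cast_one]
  refine ne_top_of_le_ne_top h.2.ne (lintegral_mono fun x => ?_)
  rw [← ofReal_norm]
  exact ENNReal.ofReal_le_ofReal (le_abs_self _)

theorem powerLaw_lintegral_ne_top (hn : 0 < n) {k : ℝ} (hk : -(n : ℝ) < k) :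
    ∫⁻ x in Metric.ball 0 1, ENNReal.ofReal (powerLaw n k x) ≠ ∞ := by
  have hn1 : (1 : ℝ) ≤ n := by exact_mod_cast hn
  -- For k = 0 the bound is log(1/r) ≤ 2r^(-1/2), and -1/2 > -n; for k > 0 the potential is
  -- nonpositive.
  obtain ⟨s, C, hs, hle⟩ : ∃ s C : ℝ, -(n : ℝ) < s ∧ ∀ x : Rn n, powerLaw n k x ≤ C * ‖x‖ ^ s := by
    rcases lt_trichotomy k 0 with h | h | h
    · refine ⟨k, -k⁻¹, hk, fun x => le_of_eq ?_⟩
      rw [powerLaw, if_neg h.ne]; ring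
    · refine ⟨-(1 / 2), 2, by linarith, fun x => ?_⟩
      rw [powerLaw, if_pos h, ← Real.log_inv]
      have := Real.log_le_rpow_div (inv_nonneg.2 (norm_nonneg x)) (show (0 : ℝ) < 1 / 2 by norm_num)
      rw [Real.inv_rpow (norm_nonneg x), ← Real.rpow_neg (norm_nonneg x)] at this
      linarith
    · refine ⟨0, 0, by linarith, fun x => ?_⟩
      rw [powerLaw, if_neg h.ne', zero_mul]
      exact div_nonpos_of_nonpos_of_nonneg (neg_nonpos.2 (by positivity)) h.le
  have hle' : ∀ x : Rn n, ENNReal.ofReal (powerLaw n k x) ≤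
      ENNReal.ofReal C * ENNReal.ofReal (‖x‖ ^ s) := fun x => by
    rw [← ENNReal.ofReal_mul' (by positivity)]
    exact ENNReal.ofReal_le_ofReal (hle x)
  refine ne_top_of_le_ne_top ?_ (lintegral_mono hle')
  rw [lintegral_const_mul' _ _ ENNReal.ofReal_ne_top]
  exact ENNReal.mul_ne_top ENNReal.ofReal_ne_top (lintegral_rpow_ball_ne_top hn hs)

/-- Stability for admissible potentials, given the gap of the truncated quadratic profile. -/
theorem admissible_stability (hn : 0 < n) {W : Rn n → ℝ} (hW : IsAdmissible W) {R : ℝ}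
    (hR : 0 < R) : ∃ c : ℝ, 0 < c ∧ ∀ (p : ℕ) (ρ : Rn n → ℝ), IsDensity ρ →
      tsupport (rearrangement ρ) ⊆ Metric.closedBall 0 R →
      (∀ f : Rn n → ℝ, f =ᵐ[volume] ρ → IsLayered (normLp ∞ f) f →
        tsupport (rearrangement f) ⊆ Metric.closedBall 0 R →
        bathtubConst n * deficitBound p f ≤ capGap R f) →
      StabilityEstimate W ρ c p := by
  obtain ⟨w, c, hc, hw, hanti⟩ := admissible_profile hn hW (L := 6 * R) (by positivity)
  exact ⟨c * bathtubConst n, mul_pos hc (bathtubConst_pos hn), fun p ρ hρ hs hgap =>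
    stabilityEstimate_of_capGap hn (admissible_measurable hW) hw hc.le hR hanti
      (admissible_lintegral_ne_top hW) hρ hs p hgap⟩

/-- Stability for power laws, given the gap of the truncated quadratic profile. -/
theorem powerLaw_stability (hn : 0 < n) : ∃ c : ℝ, 0 < c ∧ ∀ (p : ℕ) (k : ℝ), -(n : ℝ) < k →
    k ≤ 2 → ∀ R : ℝ, 0 < R → ∀ ρ : Rn n → ℝ, IsDensity ρ →
      tsupport (rearrangement ρ) ⊆ Metric.closedBall 0 R →
      (∀ f : Rn n → ℝ, f =ᵐ[volume] ρ → IsLayered (normLp ∞ f) f →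
        tsupport (rearrangement f) ⊆ Metric.closedBall 0 R →
        bathtubConst n * deficitBound p f ≤ capGap R f) →
      StabilityEstimate (powerLaw n k) ρ (c * R ^ (k - 2)) p := by
  have hκ := bathtubConst_pos hn
  refine ⟨6 ^ (-(n : ℝ) - 2) / 2 * bathtubConst n, by positivity,
    fun p k hk hk2 R hR ρ hρ hs hgap => ?_⟩
  rw [mul_right_comm]
  exact stabilityEstimate_of_capGap hn (measurable_powerLaw n k) (w := powerProfile k)
    (fun x _ => rfl) (by positivity) hR (antitoneOn_powerProfile_sub_cap hk hk2 hR)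
    (powerLaw_lintegral_ne_top hn hk) hρ hs p hgap

end Potentials

end InteractionEnergy

end

open InteractionEnergy in
theorem theorem1 :
    -- dimension `n ≥ 2`
    (∀ n : ℕ, 2 ≤ n →
      (∀ W : Rn n → ℝ, IsAdmissible W → ∀ R : ℝ, 0 < R →
        ∃ c : ℝ, 0 < c ∧ ∀ ρ : Rn n → ℝ, IsDensity ρ →
          tsupport (rearrangement ρ) ⊆ Metric.closedBall 0 R →
          StabilityEstimate W ρ c 2) ∧
      (∃ c : ℝ, 0 < c ∧ ∀ k : ℝ, -(n : ℝ) < k → k ≤ 2 → ∀ R : ℝ, 0 < R →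
        ∀ ρ : Rn n → ℝ, IsDensity ρ →
          tsupport (rearrangement ρ) ⊆ Metric.closedBall 0 R →
          StabilityEstimate (powerLaw n k) ρ (c * R ^ (k - 2)) 2)) ∧
    -- dimension `n = 1`, multiples of characteristic functions
    ((∀ W : Rn 1 → ℝ, IsAdmissible W → ∀ R : ℝ, 0 < R →
        ∃ c : ℝ, 0 < c ∧ ∀ ρ : Rn 1 → ℝ, IsDensity ρ → IsMultipleOfCharFun ρ →
          tsupport (rearrangement ρ) ⊆ Metric.closedBall 0 R →
          StabilityEstimate W ρ c 2) ∧
      (∃ c : ℝ, 0 < c ∧ ∀ k : ℝ, -1 < k → k ≤ 2 → ∀ R : ℝ, 0 < R →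
        ∀ ρ : Rn 1 → ℝ, IsDensity ρ → IsMultipleOfCharFun ρ →
          tsupport (rearrangement ρ) ⊆ Metric.closedBall 0 R →
          StabilityEstimate (powerLaw 1 k) ρ (c * R ^ (k - 2)) 2)) ∧
    -- dimension `n = 1`, general densities
    ((∀ W : Rn 1 → ℝ, IsAdmissible W → ∀ R : ℝ, 0 < R →
        ∃ c : ℝ, 0 < c ∧ ∀ ρ : Rn 1 → ℝ, IsDensity ρ →
          tsupport (rearrangement ρ) ⊆ Metric.closedBall 0 R →
          StabilityEstimate W ρ c 3) ∧
      (∃ c : ℝ, 0 < c ∧ ∀ k : ℝ, -1 < k → k ≤ 2 → ∀ R : ℝ, 0 < R →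
        ∀ ρ : Rn 1 → ℝ, IsDensity ρ →
          tsupport (rearrangement ρ) ⊆ Metric.closedBall 0 R →
          StabilityEstimate (powerLaw 1 k) ρ (c * R ^ (k - 2)) 3)) := by
  refine ⟨fun n hn => ⟨fun W hW R hR => ?_, ?_⟩, ⟨fun W hW R hR => ?_, ?_⟩,
    fun W hW R hR => ?_, ?_⟩
  · obtain ⟨c, hc, h⟩ := admissible_stability (by omega) hW hR
    exact ⟨c, hc, fun ρ hρ hs => h 2 ρ hρ hs fun f _ hf hs => capGap_ge_of_two_le hn hf hR hs⟩
  · obtain ⟨c, hc, h⟩ := powerLaw_stability (n := n) (by omega)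
    exact ⟨c, hc, fun k hk hk2 R hR ρ hρ hs => h 2 k hk hk2 R hR ρ hρ hs fun f _ hf hs =>
      capGap_ge_of_two_le hn hf hR hs⟩
  · obtain ⟨c, hc, h⟩ := admissible_stability one_pos hW hR
    exact ⟨c, hc, fun ρ hρ hch hs => h 2 ρ hρ hs fun f hfρ hf hs =>
      capGap_ge_of_isMultipleOfCharFun hf (hch.congr_ae hfρ) hR hs⟩
  · obtain ⟨c, hc, h⟩ := powerLaw_stability (n := 1) one_pos
    exact ⟨c, hc, fun k hk hk2 R hR ρ hρ hch hs => h 2 k (by simpa using hk) hk2 R hR ρ hρ hs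
      fun f hfρ hf hs => capGap_ge_of_isMultipleOfCharFun hf (hch.congr_ae hfρ) hR hs⟩
  · obtain ⟨c, hc, h⟩ := admissible_stability one_pos hW hR
    exact ⟨c, hc, fun ρ hρ hs => h 3 ρ hρ hs fun f _ hf hs => capGap_ge_cube hf hR hs⟩
  · obtain ⟨c, hc, h⟩ := powerLaw_stability (n := 1) one_pos
    exact ⟨c, hc, fun k hk hk2 R hR ρ hρ hs => h 3 k (by simpa using hk) hk2 R hR ρ hρ hs
      fun f _ hf hs => capGap_ge_cube hf hR hs⟩
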